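/- Let $h>0$, let $\Omega=\{x\in\mathbb R^3: |x_3|<h\}$, and let $k$ be a nonzero integer. For $0<R_0<R_1<\infty$ let $A_{R_0,R_1}=\{z\in\mathbb C: R_0<|z|<R_1\}$. Let $\mathcal A(\Omega)$ be the set of proper conformal harmonic immersions $F:A_{R_0,R_1}\to\Omega$ (over all such $R_0,R_1$). For such an $F$, let $N=F_x\times F_y/|F_x\times F_y|$ and let $g=(N_1+iN_2)/(1-N_3)$ be the Gauss map. Let $\mathcal A(\Omega,k)$ be the set of $F\in\mathcal A(\Omega)$ for which $g$ takes values in $\mathbb C\setminus\{0\}$ and has winding number $k$ along the circles $\{|z|=r\}$, $R_0<r<R_1$. With $P_k(z)=z^k$, let $$\mathcal A^*(\Omega,k)=\{F\in\mathcal A(\Omega,k): F=G\circ P_k \text{ for some } G\in\mathcal A(\Omega,1)\}$$ (the domain of $G$ being the annulus $P_k(A_{R_0,R_1})$). Let $\mathrm{Area}(F)=\int_{A_{R_0,R_1}}|F_x\times F_y|\,dx\,dy\in[0,\infty]$, so that area is counted with multiplicity. For $c>0$ let $F_c(e^{t+i\theta})=c(\cosh t\cos\theta,\cosh t\sin\theta,t)$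 be the vertical catenoid, parametrized by $\mathbb C\setminus\{0\}$, and let $W_c=\{e^{-h/c}<|z|<e^{h/c}\}$, so that $F_c(W_c)$ is its part in $\Omega$. For an open set $D\subset\mathbb C\setminus\{0\}$, call $F_c|_D$ stable if the second variation of area $\int_D(|\nabla u|^2-|A|^2u^2)\,dA$ is nonnegative for all $u\in C_c^\infty(D)$. Call $F_c(W_c)$ marginally stable if $F_c|_{W_c}$ is stable while $F_c|_D$ is not stable for any connected open $D\subset\mathbb C\setminus\{0\}$ properly containing $W_c$. Then there is exactly one $c>0$ for which $F_c(W_c)$ is marginally stable. For this $c$, let $C_\Omega=F_c(W_c)$, the maximally symmetric marginally stable catenoid waist in $\Omega$. The map $F_c\circ P_k$, on the annulus that $P_k$ maps onto $W_c$, is an element of $\mathcal A^*(\Omega,k)$ of finite area, and $$\mathrm{Area}(F)\ \ge\ \mathrm{Area}(F_c\circ P_k)\qquad\text{for every }F\in\mathcal A^*(\Omega,k).$$ Equality holds if and only if $F$ is a $k$-fold cover of a horizontal translate of $C_\Omega$, that is, $F=G\circ P_k$ with $G\in\mathcal A(\Omega,1)$ injective and with image $C_\Omega+v$ for some $v\in\mathbb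 R^3$ with $v_3=0$. -/

import Mathlib

open Set MeasureTheory
open scoped ContDiff ENNReal

noncomputable section

/-- Euclidean three-space. -/
abbrev E3 : Type := EuclideanSpace ℝ (Fin 3)

/-- The open annulus `{R₀ < |z| < R₁}` in the plane. -/
def annulusDomain (R₀ R₁ : ℝ) : Set ℂ := {z | R₀ < ‖z‖ ∧ ‖z‖ < R₁}

/-- The open horizontal slab `{-h < x₃ < h}`. -/
def slab (h : ℝ) : Set E3 := {p | -h < p 2 ∧ p 2 < h}

/-- The cross product of `E3`. -/
def cross3 (a b : E3) : E3 :=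
  WithLp.toLp 2 (crossProduct (WithLp.ofLp a) (WithLp.ofLp b))

/-- The vector `F_x × F_y` of a parametrized surface, at `z = x + i y`. -/
def normalVector (F : ℂ → E3) (z : ℂ) : E3 :=
  cross3 (fderiv ℝ F z 1) (fderiv ℝ F z Complex.I)

/-- The unit normal `(F_x × F_y) / |F_x × F_y|` of a parametrized surface. -/
def unitNormal (F : ℂ → E3) (z : ℂ) : E3 :=
  ‖normalVector F z‖⁻¹ • normalVector F z

/-- The area of the parametrized surface `F` over `{R₀ < |z| < R₁}`, that is `∫ |F_x × F_y| dx dy`;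
it counts multiplicity and may be infinite. -/
def area (R₀ R₁ : ℝ) (F : ℂ → E3) : ℝ≥0∞ :=
  ∫⁻ z in annulusDomain R₀ R₁, ENNReal.ofReal ‖normalVector F z‖

/-- The Gauss map, as a function with values in the extended plane, through the stereographic
projection from the north pole. (The value where the unit normal is the north pole is irrelevant,
see `HasWindingNumber`.) -/
def gaussMap (F : ℂ → E3) (z : ℂ) : ℂ :=
  ((unitNormal F z 0 : ℂ) + (unitNormal F z 1 : ℂ) * Complex.I) / (1 - (unitNormal F z 2 : ℂ))

/-- `F` is a proper conformal harmonic immersion of the annulus `{R₀ < |z| < R₁}` into the slab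
`{|x₃| < h}`. `ConformalAt` says that the derivative is a nonzero multiple of a linear isometry,
so that conformal maps are immersions. -/
structure IsMinimalAnnulus (h R₀ R₁ : ℝ) (F : ℂ → E3) : Prop where
  inner_pos : 0 < R₀
  inner_lt_outer : R₀ < R₁
  mapsTo : MapsTo F (annulusDomain R₀ R₁) (slab h)
  proper : IsProperMap (mapsTo.restrict F (annulusDomain R₀ R₁) (slab h))
  harmonic : InnerProductSpace.HarmonicOnNhd F (annulusDomain R₀ R₁)
  conformal : ∀ z ∈ annulusDomain R₀ R₁, ConformalAt F z

/-- The Gauss map of `F` avoids `∞` and `0` on the annulus `{R₀ < |z| < R₁}` and winds `k` times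
around `0` along the circles `|z| = r`: a continuous logarithm of it along such a circle
increases by `2πik`. -/
def HasWindingNumber (R₀ R₁ : ℝ) (F : ℂ → E3) (k : ℤ) : Prop :=
  (∀ z ∈ annulusDomain R₀ R₁, unitNormal F z 2 ≠ 1 ∧ gaussMap F z ≠ 0) ∧
  ∀ r ∈ Ioo R₀ R₁, ∃ φ : ℝ → ℂ, Continuous φ ∧
    (∀ t, Complex.exp (φ t) = gaussMap F (circleMap 0 r t)) ∧
    ∀ t, φ (t + 2 * Real.pi) = φ t + k * (2 * Real.pi * Complex.I)

/-- The class `𝒜(Ω, k)`: minimal annuli in the slab with winding number `k`. -/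
def IsMinimalAnnulusOfDegree (h : ℝ) (k : ℤ) (R₀ R₁ : ℝ) (F : ℂ → E3) : Prop :=
  IsMinimalAnnulus h R₀ R₁ F ∧ HasWindingNumber R₀ R₁ F k

/-- `F = G ∘ P_k`, where `P_k(z) = z ^ k`, as maps defined on annuli. -/
def IsPowerCover (k : ℤ) (R₀ R₁ : ℝ) (F : ℂ → E3) (S₀ S₁ : ℝ) (G : ℂ → E3) : Prop :=
  (fun z : ℂ => z ^ k) '' annulusDomain R₀ R₁ = annulusDomain S₀ S₁ ∧
  EqOn F (fun z => G (z ^ k)) (annulusDomain R₀ R₁)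

/-- The class `𝒜*(Ω, k)`: the elements of `𝒜(Ω, k)` of the form `G ∘ P_k` with
`G` in `𝒜(Ω, 1)`. -/
def IsCoverAnnulus (h : ℝ) (k : ℤ) (R₀ R₁ : ℝ) (F : ℂ → E3) : Prop :=
  IsMinimalAnnulusOfDegree h k R₀ R₁ F ∧
  ∃ (S₀ S₁ : ℝ) (G : ℂ → E3),
    IsMinimalAnnulusOfDegree h 1 S₀ S₁ G ∧ IsPowerCover k R₀ R₁ F S₀ S₁ G

/-- The parametrization `e^{t + iθ} ↦ c (cosh t cos θ, cosh t sin θ, t)`, on `z ≠ 0`, of the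
complete vertical catenoid of neck radius `c` that is symmetric in the plane `x₃ = 0`. -/
def catenoid (c : ℝ) (z : ℂ) : E3 :=
  !₂[c * Real.cosh (Real.log ‖z‖) * (z.re / ‖z‖), c * Real.cosh (Real.log ‖z‖) * (z.im / ‖z‖),
    c * Real.log ‖z‖]

/-- The parameter domain of the part of `catenoid c` in the slab `{|x₃| < h}`. -/
def waistDomain (h c : ℝ) : Set ℂ := annulusDomain (Real.exp (-(h / c))) (Real.exp (h / c))

/-- Stability, on an open set `D`, of a conformally parametrized minimal surface `F`: the second
variation of area `∫ |∇u|² - |A|² u²` is nonnegative for compactly supported normal variations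
`u N`. In a conformal coordinate `z = x + i y` it is
`∫ (u_x² + u_y²) - (|N_x|² + |N_y|²) u² dx dy`, where `N` is the unit normal. -/
def IsStableOn (F : ℂ → E3) (D : Set ℂ) : Prop :=
  ∀ u : ℂ → ℝ, ContDiff ℝ ∞ u → HasCompactSupport u → tsupport u ⊆ D →
    0 ≤ ∫ z in D, (((fderiv ℝ u z 1) ^ 2 + (fderiv ℝ u z Complex.I) ^ 2) -
      (‖fderiv ℝ (unitNormal F) z 1‖ ^ 2 + ‖fderiv ℝ (unitNormal F) z Complex.I‖ ^ 2) * u z ^ 2)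

/-- The part in the slab `{|x₃| < h}` of the catenoid of neck radius `c` that shares the symmetries
of the slab is marginally stable: it is stable, and every larger connected open part of the
complete catenoid is unstable. -/
def IsMarginallyStableWaist (h c : ℝ) : Prop :=
  0 < c ∧ IsStableOn (catenoid c) (waistDomain h c) ∧
  ∀ D : Set ℂ, IsOpen D → IsPreconnected D → waistDomain h c ⊂ D → D ⊆ {0}ᶜ →
    ¬ IsStableOn (catenoid c) D

/-- `F` is the `k`-fold cover `G ∘ P_k` of an injective parametrization `G`, in `𝒜(Ω, 1)`,
of a horizontal translate of the part in the slab of the catenoid of neck radius `c`. -/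
def IsCoverOfWaist (h c : ℝ) (k : ℤ) (R₀ R₁ : ℝ) (F : ℂ → E3) : Prop :=
  ∃ (v : E3) (S₀ S₁ : ℝ) (G : ℂ → E3), v 2 = 0 ∧
    IsMinimalAnnulusOfDegree h 1 S₀ S₁ G ∧ InjOn G (annulusDomain S₀ S₁) ∧
    G '' annulusDomain S₀ S₁ = (fun p => p + v) '' (catenoid c '' waistDomain h c) ∧
    IsPowerCover k R₀ R₁ F S₀ S₁ G

end

/-!
The area of `G ∘ P_k` is `|k|` times the area of `G` (`area_of_isPowerCover`), so everything reduces
to annuli `G` of degree one, and to those of finite area. Work in the coordinate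
`w = t + i θ = log z`, in which the annulus is a strip and maps on it are `2πi`-periodic.

**The height is affine in `log |z|`** (`IsMinimalAnnulus.height_eq`). By conformality the
energy density is twice the area element, so a surface of finite area has finite energy and almost
every radius has finite length. Such a radius has bounded image, and by properness its height tends
to `h` or `-h` at each end. The height is thus a function of finite energy whose boundary values are
`±h` almost everywhere. It cannot jump between the two: a nonconstant step function has squared `L²`
modulus of continuity of order `δ`, whereas finite energy gives `o(δ)`
(`tendsto_fourierMode_of_finite_energy`). So the nonzero Fourier modes of the height vanish at both
ends, and a harmonic function with this property is affine in `t`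
(`constant_gradient_of_fourierMode_tendsto`). This replaces any regularity theory at the boundary.

**The area inequality** (`IsMinimalAnnulusOfDegree.waistArea_le`). Let `α` be the slope of the height.
Since the Gauss map has winding number one, it is `exp (w + 2ψ)` with `ψ` holomorphic and periodic
(`exists_eq_exp_add_two_mul`), and by the Weierstrass representation the area element is
`α² cosh² (t + 2 Re ψ)`. Now `cosh (t + 2 Re ψ)` is half the sum of `eᵗ |e^ψ|²` and `e⁻ᵗ |e^{-ψ}|²`.
In the Parseval expansions of these on a circle only odd exponentials `e^{mt}` occur, hence the means
of `cosh (t + 2 Re ψ)` over two circles at distance `s` from the middle one, on either side of it, add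
up to at least `2 cosh s` times the mean over the middle circle (`two_cosh_mul_integral_cosh_le`).
That mean is at least `1`, so by the Cauchy–Schwarz inequality the means of the squares add up to at
least `2 cosh² s` (`four_pi_mul_cosh_sq_le`). Integrated over `s`, this gives the area of the catenoid
waist with the same height and the same conformal type. In the case of equality `ψ`
is constant, the Gauss map is linear in `z`, and the Weierstrass representation identifies the surface
with a horizontal translate of a catenoid (`IsMinimalAnnulus.eq_catenoid_add`).

**The best catenoid.** The waist `{|t| < T}` of neck radius `h / T` has least area exactly for the
solution `s` of `s tanh s = 1` (`waistArea_lt`). This is also marginal stability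
(`isMarginallyStableWaist_iff`), since `±s` are the zeros of the Jacobi function `1 - t tanh t`, the
normal component of dilations. On `{|t| < s}` the second variation is nonnegative by completing a
square (`isStableOn_catenoid`). On a larger connected domain, the Jacobi function extended by zero has
vanishing second variation and a corner inside the domain, so a perturbation there makes the second
variation negative (`not_isStableOn_catenoid`).

Conversely, an injective parametrization of a translate of the waist has the area of the waist,
because area is invariant under reparametrization (`area_eq_of_injOn_of_image_eq`).
-/

noncomputable section

/-! ### Area in logarithmic coordinates -/

lemma isOpen_annulusDomain (R₀ R₁ : ℝ) : IsOpen (annulusDomain R₀ R₁) :=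
  (isOpen_lt continuous_const continuous_norm).inter (isOpen_lt continuous_norm continuous_const)

lemma exp_mem_annulusDomain_iff {R₀ R₁ : ℝ} (h₀ : 0 < R₀) (h₁ : 0 < R₁) (w : ℂ) :
    Complex.exp w ∈ annulusDomain R₀ R₁ ↔ w.re ∈ Ioo (Real.log R₀) (Real.log R₁) := by
  simp only [annulusDomain, mem_ofPred_eq, Complex.norm_exp, mem_Ioo,
    Real.lt_log_iff_exp_lt h₁, Real.log_lt_iff_lt_exp h₀]

lemma annulusDomain_ne_zero {R₀ R₁ : ℝ} (h₀ : 0 < R₀) {z : ℂ} (hz : z ∈ annulusDomain R₀ R₁) :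
    z ≠ 0 := by
  rintro rfl
  have := hz.1
  simp at this
  linarith

lemma cross3_apply (a b : E3) :
    cross3 a b = !₂[a 1 * b 2 - a 2 * b 1, a 2 * b 0 - a 0 * b 2, a 0 * b 1 - a 1 * b 0] := by
  simp [cross3, cross_apply]

lemma cross3_linear_combination (a b : E3) (p q r s : ℝ) :
    cross3 (p • a + q • b) (r • a + s • b) = (p * s - r * q) • cross3 a b := by
  simp only [cross3_apply]
  ext i
  fin_cases i <;> simp <;> ring

lemma continuous_cross3 : Continuous fun p : E3 × E3 => cross3 p.1 p.2 := by
  simp only [cross3_apply]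
  refine (PiLp.continuous_toLp 2 _).comp (continuous_pi fun i => ?_)
  fin_cases i <;> simp <;> fun_prop

lemma clm_apply_eq_re_im {V : Type*} [NormedAddCommGroup V] [NormedSpace ℝ V] (L : ℂ →L[ℝ] V)
    (z : ℂ) : L z = z.re • L 1 + z.im • L Complex.I := by
  conv_lhs => rw [← Complex.re_add_im z]
  have h1 : (z.re : ℂ) = z.re • (1 : ℂ) := by simp
  have h2 : (z.im : ℂ) * Complex.I = z.im • Complex.I := by simp
  rw [h1, h2, map_add, map_smul, map_smul]

lemma det_clm_complex (A : ℂ →L[ℝ] ℂ) :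
    A.det = (A 1).re * (A Complex.I).im - (A Complex.I).re * (A 1).im := by
  rw [ContinuousLinearMap.det, ← LinearMap.det_toMatrix Complex.basisOneI, Matrix.det_fin_two]
  simp [LinearMap.toMatrix_apply]

lemma normalVector_congr {F G : ℂ → E3} {z : ℂ} (h : F =ᶠ[nhds z] G) :
    normalVector F z = normalVector G z := by
  simp only [normalVector, h.fderiv_eq]

/-- Under a change of parameter the normal vector is multiplied by the Jacobian determinant. -/
lemma normalVector_comp {F : ℂ → E3} {P : ℂ → ℂ} {z : ℂ} (hF : DifferentiableAt ℝ F (P z))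
    (hP : DifferentiableAt ℝ P z) :
    normalVector (fun z => F (P z)) z = (fderiv ℝ P z).det • normalVector F (P z) := by
  have h : fderiv ℝ (fun z => F (P z)) z = (fderiv ℝ F (P z)).comp (fderiv ℝ P z) :=
    fderiv_comp z hF hP
  rw [normalVector, h, ContinuousLinearMap.comp_apply, ContinuousLinearMap.comp_apply,
    clm_apply_eq_re_im (fderiv ℝ F (P z)) (fderiv ℝ P z 1),
    clm_apply_eq_re_im (fderiv ℝ F (P z)) (fderiv ℝ P z Complex.I), cross3_linear_combination,
    det_clm_complex, normalVector]

lemma fderiv_real_apply {P : ℂ → ℂ} {z p : ℂ} (hP : HasDerivAt P p z) (v : ℂ) :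
    fderiv ℝ P z v = p * v := by
  have h := (hP.hasFDerivAt.restrictScalars ℝ).fderiv
  rw [h]
  simp [mul_comm]

/-- The real Jacobian determinant of a holomorphic map is the squared modulus of its derivative. -/
lemma normalVector_comp_holomorphic {F : ℂ → E3} {P : ℂ → ℂ} {z p : ℂ}
    (hF : DifferentiableAt ℝ F (P z)) (hP : HasDerivAt P p z) :
    normalVector (fun z => F (P z)) z = (‖p‖ ^ 2) • normalVector F (P z) := by
  rw [normalVector_comp hF (hP.differentiableAt.restrictScalars ℝ), det_clm_complex,
    fderiv_real_apply hP, fderiv_real_apply hP]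
  congr 1
  rw [← Complex.normSq_eq_norm_sq, Complex.normSq_apply]
  simp

lemma continuousOn_normalVector {F : ℂ → E3} {U : Set ℂ} (hU : IsOpen U)
    (hF : ContDiffOn ℝ 1 F U) : ContinuousOn (normalVector F) U := by
  have h := hF.continuousOn_fderiv_of_isOpen hU le_rfl
  exact continuous_cross3.comp_continuousOn
    ((h.clm_apply continuousOn_const).prodMk (h.clm_apply continuousOn_const))

/-- Integration of a nonnegative continuous function over an annulus in logarithmic polar coordinates.
The inner integral is an integral of a real function over a compact circle, so only the outer one can
be infinite. -/
lemma lintegral_annulusDomain {R₀ R₁ : ℝ} (h₀ : 0 < R₀) (h₁ : 0 < R₁) {f : ℂ → ℝ}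
    (hf : ContinuousOn f (annulusDomain R₀ R₁)) (hpos : ∀ z, 0 ≤ f z) :
    ∫⁻ z in annulusDomain R₀ R₁, ENNReal.ofReal (f z) =
      ∫⁻ t in Ioo (Real.log R₀) (Real.log R₁), ENNReal.ofReal
        (∫ θ in (0 : ℝ)..2 * Real.pi, Real.exp (2 * t) * f (Complex.exp (t + θ * Complex.I))) := by
  have hpol : ∀ r θ : ℝ, Complex.polarCoord.symm (r, θ) = r * Complex.exp (θ * Complex.I) := by
    intro r θ; simp [Complex.exp_mul_I]
  have hmem : ∀ r θ : ℝ, 0 < r → (Complex.polarCoord.symm (r, θ) ∈ annulusDomain R₀ R₁ ↔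
      r ∈ Ioo R₀ R₁) := by
    intro r θ hr
    rw [hpol]
    simp [annulusDomain, abs_of_pos hr, Complex.norm_exp_ofReal_mul_I]
  have hcont : ContinuousOn (fun p : ℝ × ℝ => p.1 * f (Complex.polarCoord.symm p))
      (Ioo R₀ R₁ ×ˢ Ioo (-Real.pi) Real.pi) := by
    refine continuousOn_fst.mul (hf.comp ?_ ?_)
    · change ContinuousOn (fun p : ℝ × ℝ => Complex.polarCoord.symm p) _
      simp_rw [Complex.polarCoord_symm_apply]
      fun_prop
    · rintro ⟨r, θ⟩ ⟨hr, _⟩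
      exact (hmem r θ (h₀.trans hr.1)).2 hr
  have hms : MeasurableSet (Ioo R₀ R₁ ×ˢ Ioo (-Real.pi) Real.pi) :=
    measurableSet_Ioo.prod measurableSet_Ioo
  calc
    _ = ∫⁻ z, (annulusDomain R₀ R₁).indicator (fun z => ENNReal.ofReal (f z)) z :=
      (lintegral_indicator (isOpen_annulusDomain _ _).measurableSet _).symm
    _ = ∫⁻ p in polarCoord.target, ENNReal.ofReal p.1 •
          (annulusDomain R₀ R₁).indicator (fun z => ENNReal.ofReal (f z))
            (Complex.polarCoord.symm p) := (Complex.lintegral_comp_polarCoord_symm _).symm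
    _ = ∫⁻ p in polarCoord.target, (Ioo R₀ R₁ ×ˢ Ioo (-Real.pi) Real.pi).indicator
          (fun p => ENNReal.ofReal (p.1 * f (Complex.polarCoord.symm p))) p := by
      refine setLIntegral_congr_fun polarCoord.open_target.measurableSet ?_
      rintro ⟨r, θ⟩ ⟨hr, hθ⟩
      have hr : 0 < r := hr
      by_cases h : r ∈ Ioo R₀ R₁
      · have h' := (hmem r θ hr).2 h
        have h'' : (r, θ) ∈ Ioo R₀ R₁ ×ˢ Ioo (-Real.pi) Real.pi := ⟨h, hθ⟩
        beta_reduce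
        rw [indicator_of_mem h', indicator_of_mem h'', smul_eq_mul,
          ENNReal.ofReal_mul hr.le]
      · have h' := fun h' => h ((hmem r θ hr).1 h')
        have h'' : (r, θ) ∉ Ioo R₀ R₁ ×ˢ Ioo (-Real.pi) Real.pi := fun h' => h h'.1
        beta_reduce
        rw [indicator_of_notMem h', indicator_of_notMem h'',
          smul_eq_mul, mul_zero]
    _ = ∫⁻ p in Ioo R₀ R₁ ×ˢ Ioo (-Real.pi) Real.pi,
          ENNReal.ofReal (p.1 * f (Complex.polarCoord.symm p)) := by
      rw [setLIntegral_indicator hms]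
      congr 2
      refine inter_eq_left.2 ?_
      rintro ⟨r, θ⟩ ⟨hr, hθ⟩
      exact ⟨h₀.trans hr.1, hθ⟩
    _ = ∫⁻ r in Ioo R₀ R₁, ∫⁻ θ in Ioo (-Real.pi) Real.pi,
          ENNReal.ofReal (r * f (Complex.polarCoord.symm (r, θ))) := by
      rw [Measure.volume_eq_prod, ← Measure.prod_restrict, lintegral_prod]
      rw [Measure.prod_restrict]
      exact (hcont.aemeasurable hms).ennreal_ofReal
    _ = ∫⁻ r in Real.exp '' Ioo (Real.log R₀) (Real.log R₁), ∫⁻ θ in Ioo (-Real.pi) Real.pi,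
          ENNReal.ofReal (r * f (Complex.polarCoord.symm (r, θ))) := by
      congr 2
      ext r
      constructor
      · intro hr
        have h0 := h₀.trans hr.1
        exact ⟨Real.log r, ⟨Real.log_lt_log h₀ hr.1, Real.log_lt_log h0 hr.2⟩, Real.exp_log h0⟩
      · rintro ⟨t, ht, rfl⟩
        exact ⟨(Real.log_lt_iff_lt_exp h₀).1 ht.1, (Real.lt_log_iff_exp_lt h₁).1 ht.2⟩
    _ = ∫⁻ t in Ioo (Real.log R₀) (Real.log R₁), ENNReal.ofReal |Real.exp t| *
          ∫⁻ θ in Ioo (-Real.pi) Real.pi,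
            ENNReal.ofReal (Real.exp t * f (Complex.polarCoord.symm (Real.exp t, θ))) := by
      refine lintegral_image_eq_lintegral_abs_deriv_mul measurableSet_Ioo
        (fun t _ => (Real.hasDerivAt_exp t).hasDerivWithinAt) Real.exp_injective.injOn _
    _ = _ := by
      refine setLIntegral_congr_fun measurableSet_Ioo fun t ht => ?_
      have hper : Function.Periodic
          (fun θ : ℝ => Real.exp (2 * t) * f (Complex.exp (t + θ * Complex.I)))
          (2 * Real.pi) := by
        intro θ
        have : (t : ℂ) + ((θ + 2 * Real.pi : ℝ) : ℂ) * Complex.I =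
          (t + θ * Complex.I) + 2 * Real.pi * Complex.I := by push_cast; ring
        simp only [this, Complex.exp_periodic _]
      have hc : Continuous fun θ : ℝ =>
          Real.exp (2 * t) * f (Complex.exp (t + θ * Complex.I)) := by
        refine continuous_const.mul (hf.comp_continuous (by fun_prop) fun θ => ?_)
        rw [exp_mem_annulusDomain_iff h₀ h₁]
        simpa using ht
      have hpi := Real.pi_pos
      have e1 := hper.intervalIntegral_add_eq 0 (-Real.pi)
      rw [zero_add, show -Real.pi + 2 * Real.pi = Real.pi by ring] at e1
      rw [e1, intervalIntegral.integral_of_le (by linarith), integral_Ioc_eq_integral_Ioo,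
        ofReal_integral_eq_lintegral_ofReal, ← lintegral_const_mul']
      · refine lintegral_congr fun θ => ?_
        rw [abs_of_pos (Real.exp_pos t), ← ENNReal.ofReal_mul (Real.exp_pos t).le, hpol,
          Complex.exp_add, Complex.ofReal_exp, ← mul_assoc, ← Real.exp_add, two_mul]
      · exact ENNReal.ofReal_ne_top
      · exact (hc.integrableOn_Icc (a := -Real.pi) (b := Real.pi)).mono_set Ioo_subset_Icc_self
      · exact Filter.Eventually.of_forall fun θ => mul_nonneg (Real.exp_pos _).le (hpos _)

/-- The area, per unit of `t`, of the image of the circle `|z| = e ^ t`: the integral over that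
circle of the area element of `F ∘ exp`. -/
def areaDensity (F : ℂ → E3) (t : ℝ) : ℝ :=
  ∫ θ in (0 : ℝ)..2 * Real.pi, Real.exp (2 * t) * ‖normalVector F (Complex.exp (t + θ * Complex.I))‖

lemma area_eq_lintegral_areaDensity {R₀ R₁ : ℝ} (h₀ : 0 < R₀) (h₁ : 0 < R₁) {F : ℂ → E3}
    (hF : ContDiffOn ℝ 1 F (annulusDomain R₀ R₁)) :
    area R₀ R₁ F =
      ∫⁻ t in Ioo (Real.log R₀) (Real.log R₁), ENNReal.ofReal (areaDensity F t) :=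
  lintegral_annulusDomain h₀ h₁
    (continuousOn_normalVector (isOpen_annulusDomain _ _) hF).norm fun _ => norm_nonneg _

/-- A `k`-fold cover multiplies the area by `|k|`. -/
lemma area_of_isPowerCover {k : ℤ} (hk : k ≠ 0) {R₀ R₁ S₀ S₁ : ℝ} {F G : ℂ → E3}
    (hR₀ : 0 < R₀) (hR₁ : R₀ < R₁) (hS₀ : 0 < S₀) (hS₁ : S₀ < S₁)
    (hF : ContDiffOn ℝ 1 F (annulusDomain R₀ R₁)) (hG : ContDiffOn ℝ 1 G (annulusDomain S₀ S₁))
    (hFG : IsPowerCover k R₀ R₁ F S₀ S₁ G) :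
    area R₀ R₁ F = ENNReal.ofReal |(k : ℝ)| * area S₀ S₁ G := by
  have hR₁' := hR₀.trans hR₁
  have hS₁' := hS₀.trans hS₁
  have hk' : (k : ℝ) ≠ 0 := by exact_mod_cast hk
  rw [area_eq_lintegral_areaDensity hR₀ hR₁' hF, area_eq_lintegral_areaDensity hS₀ hS₁' hG]
  have hmap : ∀ z ∈ annulusDomain R₀ R₁, z ^ k ∈ annulusDomain S₀ S₁ := fun z hz => by
    rw [← hFG.1]; exact ⟨z, hz, rfl⟩
  have himage : Ioo (Real.log S₀) (Real.log S₁) =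
      (fun t => (k : ℝ) * t) '' Ioo (Real.log R₀) (Real.log R₁) := by
    ext s
    constructor
    · intro hs
      have h1 : Complex.exp s ∈ annulusDomain S₀ S₁ := by
        rw [exp_mem_annulusDomain_iff hS₀ hS₁']; simpa using hs
      rw [← hFG.1] at h1
      obtain ⟨z, hz, hzs⟩ := h1
      refine ⟨Real.log ‖z‖, ⟨Real.log_lt_log hR₀ hz.1,
        Real.log_lt_log (hR₀.trans hz.1) hz.2⟩, ?_⟩
      have := congrArg (fun z => Real.log ‖z‖) hzs
      simpa [Complex.norm_exp, Real.log_zpow] using this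
    · rintro ⟨t, ht, rfl⟩
      have h1 : Complex.exp t ∈ annulusDomain R₀ R₁ := by
        rw [exp_mem_annulusDomain_iff hR₀ hR₁']; simpa using ht
      have h2 := hmap _ h1
      rw [← Complex.exp_int_mul, exp_mem_annulusDomain_iff hS₀ hS₁'] at h2
      simpa using h2
  rw [himage, lintegral_image_eq_lintegral_abs_deriv_mul measurableSet_Ioo
    (f' := fun _ => (k : ℝ))
    (fun t _ => by simpa using ((hasDerivAt_id t).const_mul (k : ℝ)).hasDerivWithinAt)
    (fun x _ y _ h => mul_left_cancel₀ hk' h),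
    ← lintegral_const_mul' _ _ ENNReal.ofReal_ne_top]
  refine setLIntegral_congr_fun measurableSet_Ioo fun t ht => ?_
  rw [← ENNReal.ofReal_mul (abs_nonneg _), ← ENNReal.ofReal_mul (abs_nonneg _)]
  congr 1
  have hmem : ∀ θ : ℝ, Complex.exp (t + θ * Complex.I) ∈ annulusDomain R₀ R₁ := fun θ => by
    rw [exp_mem_annulusDomain_iff hR₀ hR₁']; simpa using ht
  have hpt : ∀ θ : ℝ, Real.exp (2 * t) * ‖normalVector F (Complex.exp (t + θ * Complex.I))‖ =
      |(k : ℝ)| * (|(k : ℝ)| * (Real.exp (2 * (k * t)) *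
        ‖normalVector G (Complex.exp (((k * t : ℝ) : ℂ) + ((k * θ : ℝ) : ℂ) * Complex.I))‖)) := by
    intro θ
    set z := Complex.exp (t + θ * Complex.I) with hz
    have hz0 : z ≠ 0 := Complex.exp_ne_zero _
    have hd : HasDerivAt (fun z : ℂ => z ^ k) (k * z ^ (k - 1)) z := hasDerivAt_zpow k z (Or.inl hz0)
    have hGd : DifferentiableAt ℝ G (z ^ k) :=
      (hG.differentiableOn one_ne_zero).differentiableAt
        ((isOpen_annulusDomain _ _).mem_nhds (hmap z (hmem θ)))
    have e1 : normalVector F z = normalVector (fun z => G (z ^ k)) z :=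
      normalVector_congr (Filter.eventuallyEq_of_mem
        ((isOpen_annulusDomain _ _).mem_nhds (hmem θ)) hFG.2)
    have e2 : z ^ k = Complex.exp (((k * t : ℝ) : ℂ) + ((k * θ : ℝ) : ℂ) * Complex.I) := by
      rw [hz, ← Complex.exp_int_mul]; push_cast; ring_nf
    have hnz : ‖z‖ = Real.exp t := by rw [hz, Complex.norm_exp]; simp
    rw [e1, normalVector_comp_holomorphic hGd hd, norm_smul, e2]
    have e3 : Real.exp (2 * t) * ‖‖(k : ℂ) * z ^ (k - 1)‖ ^ 2‖ =
        |(k : ℝ)| * |(k : ℝ)| * Real.exp (2 * (k * t)) := by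
      rw [Real.norm_of_nonneg (sq_nonneg _), norm_mul, norm_zpow, hnz, ← Real.rpow_intCast, ← Real.exp_mul,
        mul_pow, Complex.norm_intCast, ← Real.exp_nat_mul, mul_left_comm, ← Real.exp_add, sq]
      congr 2
      push_cast; ring
    rw [← mul_assoc, e3]; ring
  have hper : Function.Periodic (fun φ : ℝ => Real.exp (2 * (k * t)) *
        ‖normalVector G (Complex.exp (((k * t : ℝ) : ℂ) + (φ : ℂ) * Complex.I))‖)
        (2 * Real.pi) := by
    intro φ
    have : ((k * t : ℝ) : ℂ) + ((φ + 2 * Real.pi : ℝ) : ℂ) * Complex.I =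
      (((k * t : ℝ) : ℂ) + φ * Complex.I) + 2 * Real.pi * Complex.I := by push_cast; ring
    simp only [this, Complex.exp_periodic _]
  have hc : Continuous fun φ : ℝ => Real.exp (2 * (k * t)) *
      ‖normalVector G (Complex.exp (((k * t : ℝ) : ℂ) + (φ : ℂ) * Complex.I))‖ := by
    refine continuous_const.mul (((continuousOn_normalVector (isOpen_annulusDomain _ _)
      hG).comp_continuous (by fun_prop) fun φ => ?_).norm)
    have : (k : ℝ) * t ∈ Ioo (Real.log S₀) (Real.log S₁) := himage ▸ ⟨t, ht, rfl⟩
    rw [exp_mem_annulusDomain_iff hS₀ hS₁']; simpa using this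
  unfold areaDensity
  simp_rw [hpt]
  rw [intervalIntegral.integral_const_mul, intervalIntegral.integral_const_mul]
  congr 1
  rw [intervalIntegral.integral_comp_mul_left (fun φ : ℝ => Real.exp (2 * (k * t)) *
        ‖normalVector G (Complex.exp (((k * t : ℝ) : ℂ) + (φ : ℂ) * Complex.I))‖) hk', mul_zero,
    show (k : ℝ) * (2 * Real.pi) = 0 + k • (2 * Real.pi) by simp,
    hper.intervalIntegral_add_zsmul_eq k 0 (fun t₁ t₂ => hc.intervalIntegrable t₁ t₂), zero_add,
    ← Int.cast_smul_eq_zsmul ℝ, smul_smul, inv_mul_cancel₀ hk', one_smul]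

/-! ### Weierstrass data -/

/-- The real linear form `v ↦ Re (φ v)` on `ℂ`. A real function `u` has this derivative exactly
if `u_x - i u_y = φ`. -/
def reMulCLM (φ : ℂ) : ℂ →L[ℝ] ℝ := Complex.reCLM.comp (ContinuousLinearMap.mul ℝ ℂ φ)

@[simp] lemma reMulCLM_apply (φ v : ℂ) : reMulCLM φ v = (φ * v).re := rfl

/-- `F` has the complex gradient `φ` at `z`: the vector `F_x - i F_y` at `z` is `φ`. -/
def HasComplexGradientAt (F : ℂ → E3) (φ : Fin 3 → ℂ) (z : ℂ) : Prop :=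
  ∀ j, HasFDerivAt (fun w => F w j) (reMulCLM (φ j)) z

lemma HasDerivAt.hasFDerivAt_re {f : ℂ → ℂ} {φ z : ℂ} (h : HasDerivAt f φ z) :
    HasFDerivAt (fun w => (f w).re) (reMulCLM φ) z := by
  have := Complex.reCLM.hasFDerivAt.comp z (h.hasFDerivAt.restrictScalars ℝ)
  refine this.congr_fderiv ?_
  ext v
  simp
  ring

/-- The complex gradient of `log |z|` is `1 / z`. Off the slit plane, `log |z|` is the real part of
`log (-z)`. -/
lemma hasFDerivAt_log_norm {z : ℂ} (hz : z ≠ 0) :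
    HasFDerivAt (fun w : ℂ => Real.log ‖w‖) (reMulCLM z⁻¹) z := by
  by_cases h : z ∈ Complex.slitPlane
  · have := (Complex.hasDerivAt_log h).hasFDerivAt_re
    simpa only [Complex.log_re] using this
  · have h' : -z ∈ Complex.slitPlane := by
      rw [Complex.mem_slitPlane_iff] at h ⊢
      push Not at h
      left
      have : z.re ≠ 0 := fun h0 => hz (Complex.ext h0 h.2)
      simpa using lt_of_le_of_ne h.1 this
    have h2 : HasDerivAt (fun w : ℂ => Complex.log (-w)) z⁻¹ z := by
      have := (Complex.hasDerivAt_log h').comp z (hasDerivAt_neg z)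
      refine this.congr_deriv ?_
      rw [inv_neg]; ring
    have := h2.hasFDerivAt_re
    simpa only [Complex.log_re, norm_neg] using this

lemma HasComplexGradientAt.hasFDerivAt {F : ℂ → E3} {φ : Fin 3 → ℂ} {z : ℂ}
    (h : HasComplexGradientAt F φ z) :
    HasFDerivAt F (fderiv ℝ F z) z ∧ ∀ v j, fderiv ℝ F z v j = (φ j * v).re := by
  have hd : DifferentiableAt ℝ F z := by
    rw [differentiableAt_euclidean]
    exact fun j => (h j).differentiableAt
  refine ⟨hd.hasFDerivAt, fun v j => ?_⟩
  have h1 : HasFDerivAt (fun w => F w j)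
      ((EuclideanSpace.proj j : E3 →L[ℝ] ℝ).comp (fderiv ℝ F z)) z :=
    (EuclideanSpace.proj j : E3 →L[ℝ] ℝ).hasFDerivAt.comp z hd.hasFDerivAt
  have h2 := congrArg (fun L => L v) (h1.unique (h j))
  simpa using h2

lemma hasComplexGradientAt_of_differentiableAt {F : ℂ → E3} {z : ℂ}
    (h : DifferentiableAt ℝ F z) :
    HasComplexGradientAt F
      (fun j => fderiv ℝ (fun w => F w j) z 1 - Complex.I * fderiv ℝ (fun w => F w j) z Complex.I)
      z := by
  intro j
  have hd : DifferentiableAt ℝ (fun w => F w j) z := (differentiableAt_euclidean.1 h) j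
  refine hd.hasFDerivAt.congr_fderiv ?_
  ext v
  rw [clm_apply_eq_re_im]
  simp
  ring

lemma inner_e3 (a b : E3) : inner ℝ a b = a 0 * b 0 + a 1 * b 1 + a 2 * b 2 := by
  simp [PiLp.inner_apply, Fin.sum_univ_three]; ring

lemma norm_sq_e3 (a : E3) : ‖a‖ ^ 2 = a 0 ^ 2 + a 1 ^ 2 + a 2 ^ 2 := by
  rw [EuclideanSpace.norm_sq_eq]; simp [Fin.sum_univ_three]

/-- A map with isotropic nonzero complex gradient is conformal. -/
lemma HasComplexGradientAt.conformalAt {F : ℂ → E3} {φ : Fin 3 → ℂ} {z : ℂ}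
    (h : HasComplexGradientAt F φ z) (hiso : φ 0 ^ 2 + φ 1 ^ 2 + φ 2 ^ 2 = 0) (hne : φ 2 ≠ 0) :
    ConformalAt F z := by
  obtain ⟨h1, h2⟩ := h.hasFDerivAt
  rw [conformalAt_iff h1]
  refine ⟨(Complex.normSq (φ 0) + Complex.normSq (φ 1) + Complex.normSq (φ 2)) / 2, ?_, ?_⟩
  · have := Complex.normSq_pos.2 hne
    have := Complex.normSq_nonneg (φ 0)
    have := Complex.normSq_nonneg (φ 1)
    linarith
  · intro u v
    have hr := congrArg Complex.re hiso
    have hi := congrArg Complex.im hiso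
    simp only [inner_e3, h2, Complex.inner, Complex.normSq_apply]
    simp [sq] at hr hi ⊢
    linear_combination (u.re * v.re - u.im * v.im) / 2 * hr - (u.re * v.im + u.im * v.re) / 2 * hi

/-- The complex gradient of a conformal map is an isotropic vector of `ℂ³`. -/
lemma ConformalAt.isotropic {F : ℂ → E3} {φ : Fin 3 → ℂ} {z : ℂ} (hF : ConformalAt F z)
    (h : HasComplexGradientAt F φ z) : φ 0 ^ 2 + φ 1 ^ 2 + φ 2 ^ 2 = 0 := by
  obtain ⟨h1, h2⟩ := h.hasFDerivAt
  obtain ⟨c, -, hc⟩ := (conformalAt_iff h1).1 hF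
  have e1 := hc 1 1
  have e2 := hc Complex.I Complex.I
  have e3 := hc 1 Complex.I
  simp only [inner_e3, h2, Complex.inner] at e1 e2 e3
  apply Complex.ext
  · simp [sq] at e1 e2 ⊢
    linarith
  · simp [sq] at e3 ⊢
    linarith

lemma HasComplexGradientAt.normalVector_eq {F : ℂ → E3} {φ : Fin 3 → ℂ} {z : ℂ}
    (h : HasComplexGradientAt F φ z) :
    normalVector F z = !₂[(φ 2).re * (φ 1).im - (φ 1).re * (φ 2).im,
      (φ 0).re * (φ 2).im - (φ 2).re * (φ 0).im, (φ 1).re * (φ 0).im - (φ 0).re * (φ 1).im] := by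
  obtain ⟨h1, h2⟩ := h.hasFDerivAt
  rw [normalVector, cross3_apply]
  simp only [h2]
  ext i
  fin_cases i <;> simp <;> ring

/-- The length of `F_x × F_y` is `|F_x - i F_y|² / 2` for conformal maps. -/
lemma HasComplexGradientAt.norm_normalVector {F : ℂ → E3} {φ : Fin 3 → ℂ} {z : ℂ}
    (h : HasComplexGradientAt F φ z) (hiso : φ 0 ^ 2 + φ 1 ^ 2 + φ 2 ^ 2 = 0) :
    ‖normalVector F z‖ =
      (Complex.normSq (φ 0) + Complex.normSq (φ 1) + Complex.normSq (φ 2)) / 2 := by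
  have hr := congrArg Complex.re hiso
  have hi := congrArg Complex.im hiso
  have h0 := Complex.normSq_nonneg (φ 0)
  have h1 := Complex.normSq_nonneg (φ 1)
  have h2 := Complex.normSq_nonneg (φ 2)
  rw [← abs_of_nonneg (norm_nonneg (normalVector F z)),
    ← abs_of_nonneg (show 0 ≤ (Complex.normSq (φ 0) + Complex.normSq (φ 1) +
      Complex.normSq (φ 2)) / 2 by linarith), ← sq_eq_sq_iff_abs_eq_abs, norm_sq_e3,
    h.normalVector_eq]
  simp only [Complex.normSq_apply]
  simp [sq] at hr hi ⊢
  generalize (φ 0).re = a0 at *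
  generalize (φ 1).re = a1 at *
  generalize (φ 2).re = a2 at *
  generalize (φ 0).im = b0 at *
  generalize (φ 1).im = b1 at *
  generalize (φ 2).im = b2 at *
  -- Lagrange's identity
  have hr' : a0 ^ 2 + a1 ^ 2 + a2 ^ 2 = b0 ^ 2 + b1 ^ 2 + b2 ^ 2 := by linarith
  have hi' : a0 * b0 + a1 * b1 + a2 * b2 = 0 := by linarith
  linear_combination (-(a0 * b0 + a1 * b1 + a2 * b2)) * hi' -
    (a0 ^ 2 + a1 ^ 2 + a2 ^ 2 - (b0 ^ 2 + b1 ^ 2 + b2 ^ 2)) / 4 * hr'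

/-- Where the unit normal is not the north pole, the Gauss map is the quotient of
`F₃_x - i F₃_y` by `φ₁ - i φ₂`, and the latter does not vanish. -/
lemma HasComplexGradientAt.gaussMap_mul {F : ℂ → E3} {φ : Fin 3 → ℂ} {z : ℂ}
    (h : HasComplexGradientAt F φ z) (hiso : φ 0 ^ 2 + φ 1 ^ 2 + φ 2 ^ 2 = 0)
    (hF : ConformalAt F z) (hN : unitNormal F z 2 ≠ 1) :
    φ 0 - Complex.I * φ 1 ≠ 0 ∧ gaussMap F z * (φ 0 - Complex.I * φ 1) = φ 2 := by
  have hr := congrArg Complex.re hiso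
  have hi := congrArg Complex.im hiso
  have hnv := h.normalVector_eq
  have hlam := h.norm_normalVector hiso
  set l := ‖normalVector F z‖ with hl
  have hpos : 0 < l := by
    obtain ⟨h1, h2⟩ := h.hasFDerivAt
    obtain ⟨c, hc0, hc⟩ := (conformalAt_iff h1).1 hF
    have e1 := hc 1 1
    have e2 := hc Complex.I Complex.I
    simp only [inner_e3, h2, Complex.inner] at e1 e2
    simp only [Complex.normSq_apply] at hlam
    simp at e1 e2
    linarith
  simp only [Complex.normSq_apply] at hlam
  have hn : ∀ i, unitNormal F z i = l⁻¹ * normalVector F z i := fun i => by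
    simp [unitNormal, hl]
  have hn0 : unitNormal F z 0 = l⁻¹ * ((φ 2).re * (φ 1).im - (φ 1).re * (φ 2).im) := by
    rw [hn, hnv]; simp
  have hn1 : unitNormal F z 1 = l⁻¹ * ((φ 0).re * (φ 2).im - (φ 2).re * (φ 0).im) := by
    rw [hn, hnv]; simp
  have hn2 : unitNormal F z 2 = l⁻¹ * ((φ 1).re * (φ 0).im - (φ 0).re * (φ 1).im) := by
    rw [hn, hnv]; simp
  have hN' : (1 : ℂ) - (unitNormal F z 2 : ℂ) ≠ 0 := by
    intro h0
    apply hN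
    have : (unitNormal F z 2 : ℂ) = 1 := by linear_combination -h0
    exact_mod_cast this
  constructor
  · intro h0
    apply hN
    have r0 := congrArg Complex.re h0
    have i0 := congrArg Complex.im h0
    have hzero : φ 2 = 0 := by
      have : φ 2 ^ 2 = 0 := by
        linear_combination hiso - (φ 0 + Complex.I * φ 1) * h0 - φ 1 ^ 2 * Complex.I_sq
      exact pow_eq_zero_iff two_ne_zero |>.1 this
    simp at r0 i0
    rw [hn2, inv_mul_eq_one₀ hpos.ne', hlam, hzero]
    simp
    have e1 : (φ 0).re = -(φ 1).im := by linarith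
    have e2 : (φ 0).im = (φ 1).re := by linarith
    rw [e1, e2]; ring
  · rw [gaussMap, div_mul_eq_mul_div, div_eq_iff hN', hn0, hn1, hn2]
    have hl' : (l : ℂ) ≠ 0 := by exact_mod_cast hpos.ne'
    push_cast
    field_simp
    rw [hlam]
    simp [sq] at hr hi
    apply Complex.ext
    · simp
      generalize (φ 0).re = a0 at *
      generalize (φ 1).re = a1 at *
      generalize (φ 2).re = a2 at *
      generalize (φ 0).im = b0 at *
      generalize (φ 1).im = b1 at *
      generalize (φ 2).im = b2 at *
      linear_combination -a2 / 2 * hr - b2 / 2 * hi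
    · simp
      generalize (φ 0).re = a0 at *
      generalize (φ 1).re = a1 at *
      generalize (φ 2).re = a2 at *
      generalize (φ 0).im = b0 at *
      generalize (φ 1).im = b1 at *
      generalize (φ 2).im = b2 at *
      linear_combination b2 / 2 * hr - a2 / 2 * hi

/-- The area element of a conformal map in terms of its Weierstrass data. -/
lemma HasComplexGradientAt.norm_normalVector_eq_gaussMap {F : ℂ → E3} {φ : Fin 3 → ℂ} {z : ℂ}
    (h : HasComplexGradientAt F φ z) (hF : ConformalAt F z) (hN : unitNormal F z 2 ≠ 1)
    (hg : gaussMap F z ≠ 0) :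
    φ 2 ≠ 0 ∧
    ‖normalVector F z‖ = ‖φ 2‖ ^ 2 * ((‖gaussMap F z‖ + ‖gaussMap F z‖⁻¹) / 2) ^ 2 := by
  have hiso := hF.isotropic h
  obtain ⟨hne, hgm⟩ := h.gaussMap_mul hiso hF hN
  rw [h.norm_normalVector hiso]
  set g := gaussMap F z
  set η := φ 0 - Complex.I * φ 1 with hη
  set ζ := φ 0 + Complex.I * φ 1 with hζ
  have h2 : φ 2 ≠ 0 := by rw [← hgm]; exact mul_ne_zero hg hne
  refine ⟨h2, ?_⟩
  have hζ' : ζ = -(φ 2) * g := by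
    apply mul_left_cancel₀ hne
    rw [hζ, hη]
    linear_combination hiso - φ 1 ^ 2 * Complex.I_sq + φ 2 * hgm
  have hη' : η = φ 2 / g := by rw [← hgm]; field_simp
  have hsum : Complex.normSq (φ 0) + Complex.normSq (φ 1) =
      (Complex.normSq η + Complex.normSq ζ) / 2 := by
    rw [hη, hζ]
    simp only [Complex.normSq_apply]
    simp
    ring
  have hgn : ‖g‖ ≠ 0 := norm_ne_zero_iff.2 hg
  rw [hsum, hη', hζ']
  simp only [Complex.normSq_eq_norm_sq, norm_mul, norm_div, norm_neg]
  field_simp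
  ring

/-! ### The catenoid -/

/-- The horizontal coordinates of the catenoid are real parts of holomorphic functions. -/
lemma catenoid_apply_zero (c : ℝ) (z : ℂ) :
    catenoid c z 0 = ((c / 2 : ℂ) * (z + z⁻¹)).re := by
  rcases eq_or_ne z 0 with rfl | hz
  · simp [catenoid]
  have h : ‖z‖ ≠ 0 := norm_ne_zero_iff.2 hz
  have h' : Complex.normSq z = ‖z‖ ^ 2 := Complex.normSq_eq_norm_sq z
  have e : catenoid c z 0 = c * Real.cosh (Real.log ‖z‖) * (z.re / ‖z‖) := by simp [catenoid]
  rw [e, Real.cosh_log (norm_pos_iff.2 hz)]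
  rw [show ((c / 2 : ℂ)) = ((c / 2 : ℝ) : ℂ) by push_cast; rfl, Complex.re_ofReal_mul,
    Complex.add_re, Complex.inv_re, h']
  field_simp

lemma catenoid_apply_one (c : ℝ) (z : ℂ) :
    catenoid c z 1 = ((-(c / 2) * Complex.I : ℂ) * (z - z⁻¹)).re := by
  rcases eq_or_ne z 0 with rfl | hz
  · simp [catenoid]
  have h : ‖z‖ ≠ 0 := norm_ne_zero_iff.2 hz
  have h' : Complex.normSq z = ‖z‖ ^ 2 := Complex.normSq_eq_norm_sq z
  have e : catenoid c z 1 = c * Real.cosh (Real.log ‖z‖) * (z.im / ‖z‖) := by simp [catenoid]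
  rw [e, Real.cosh_log (norm_pos_iff.2 hz)]
  rw [show ((-(c / 2) * Complex.I : ℂ)) * (z - z⁻¹) =
    ((c / 2 : ℝ) : ℂ) * (-Complex.I * (z - z⁻¹)) by push_cast; ring, Complex.re_ofReal_mul]
  simp [h']
  field_simp
  ring

lemma catenoid_apply_two (c : ℝ) (z : ℂ) : catenoid c z 2 = c * Real.log ‖z‖ := by
  simp [catenoid]

/-- The complex gradient of the catenoid. -/
def catenoidGradient (c : ℝ) (z : ℂ) : Fin 3 → ℂ :=
  ![c / 2 * (1 - (z ^ 2)⁻¹), -(c / 2) * Complex.I * (1 + (z ^ 2)⁻¹), c * z⁻¹]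

lemma hasComplexGradientAt_catenoid (c : ℝ) {z : ℂ} (hz : z ≠ 0) :
    HasComplexGradientAt (catenoid c) (catenoidGradient c z) z := by
  intro j
  fin_cases j
  · simp only [Fin.zero_eta, catenoid_apply_zero]
    refine HasDerivAt.hasFDerivAt_re ?_
    refine (((hasDerivAt_id z).add (hasDerivAt_inv hz)).const_mul (c / 2 : ℂ)).congr_deriv ?_
    simp [catenoidGradient, ← sub_eq_add_neg]
  · simp only [Fin.mk_one, catenoid_apply_one]
    refine HasDerivAt.hasFDerivAt_re ?_
    refine (((hasDerivAt_id z).sub (hasDerivAt_inv hz)).const_mul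
      (-(c / 2) * Complex.I : ℂ)).congr_deriv ?_
    simp [catenoidGradient]
  · simp only [Fin.reduceFinMk, catenoid_apply_two]
    refine ((hasFDerivAt_log_norm hz).const_mul c).congr_fderiv ?_
    ext v
    simp [catenoidGradient]
    ring

lemma catenoidGradient_isotropic (c : ℝ) {z : ℂ} (hz : z ≠ 0) :
    catenoidGradient c z 0 ^ 2 + catenoidGradient c z 1 ^ 2 + catenoidGradient c z 2 ^ 2 = 0 := by
  simp only [catenoidGradient, Matrix.cons_val]
  field_simp
  linear_combination (c : ℂ) ^ 2 * (z ^ 2 + 1) ^ 2 * Complex.I_sq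

lemma catenoid_conformalAt {c : ℝ} (hc : c ≠ 0) {z : ℂ} (hz : z ≠ 0) :
    ConformalAt (catenoid c) z :=
  (hasComplexGradientAt_catenoid c hz).conformalAt (catenoidGradient_isotropic c hz)
    (by simp [catenoidGradient, hc, hz])

lemma normalVector_catenoid (c : ℝ) {z : ℂ} (hz : z ≠ 0) :
    normalVector (catenoid c) z = (c ^ 2 / 4 * (1 + (Complex.normSq z)⁻¹) ^ 2) •
      !₂[-2 * z.re / (1 + Complex.normSq z), -2 * z.im / (1 + Complex.normSq z),
        1 - 2 / (1 + Complex.normSq z)] := by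
  have hn : 0 < Complex.normSq z := Complex.normSq_pos.2 hz
  have hn' : Complex.normSq z = z.re * z.re + z.im * z.im := Complex.normSq_apply z
  have hr : ((z ^ 2)⁻¹).re = (z.re ^ 2 - z.im ^ 2) / Complex.normSq z ^ 2 := by
    rw [Complex.inv_re, map_pow]; simp [sq]
  have hi : ((z ^ 2)⁻¹).im = -(2 * z.re * z.im) / Complex.normSq z ^ 2 := by
    rw [Complex.inv_im, map_pow]; simp [sq]; ring
  have e0r : (catenoidGradient c z 0).re = c / 2 * (1 - ((z ^ 2)⁻¹).re) := by
    simp [catenoidGradient, -map_pow]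
  have e0i : (catenoidGradient c z 0).im = -(c / 2 * ((z ^ 2)⁻¹).im) := by
    simp [catenoidGradient, -map_pow]
  have e1r : (catenoidGradient c z 1).re = c / 2 * ((z ^ 2)⁻¹).im := by
    simp [catenoidGradient, -map_pow]
  have e1i : (catenoidGradient c z 1).im = -(c / 2 * (1 + ((z ^ 2)⁻¹).re)) := by
    simp [catenoidGradient, -map_pow]
  have e2r : (catenoidGradient c z 2).re = c * (z.re / Complex.normSq z) := by
    simp [catenoidGradient]
  have e2i : (catenoidGradient c z 2).im = -(c * (z.im / Complex.normSq z)) := by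
    simp [catenoidGradient]; ring
  rw [(hasComplexGradientAt_catenoid c hz).normalVector_eq, e0r, e0i, e1r, e1i, e2r, e2i, hr, hi]
  set s := Complex.normSq z
  have h1 : 1 + s ≠ 0 := by positivity
  ext i
  fin_cases i
  · simp
    field_simp
    rw [hn']; ring
  · simp
    field_simp
    rw [hn']; ring
  · simp
    field_simp
    rw [hn']; ring

/-- The inverse stereographic projection from the north pole, composed with `z ↦ -z`. It is the unit
normal of the catenoid. -/
def catenoidNormal (z : ℂ) : E3 :=
  !₂[-2 * z.re / (1 + Complex.normSq z), -2 * z.im / (1 + Complex.normSq z),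
    1 - 2 / (1 + Complex.normSq z)]

lemma norm_catenoidNormal (z : ℂ) : ‖catenoidNormal z‖ = 1 := by
  have h0 := Complex.normSq_nonneg z
  have h1 : 1 + Complex.normSq z ≠ 0 := by positivity
  rw [← sq_eq_sq₀ (norm_nonneg _) zero_le_one, norm_sq_e3]
  simp [catenoidNormal]
  field_simp
  rw [Complex.normSq_apply]; ring

lemma norm_normalVector_catenoid (c : ℝ) {z : ℂ} (hz : z ≠ 0) :
    ‖normalVector (catenoid c) z‖ = c ^ 2 / 4 * (1 + (Complex.normSq z)⁻¹) ^ 2 := by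
  rw [normalVector_catenoid c hz, norm_smul]
  change _ * ‖catenoidNormal z‖ = _
  rw [norm_catenoidNormal, mul_one, Real.norm_of_nonneg (by positivity)]

lemma unitNormal_catenoid {c : ℝ} (hc : c ≠ 0) {z : ℂ} (hz : z ≠ 0) :
    unitNormal (catenoid c) z = catenoidNormal z := by
  have hn : 0 < Complex.normSq z := Complex.normSq_pos.2 hz
  rw [unitNormal, norm_normalVector_catenoid c hz, normalVector_catenoid c hz, smul_smul,
    inv_mul_cancel₀ (by positivity), one_smul]
  rfl

lemma contDiffAt_catenoid (c : ℝ) {z : ℂ} (hz : z ≠ 0) : ContDiffAt ℝ ∞ (catenoid c) z := by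
  have hn : ContDiffAt ℝ ∞ (fun z : ℂ => ‖z‖) z := contDiffAt_norm ℝ hz
  have hn' : ‖z‖ ≠ 0 := norm_ne_zero_iff.2 hz
  rw [contDiffAt_euclidean]
  have hl := hn.log hn'
  intro i
  fin_cases i
  · exact (contDiffAt_const.mul (hl.cosh)).mul (Complex.reCLM.contDiff.contDiffAt.div hn hn')
  · exact (contDiffAt_const.mul (hl.cosh)).mul (Complex.imCLM.contDiff.contDiffAt.div hn hn')
  · exact contDiffAt_const.mul hl

lemma harmonicAt_e3 {F : ℂ → E3} {z : ℂ}
    (h : ∀ j, InnerProductSpace.HarmonicAt (fun w => F w j) z) :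
    InnerProductSpace.HarmonicAt F z := by
  have e : F = fun w => ∑ j, (F w j) • (EuclideanSpace.single j (1 : ℝ) : E3) := by
    ext w i
    simp [Pi.single_apply]
  have hj : ∀ j, InnerProductSpace.HarmonicAt
      (fun w => (F w j) • (EuclideanSpace.single j (1 : ℝ) : E3)) z := fun j =>
    (h j).comp_CLM ((ContinuousLinearMap.id ℝ ℝ).smulRight (EuclideanSpace.single j (1 : ℝ) : E3))
  rw [e]
  simp only [Fin.sum_univ_three]
  exact ((hj 0).add (hj 1)).add (hj 2)

/-- The Gauss map of the catenoid is `-z`, whatever the sign of `c`: the normal vector is quadratic in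
`c`. For `c > 0` it points towards the axis. -/
lemma gaussMap_catenoid {c : ℝ} (hc : c ≠ 0) {z : ℂ} (hz : z ≠ 0) :
    unitNormal (catenoid c) z 2 ≠ 1 ∧ gaussMap (catenoid c) z = -z := by
  have h0 := Complex.normSq_nonneg z
  have h1 : 1 + Complex.normSq z ≠ 0 := by positivity
  have hN : unitNormal (catenoid c) z 2 ≠ 1 := by
    rw [unitNormal_catenoid hc hz]
    simp [catenoidNormal]
    positivity
  refine ⟨hN, ?_⟩
  obtain ⟨h2, h3⟩ := (hasComplexGradientAt_catenoid c hz).gaussMap_mul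
    (catenoidGradient_isotropic c hz) (catenoid_conformalAt hc hz) hN
  apply mul_right_cancel₀ h2
  rw [h3]
  simp only [catenoidGradient, Matrix.cons_val]
  field_simp
  linear_combination (c : ℂ) * (z ^ 2 + 1) * Complex.I_sq

lemma hasDerivAt_zpow_of_ne_zero (k : ℤ) {z : ℂ} (hz : z ≠ 0) :
    HasDerivAt (fun z : ℂ => z ^ k) (k * z ^ (k - 1)) z := hasDerivAt_zpow k z (Or.inl hz)

lemma unitNormal_comp_zpow {F : ℂ → E3} {k : ℤ} (hk : k ≠ 0) {z : ℂ} (hz : z ≠ 0)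
    (hF : DifferentiableAt ℝ F (z ^ k)) :
    unitNormal (fun z => F (z ^ k)) z = unitNormal F (z ^ k) := by
  have hp : (k : ℂ) * z ^ (k - 1) ≠ 0 :=
    mul_ne_zero (by exact_mod_cast hk) (zpow_ne_zero _ hz)
  have hp' : ‖(k : ℂ) * z ^ (k - 1)‖ ^ 2 ≠ 0 := pow_ne_zero _ (norm_ne_zero_iff.2 hp)
  rw [unitNormal, normalVector_comp_holomorphic hF (hasDerivAt_zpow_of_ne_zero k hz), unitNormal,
    norm_smul, Real.norm_of_nonneg (sq_nonneg _), smul_smul, mul_inv_rev, mul_assoc,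
    inv_mul_cancel₀ hp', mul_one]

lemma log_norm_zpow (z : ℂ) (k : ℤ) : Real.log ‖z ^ k‖ = k * Real.log ‖z‖ := by
  rw [norm_zpow, Real.log_zpow]

lemma mem_annulusDomain_exp_iff {a b : ℝ} {z : ℂ} (hz : z ≠ 0) :
    z ∈ annulusDomain (Real.exp a) (Real.exp b) ↔ Real.log ‖z‖ ∈ Ioo a b := by
  have := norm_pos_iff.2 hz
  simp only [annulusDomain, mem_ofPred_eq, mem_Ioo, Real.lt_log_iff_exp_lt this,
    Real.log_lt_iff_lt_exp this]

lemma annulusDomain_exp_ne_zero {a b : ℝ} {z : ℂ}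
    (hz : z ∈ annulusDomain (Real.exp a) (Real.exp b)) : z ≠ 0 :=
  annulusDomain_ne_zero (Real.exp_pos a) hz

/-- The `k`-fold cover of the waist of the catenoid belongs to `𝒜(Ω, k)`. -/
lemma isMinimalAnnulusOfDegree_catenoid_zpow {h c : ℝ} (hh : 0 < h) (hc : 0 < c) {k : ℤ}
    (hk : k ≠ 0) :
    IsMinimalAnnulusOfDegree h k (Real.exp (-(h / (c * |(k : ℝ)|))))
      (Real.exp (h / (c * |(k : ℝ)|))) (fun z => catenoid c (z ^ k)) := by
  have hk' : (0 : ℝ) < |(k : ℝ)| := abs_pos.2 (by exact_mod_cast hk)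
  set T := h / (c * |(k : ℝ)|) with hT
  have hTpos : 0 < T := by positivity
  have habs : ∀ t : ℝ, |c * (k * t)| = c * |(k : ℝ)| * |t| := fun t => by
    rw [abs_mul, abs_mul, abs_of_pos hc, mul_assoc]
  have h2 : ∀ z : ℂ, catenoid c (z ^ k) 2 = c * (k * Real.log ‖z‖) := fun z => by
    rw [catenoid_apply_two, log_norm_zpow]
  have hmaps : MapsTo (fun z => catenoid c (z ^ k))
      (annulusDomain (Real.exp (-T)) (Real.exp T)) (slab h) := by
    intro z hz
    have hz0 := annulusDomain_exp_ne_zero hz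
    rw [mem_annulusDomain_exp_iff hz0, mem_Ioo, ← abs_lt] at hz
    change -h < _ ∧ _ < h
    rw [← abs_lt, h2, habs]
    calc _ < c * |(k : ℝ)| * T := by gcongr
      _ = h := by rw [hT]; field_simp
  have hcd : ∀ z : ℂ, z ≠ 0 → ContDiffAt ℝ ∞ (fun z => catenoid c (z ^ k)) z := by
    intro z hz
    have hp : ContDiffAt ℝ ∞ (fun z : ℂ => z ^ k) z :=
      (show AnalyticAt ℂ (fun z : ℂ => z ^ k) z from
        AnalyticAt.zpow analyticAt_id hz).contDiffAt.restrict_scalars ℝ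
    exact ContDiffAt.comp (g := catenoid c) z (contDiffAt_catenoid c (zpow_ne_zero k hz)) hp
  have hg : ∀ z : ℂ, z ≠ 0 → unitNormal (fun z => catenoid c (z ^ k)) z 2 ≠ 1 ∧
      gaussMap (fun z => catenoid c (z ^ k)) z = -z ^ k := by
    intro z hz
    have hz' := zpow_ne_zero k hz
    have hN := unitNormal_comp_zpow hk hz
      ((hasComplexGradientAt_catenoid c hz').hasFDerivAt.1.differentiableAt)
    obtain ⟨h3, h4⟩ := gaussMap_catenoid hc.ne' hz'
    rw [← h4, hN]
    refine ⟨h3, ?_⟩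
    simp only [gaussMap, hN]
  refine ⟨⟨Real.exp_pos _, Real.exp_lt_exp.2 (by linarith), hmaps, ?_, ?_, ?_⟩, ?_, ?_⟩
  · have hcont : Continuous (hmaps.restrict _ _ _) :=
      ContinuousOn.mapsToRestrict (fun z hz =>
        (hcd z (annulusDomain_exp_ne_zero hz)).continuousAt.continuousWithinAt) hmaps
    rw [isProperMap_iff_isCompact_preimage]
    refine ⟨hcont, fun K hK => ?_⟩
    rcases K.eq_empty_or_nonempty with rfl | hne
    · simp
    -- `|x₃|` attains a maximum `m < h` on `K`, so the preimage of `K` lies in a closed smaller annulus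
    have hc2 : Continuous fun p : slab h => |(p : E3) 2| := by fun_prop
    obtain ⟨q, -, hq⟩ := hK.exists_isMaxOn hne hc2.continuousOn
    set m := |(q : E3) 2| with hm
    have hmh : m < h := abs_lt.2 q.2
    have hm0 : 0 ≤ m := abs_nonneg _
    set m' := m / (c * |(k : ℝ)|) with hm'
    have hm'T : m' < T := by rw [hm', hT]; gcongr
    set Q : Set ℂ := {z | Real.exp (-m') ≤ ‖z‖ ∧ ‖z‖ ≤ Real.exp m'} with hQ
    have hQc : IsCompact Q := by
      refine Metric.isCompact_of_isClosed_isBounded ?_ ?_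
      · exact (isClosed_le continuous_const continuous_norm).inter
          (isClosed_le continuous_norm continuous_const)
      · refine (Metric.isBounded_closedBall (x := (0 : ℂ)) (r := Real.exp m')).subset fun z hz => ?_
        simpa using hz.2
    have hQA : Q ⊆ annulusDomain (Real.exp (-T)) (Real.exp T) := fun z hz =>
      ⟨(Real.exp_lt_exp.2 (by linarith)).trans_le hz.1, hz.2.trans_lt (Real.exp_lt_exp.2 hm'T)⟩
    have hQ' : IsCompact ((↑) ⁻¹' Q : Set (annulusDomain (Real.exp (-T)) (Real.exp T))) := by
      refine Topology.IsInducing.subtypeVal.isCompact_preimage' hQc ?_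
      simpa using hQA
    refine hQ'.of_isClosed_subset (hK.isClosed.preimage hcont) ?_
    rintro ⟨z, hz⟩ hzK
    have h1 : |catenoid c (z ^ k) 2| ≤ m := hq hzK
    have hz0 := annulusDomain_exp_ne_zero hz
    have hzp := norm_pos_iff.2 hz0
    rw [h2, habs] at h1
    have h3 : |Real.log ‖z‖| ≤ m' := by
      rw [hm', le_div_iff₀ (by positivity)]; linarith
    rw [abs_le] at h3
    exact ⟨(Real.le_log_iff_exp_le hzp).1 h3.1, (Real.log_le_iff_le_exp hzp).1 h3.2⟩
  · intro z hz
    have hz0 := annulusDomain_exp_ne_zero hz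
    have hp : AnalyticAt ℂ (fun z : ℂ => z ^ k) z := AnalyticAt.zpow analyticAt_id hz0
    have hpi : AnalyticAt ℂ (fun z : ℂ => (z ^ k)⁻¹) z := hp.inv (zpow_ne_zero k hz0)
    refine harmonicAt_e3 fun j => ?_
    fin_cases j
    · simp only [Fin.zero_eta, catenoid_apply_zero]
      exact AnalyticAt.harmonicAt_re (analyticAt_const.mul (hp.add hpi))
    · simp only [Fin.mk_one, catenoid_apply_one]
      exact AnalyticAt.harmonicAt_re (analyticAt_const.mul (hp.sub hpi))
    · simp only [Fin.reduceFinMk, catenoid_apply_two]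
      exact (AnalyticAt.harmonicAt_log_norm hp (zpow_ne_zero k hz0)).const_smul (c := c)
  · intro z hz
    have hz0 := annulusDomain_exp_ne_zero hz
    refine ConformalAt.comp (g := catenoid c) z (catenoid_conformalAt hc.ne' (zpow_ne_zero k hz0)) ?_
    exact DifferentiableAt.conformalAt (hasDerivAt_zpow_of_ne_zero k hz0).differentiableAt
      (by rw [(hasDerivAt_zpow_of_ne_zero k hz0).deriv]
          exact mul_ne_zero (by exact_mod_cast hk) (zpow_ne_zero _ hz0))
  · intro z hz
    have hz0 := annulusDomain_exp_ne_zero hz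
    obtain ⟨h3, h4⟩ := hg z hz0
    rw [h4]
    exact ⟨h3, neg_ne_zero.2 (zpow_ne_zero k hz0)⟩
  · intro r hr
    have hr0 : 0 < r := (Real.exp_pos _).trans hr.1
    refine ⟨fun t => Real.pi * Complex.I + k * (Real.log r + t * Complex.I), by fun_prop,
      fun t => ?_, fun t => by push_cast; ring⟩
    rw [(hg _ (circleMap_ne_center hr0.ne')).2, Complex.exp_add, Complex.exp_pi_mul_I, neg_one_mul,
      Complex.exp_int_mul, Complex.exp_add, ← Complex.ofReal_exp, Real.exp_log hr0, circleMap_zero]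

lemma contDiffOn_catenoid (c : ℝ) {R₀ R₁ : ℝ} (h₀ : 0 < R₀) :
    ContDiffOn ℝ 1 (catenoid c) (annulusDomain R₀ R₁) := fun z hz =>
  ((contDiffAt_catenoid c (annulusDomain_ne_zero h₀ hz)).of_le (by simp)).contDiffWithinAt

lemma areaDensity_catenoid (c t : ℝ) :
    areaDensity (catenoid c) t = 2 * Real.pi * c ^ 2 * Real.cosh t ^ 2 := by
  have h : ∀ θ : ℝ, Real.exp (2 * t) *
      ‖normalVector (catenoid c) (Complex.exp (t + θ * Complex.I))‖ =
      c ^ 2 * Real.cosh t ^ 2 := by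
    intro θ
    rw [norm_normalVector_catenoid c (Complex.exp_ne_zero _), Complex.normSq_eq_norm_sq,
      Complex.norm_exp, Real.cosh_eq]
    simp only [Complex.add_re, Complex.ofReal_re, Complex.mul_re, Complex.I_re, mul_zero,
      Complex.ofReal_im, Complex.I_im, mul_one, sub_self, add_zero, Real.exp_neg]
    rw [two_mul, Real.exp_add]
    field_simp
    ring
  simp only [areaDensity, h]
  simp
  ring

lemma area_catenoid (c : ℝ) {T : ℝ} (hT : 0 < T) :
    area (Real.exp (-T)) (Real.exp T) (catenoid c) =
      ENNReal.ofReal (∫ t in (-T)..T, 2 * Real.pi * c ^ 2 * Real.cosh t ^ 2) := by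
  rw [area_eq_lintegral_areaDensity (Real.exp_pos _) (Real.exp_pos _)
    (contDiffOn_catenoid c (Real.exp_pos _)), Real.log_exp, Real.log_exp,
    intervalIntegral.integral_of_le (by linarith), integral_Ioc_eq_integral_Ioo,
    ofReal_integral_eq_lintegral_ofReal]
  · simp only [areaDensity_catenoid]
  · refine IntegrableOn.mono_set (Continuous.integrableOn_Icc ?_) Ioo_subset_Icc_self
    fun_prop
  · have := Real.pi_pos
    exact Filter.Eventually.of_forall fun t => by positivity

lemma isPowerCover_catenoid (c : ℝ) {T : ℝ} {k : ℤ} (hk : k ≠ 0) :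
    IsPowerCover k (Real.exp (-(T / |(k : ℝ)|))) (Real.exp (T / |(k : ℝ)|))
      (fun z => catenoid c (z ^ k)) (Real.exp (-T)) (Real.exp T) (catenoid c) := by
  have hk0 : (k : ℂ) ≠ 0 := by exact_mod_cast hk
  have hk' : (0 : ℝ) < |(k : ℝ)| := abs_pos.2 (by exact_mod_cast hk)
  have key : ∀ z : ℂ, z ≠ 0 →
      (z ∈ annulusDomain (Real.exp (-(T / |(k : ℝ)|))) (Real.exp (T / |(k : ℝ)|)) ↔
        z ^ k ∈ annulusDomain (Real.exp (-T)) (Real.exp T)) := by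
    intro z hz
    rw [mem_annulusDomain_exp_iff hz, mem_annulusDomain_exp_iff (zpow_ne_zero k hz), mem_Ioo,
      mem_Ioo, ← abs_lt, ← abs_lt, log_norm_zpow, abs_mul, lt_div_iff₀ hk', mul_comm]
  refine ⟨?_, fun _ _ => rfl⟩
  ext y
  constructor
  · rintro ⟨z, hz, rfl⟩
    exact (key z (annulusDomain_exp_ne_zero hz)).1 hz
  · intro hy
    have hy0 := annulusDomain_exp_ne_zero hy
    have e : Complex.exp (Complex.log y / k) ^ k = y := by
      rw [← Complex.exp_int_mul, mul_div_cancel₀ _ hk0, Complex.exp_log hy0]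
    exact ⟨Complex.exp (Complex.log y / k), (key _ (Complex.exp_ne_zero _)).2 (by rwa [e]), e⟩

/-! ### Boundary values of functions of finite energy -/

lemma sq_intervalIntegral_le {a b : ℝ} (hab : a ≤ b) {f : ℝ → ℝ} (hf : ContinuousOn f (uIcc a b)) :
    (∫ x in a..b, f x) ^ 2 ≤ (b - a) * ∫ x in a..b, f x ^ 2 := by
  rcases hab.eq_or_lt with rfl | hlt
  · simp
  have hi : IntervalIntegrable f volume a b := hf.intervalIntegrable
  have hi2 : IntervalIntegrable (fun x => f x ^ 2) volume a b := (hf.pow 2).intervalIntegrable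
  set m := (∫ x in a..b, f x) / (b - a) with hm
  have hba : 0 < b - a := sub_pos.2 hlt
  have h0 : 0 ≤ ∫ x in a..b, (f x - m) ^ 2 :=
    intervalIntegral.integral_nonneg hab fun x _ => sq_nonneg _
  have h1 : ∫ x in a..b, (f x - m) ^ 2 =
      (∫ x in a..b, f x ^ 2) - 2 * m * (∫ x in a..b, f x) + m ^ 2 * (b - a) := by
    have e : ∀ x, (f x - m) ^ 2 = f x ^ 2 - 2 * m * f x + m ^ 2 := fun x => by ring
    simp only [e]
    rw [intervalIntegral.integral_add (hi2.sub (hi.const_mul _)) intervalIntegrable_const,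
      intervalIntegral.integral_sub hi2 (hi.const_mul _), intervalIntegral.integral_const_mul,
      intervalIntegral.integral_const, smul_eq_mul, mul_comm (b - a)]
  have h2 : (∫ x in a..b, f x) = m * (b - a) := by rw [hm]; field_simp
  rw [h1, h2] at h0
  rw [h2]
  nlinarith

lemma intervalIntegral_swap_of_continuousOn {E : Type*} [NormedAddCommGroup E] [NormedSpace ℝ E]
    {f : ℝ → ℝ → E} {a b c d : ℝ}
    (hf : ContinuousOn (fun p : ℝ × ℝ => f p.1 p.2) (uIcc a b ×ˢ uIcc c d)) :
    ∫ x in a..b, ∫ y in c..d, f x y = ∫ y in c..d, ∫ x in a..b, f x y := by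
  refine intervalIntegral_intervalIntegral_swap ?_
  exact (hf.integrableOn_compact (isCompact_uIcc.prod isCompact_uIcc)).mono_set
    (prod_mono uIoc_subset_uIcc uIoc_subset_uIcc)

lemma intervalIntegral_comp_add_periodic {f : ℝ → ℝ} {T : ℝ} (hf : Function.Periodic f T) (x : ℝ) :
    ∫ θ in (0 : ℝ)..T, f (θ + x) = ∫ θ in (0 : ℝ)..T, f θ := by
  rw [intervalIntegral.integral_comp_add_right, add_comm T x, zero_add,
    hf.intervalIntegral_add_eq x 0, zero_add]

/-- A trace estimate: for a function on `[s, t] × ℝ` which is periodic in the second variable, the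
boundary values at `t` have `L²` modulus of continuity controlled by the energy of the collar whose
width is the shift. -/
lemma integral_shift_sq_le_energy {s t : ℝ} (hst : s < t) {u A B : ℝ → ℝ → ℝ}
    (hA : Continuous fun p : ℝ × ℝ => A p.1 p.2) (hB : Continuous fun p : ℝ × ℝ => B p.1 p.2)
    (huA : ∀ τ ∈ Icc s t, ∀ θ, HasDerivAt (fun τ => u τ θ) (A τ θ) τ)
    (huB : ∀ τ ∈ Icc s t, ∀ θ, HasDerivAt (fun θ => u τ θ) (B τ θ) θ)
    (hper : ∀ τ ∈ Icc s t, Function.Periodic (u τ) (2 * Real.pi))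
    (hperB : ∀ τ ∈ Icc s t, Function.Periodic (B τ) (2 * Real.pi)) :
    ∫ θ in (0 : ℝ)..2 * Real.pi, (u t (θ + (t - s)) - u t θ) ^ 2 ≤
      6 * (t - s) * ∫ τ in s..t, ∫ θ in (0 : ℝ)..2 * Real.pi, (A τ θ ^ 2 + B τ θ ^ 2) := by
  have hpi := Real.pi_pos
  set δ := t - s with hδ
  have hδ0 : 0 < δ := sub_pos.2 hst
  have hcu : ∀ τ ∈ Icc s t, Continuous (u τ) := fun τ hτ =>
    continuous_iff_continuousAt.2 fun θ => (huB τ hτ θ).continuousAt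
  have htt : t ∈ Icc s t := ⟨hst.le, le_rfl⟩
  have hAθ : ∀ θ, Continuous fun τ => A τ θ := fun θ => hA.comp (by fun_prop : Continuous fun τ => (τ, θ))
  have hBτ : ∀ τ, Continuous fun θ => B τ θ := fun τ => hB.comp (by fun_prop : Continuous fun θ => (τ, θ))
  have hAτ : ∀ τ, Continuous fun θ => A τ θ := fun τ => hA.comp (by fun_prop : Continuous fun θ => (τ, θ))
  have hA2 : Continuous fun p : ℝ × ℝ => A p.1 p.2 ^ 2 := hA.pow 2
  have hB2 : Continuous fun p : ℝ × ℝ => B p.1 p.2 ^ 2 := hB.pow 2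
  have hA2' : Continuous fun p : ℝ × ℝ => A p.2 p.1 ^ 2 := hA2.comp continuous_swap
  have hB2' : Continuous fun p : ℝ × ℝ => B p.2 p.1 ^ 2 := hB2.comp continuous_swap
  set EA := ∫ τ in s..t, ∫ θ in (0 : ℝ)..2 * Real.pi, A τ θ ^ 2 with hEA
  set EB := ∫ τ in s..t, ∫ θ in (0 : ℝ)..2 * Real.pi, B τ θ ^ 2 with hEB
  have hcA : Continuous fun τ => ∫ θ in (0 : ℝ)..2 * Real.pi, A τ θ ^ 2 :=
    intervalIntegral.continuous_parametric_intervalIntegral_of_continuous' hA2 _ _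
  have hcB : Continuous fun τ => ∫ θ in (0 : ℝ)..2 * Real.pi, B τ θ ^ 2 :=
    intervalIntegral.continuous_parametric_intervalIntegral_of_continuous' hB2 _ _
  have hsum : ∫ τ in s..t, ∫ θ in (0 : ℝ)..2 * Real.pi, (A τ θ ^ 2 + B τ θ ^ 2) = EA + EB := by
    rw [hEA, hEB, ← intervalIntegral.integral_add (hcA.intervalIntegrable _ _)
      (hcB.intervalIntegrable _ _)]
    congr 1
    ext τ
    exact intervalIntegral.integral_add (((hAτ τ).pow 2).intervalIntegrable _ _)
      (((hBτ τ).pow 2).intervalIntegrable _ _)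
  have hEAswap : EA = ∫ θ in (0 : ℝ)..2 * Real.pi, ∫ τ in s..t, A τ θ ^ 2 :=
    intervalIntegral_swap_of_continuousOn hA2.continuousOn
  -- the radial part
  have hrad : ∀ τ ∈ Icc s t, ∀ θ, (u t θ - u τ θ) ^ 2 ≤ δ * ∫ σ in s..t, A σ θ ^ 2 := by
    intro τ hτ θ
    have h1 : ∫ σ in τ..t, A σ θ = u t θ - u τ θ := by
      refine intervalIntegral.integral_eq_sub_of_hasDerivAt (f := fun σ => u σ θ) (fun σ hσ => ?_)
        ((hAθ θ).intervalIntegrable _ _)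
      rw [uIcc_of_le hτ.2] at hσ
      exact huA σ ⟨hτ.1.trans hσ.1, hσ.2⟩ θ
    rw [← h1]
    refine (sq_intervalIntegral_le hτ.2 (hAθ θ).continuousOn).trans ?_
    have h2 : ∫ σ in τ..t, A σ θ ^ 2 ≤ ∫ σ in s..t, A σ θ ^ 2 :=
      intervalIntegral.integral_mono_interval hτ.1 hτ.2 le_rfl
        (Filter.Eventually.of_forall fun σ => sq_nonneg _) (((hAθ θ).pow 2).intervalIntegrable _ _)
    have h3 : 0 ≤ ∫ σ in τ..t, A σ θ ^ 2 :=
      intervalIntegral.integral_nonneg hτ.2 fun σ _ => sq_nonneg _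
    exact mul_le_mul (by rw [hδ]; linarith [hτ.1]) h2 h3 hδ0.le
  have hrad' : ∀ τ ∈ Icc s t, ∫ θ in (0 : ℝ)..2 * Real.pi, (u t θ - u τ θ) ^ 2 ≤ δ * EA := by
    intro τ hτ
    rw [hEAswap, ← intervalIntegral.integral_const_mul]
    refine intervalIntegral.integral_mono_on (by positivity)
      ((((hcu t htt).sub (hcu τ hτ)).pow 2).intervalIntegrable _ _) ?_ fun θ _ => hrad τ hτ θ
    refine Continuous.intervalIntegrable (continuous_const.mul ?_) _ _
    exact intervalIntegral.continuous_parametric_intervalIntegral_of_continuous' hA2' _ _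
  -- the angular part
  have hang : ∀ τ ∈ Icc s t, ∫ θ in (0 : ℝ)..2 * Real.pi, (u τ (θ + δ) - u τ θ) ^ 2 ≤
      δ ^ 2 * ∫ θ in (0 : ℝ)..2 * Real.pi, B τ θ ^ 2 := by
    intro τ hτ
    have h1 : ∀ θ, (u τ (θ + δ) - u τ θ) ^ 2 ≤ δ * ∫ σ in (0 : ℝ)..δ, B τ (σ + θ) ^ 2 := by
      intro θ
      have h2 : ∫ σ in θ..(θ + δ), B τ σ = u τ (θ + δ) - u τ θ :=
        intervalIntegral.integral_eq_sub_of_hasDerivAt (fun σ _ => huB τ hτ σ)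
          ((hBτ τ).intervalIntegrable _ _)
      rw [← h2, intervalIntegral.integral_comp_add_right (fun σ => B τ σ ^ 2), zero_add, add_comm δ]
      refine (sq_intervalIntegral_le (by linarith) (hBτ τ).continuousOn).trans ?_
      rw [add_sub_cancel_left]
    have hBs : Continuous fun p : ℝ × ℝ => B τ (p.2 + p.1) ^ 2 :=
      ((hBτ τ).comp (by fun_prop : Continuous fun p : ℝ × ℝ => p.2 + p.1)).pow 2
    calc _ ≤ ∫ θ in (0 : ℝ)..2 * Real.pi, δ * ∫ σ in (0 : ℝ)..δ, B τ (σ + θ) ^ 2 := by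
          refine intervalIntegral.integral_mono_on (by positivity)
            (Continuous.intervalIntegrable ?_ _ _) ?_ fun θ _ => h1 θ
          · exact (((hcu τ hτ).comp (by fun_prop)).sub (hcu τ hτ)).pow 2
          · refine Continuous.intervalIntegrable (continuous_const.mul ?_) _ _
            exact intervalIntegral.continuous_parametric_intervalIntegral_of_continuous' hBs _ _
      _ = δ * ∫ σ in (0 : ℝ)..δ, ∫ θ in (0 : ℝ)..2 * Real.pi, B τ (θ + σ) ^ 2 := by
          rw [intervalIntegral.integral_const_mul, intervalIntegral_swap_of_continuousOn
            (f := fun x y => B τ (y + x) ^ 2) hBs.continuousOn]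
          simp only [add_comm]
      _ = δ * ∫ σ in (0 : ℝ)..δ, ∫ θ in (0 : ℝ)..2 * Real.pi, B τ θ ^ 2 := by
          congr 2
          ext σ
          exact intervalIntegral_comp_add_periodic (f := fun θ => B τ θ ^ 2)
            (fun θ => by simp only [hperB τ hτ θ]) σ
      _ = _ := by simp; ring
  set D := ∫ θ in (0 : ℝ)..2 * Real.pi, (u t (θ + δ) - u t θ) ^ 2 with hD
  have hDτ : ∀ τ ∈ Icc s t, D ≤ 6 * δ * EA + 3 * δ ^ 2 * ∫ θ in (0 : ℝ)..2 * Real.pi, B τ θ ^ 2 := by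
    intro τ hτ
    have hc1 : Continuous fun θ => (u t θ - u τ θ) ^ 2 := ((hcu t htt).sub (hcu τ hτ)).pow 2
    have hc1' : Continuous fun θ => (u t (θ + δ) - u τ (θ + δ)) ^ 2 :=
      hc1.comp (by fun_prop : Continuous fun θ : ℝ => θ + δ)
    have hc2 : Continuous fun θ => (u τ (θ + δ) - u τ θ) ^ 2 :=
      (((hcu τ hτ).comp (by fun_prop)).sub (hcu τ hτ)).pow 2
    have hc3 : Continuous fun θ => (u t (θ + δ) - u t θ) ^ 2 :=
      (((hcu t htt).comp (by fun_prop)).sub (hcu t htt)).pow 2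
    -- `(x + y + z)² ≤ 3 (x² + y² + z²)` on the path from `(t, θ + δ)` to `(t, θ)` through level `τ`;
    -- averaging over `τ` in `[s, t]` then gives the estimate
    have h1 : D ≤ ∫ θ in (0 : ℝ)..2 * Real.pi, (3 * (u t (θ + δ) - u τ (θ + δ)) ^ 2 +
        3 * (u t θ - u τ θ) ^ 2 + 3 * (u τ (θ + δ) - u τ θ) ^ 2) := by
      refine intervalIntegral.integral_mono_on (by positivity) (hc3.intervalIntegrable _ _)
        (Continuous.intervalIntegrable (by fun_prop) _ _) fun θ _ => ?_
      nlinarith [sq_nonneg (u t (θ + δ) - u τ (θ + δ) + (u t θ - u τ θ)),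
        sq_nonneg (u t (θ + δ) - u τ (θ + δ) - (u τ (θ + δ) - u τ θ)),
        sq_nonneg (u t θ - u τ θ + (u τ (θ + δ) - u τ θ))]
    rw [intervalIntegral.integral_add (Continuous.intervalIntegrable (by fun_prop) _ _)
      (Continuous.intervalIntegrable (by fun_prop) _ _), intervalIntegral.integral_add
      (Continuous.intervalIntegrable (by fun_prop) _ _)
      (Continuous.intervalIntegrable (by fun_prop) _ _), intervalIntegral.integral_const_mul,
      intervalIntegral.integral_const_mul, intervalIntegral.integral_const_mul,
      intervalIntegral_comp_add_periodic (f := fun θ => (u t θ - u τ θ) ^ 2)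
        (fun θ => by simp only [hper t htt θ, hper τ hτ θ])] at h1
    have h2 := hrad' τ hτ
    have h3 := hang τ hτ
    nlinarith
  have hint : ∫ τ in s..t, D ≤ ∫ τ in s..t, (6 * δ * EA + 3 * δ ^ 2 *
      ∫ θ in (0 : ℝ)..2 * Real.pi, B τ θ ^ 2) :=
    intervalIntegral.integral_mono_on hst.le intervalIntegrable_const
      (Continuous.intervalIntegrable (by fun_prop) _ _) hDτ
  rw [intervalIntegral.integral_add intervalIntegrable_const
    (Continuous.intervalIntegrable (by fun_prop) _ _), intervalIntegral.integral_const_mul (3 * δ ^ 2),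
    intervalIntegral.integral_const, intervalIntegral.integral_const, ← hδ, ← hEB, smul_eq_mul,
    smul_eq_mul] at hint
  have hEB0 : 0 ≤ EB := intervalIntegral.integral_nonneg hst.le fun τ _ =>
    intervalIntegral.integral_nonneg (by positivity) fun θ _ => sq_nonneg _
  rw [hsum]
  refine le_of_mul_le_mul_left ?_ hδ0
  nlinarith [mul_nonneg (sq_nonneg δ) hEB0]

/-- A shift by `N δ` changes a periodic function in the mean by at most `N` times as much as a shift by
`δ`. -/
lemma integral_abs_shift_nsmul_le {f : ℝ → ℝ} (hf : Continuous f) {T : ℝ} (hT : 0 ≤ T)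
    (hper : Function.Periodic f T) (δ : ℝ) (N : ℕ) :
    ∫ θ in (0 : ℝ)..T, |f (θ + N * δ) - f θ| ≤ N * ∫ θ in (0 : ℝ)..T, |f (θ + δ) - f θ| := by
  induction N with
  | zero => simp
  | succ N ih =>
    have h1 : ∫ θ in (0 : ℝ)..T, |f (θ + (N + 1 : ℕ) * δ) - f θ| ≤
        ∫ θ in (0 : ℝ)..T, (|f (θ + N * δ + δ) - f (θ + N * δ)| + |f (θ + N * δ) - f θ|) := by
      refine intervalIntegral.integral_mono_on hT (Continuous.intervalIntegrable (by fun_prop) _ _)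
        (Continuous.intervalIntegrable (by fun_prop) _ _) fun θ _ => ?_
      have e : θ + ((N + 1 : ℕ) : ℝ) * δ = θ + N * δ + δ := by push_cast; ring
      rw [e]
      exact abs_sub_le _ _ _
    rw [intervalIntegral.integral_add (Continuous.intervalIntegrable (by fun_prop) _ _)
      (Continuous.intervalIntegrable (by fun_prop) _ _),
      intervalIntegral_comp_add_periodic (f := fun θ => |f (θ + δ) - f θ|) (fun θ => by
        simp only [show θ + T + δ = θ + δ + T by ring, hper (θ + δ), hper θ])] at h1
    push_cast at h1 ⊢
    linarith

/-- Values near `{-h, h}` differ by almost `0` or almost `2h`, so that the difference is controlled by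
its square. -/
lemma two_mul_abs_sub_le {h a b : ℝ} (ha : |a| ≤ h) (hb : |b| ≤ h) :
    2 * h * |a - b| ≤ (a - b) ^ 2 + 2 * h * ((h - |a|) + (h - |b|)) := by
  have h0 : 0 ≤ h := (abs_nonneg a).trans ha
  have h1 : |a - b| ≤ (h - |a|) + (h - |b|) ∨ 2 * h - |a - b| ≤ (h - |a|) + (h - |b|) := by
    rcases le_total 0 a with h1 | h1 <;> rcases le_total 0 b with h2 | h2 <;>
    rcases le_total 0 (a - b) with h3 | h3 <;>
    simp only [abs_of_nonneg, abs_of_nonpos, h1, h2, h3] at * <;>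
    first
      | (left; linarith)
      | (right; linarith)
  have h2 : |a - b| ≤ 2 * h := (abs_sub a b).trans (by linarith)
  have h3 : 0 ≤ |a - b| := abs_nonneg _
  rw [← sq_abs (a - b)]
  rcases h1 with h1 | h1
  · nlinarith
  · nlinarith [mul_le_mul_of_nonneg_left h1 h3, mul_le_mul_of_nonneg_right h2
      (show 0 ≤ (h - |a|) + (h - |b|) by linarith)]

/-- The energy of a collar tends to zero with its width. -/
lemma tendsto_integral_collar {a b : ℝ} (hab : a < b) {e : ℝ → ℝ} (he : IntegrableOn e (Ioo a b)) :
    Filter.Tendsto (fun s => ∫ τ in s..b, e τ) (nhdsWithin b (Iio b)) (nhds 0) := by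
  have hi : IntegrableOn e (uIcc a b) := by
    rw [uIcc_of_le hab.le, integrableOn_Icc_iff_integrableOn_Ioo]; exact he
  have h1 := (intervalIntegral.continuousOn_primitive_interval_left (a := a) (b := b) hi) b
    right_mem_uIcc
  have h2 : Filter.Tendsto (fun s => ∫ τ in s..b, e τ) (nhdsWithin b (uIcc a b)) (nhds 0) := by
    simpa [ContinuousWithinAt] using h1
  refine h2.mono_left ?_
  rw [uIcc_of_le hab.le, ← nhdsWithin_Ico_eq_nhdsLT hab]
  exact nhdsWithin_mono _ Ico_subset_Icc_self

/-- A function of finite energy on the strip `(a, b) × ℝ`, periodic in the second variable, whose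
radial boundary values at `b` are `h` or `-h` almost everywhere has constant boundary values, in the
sense that its nonzero Fourier modes tend to `0`: otherwise the boundary function, a step function,
would have modulus of continuity `δ` in `L²`, whereas finite energy gives `o(δ)`. -/
theorem tendsto_fourierMode_of_finite_energy {a b h : ℝ} (hab : a < b) (hh : 0 < h)
    {u A B : ℝ → ℝ → ℝ}
    (hA : ContinuousOn (fun p : ℝ × ℝ => A p.1 p.2) (Ioo a b ×ˢ univ))
    (hB : ContinuousOn (fun p : ℝ × ℝ => B p.1 p.2) (Ioo a b ×ˢ univ))
    (huA : ∀ t ∈ Ioo a b, ∀ θ, HasDerivAt (fun t => u t θ) (A t θ) t)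
    (huB : ∀ t ∈ Ioo a b, ∀ θ, HasDerivAt (fun θ => u t θ) (B t θ) θ)
    (hper : ∀ t ∈ Ioo a b, Function.Periodic (u t) (2 * Real.pi))
    (hperB : ∀ t ∈ Ioo a b, Function.Periodic (B t) (2 * Real.pi))
    (hbd : ∀ t ∈ Ioo a b, ∀ θ, |u t θ| ≤ h)
    (hE : IntegrableOn (fun t => ∫ θ in (0 : ℝ)..2 * Real.pi, (A t θ ^ 2 + B t θ ^ 2)) (Ioo a b))
    (hlim : ∀ᵐ θ : ℝ, θ ∈ uIoc 0 (2 * Real.pi) →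
      Filter.Tendsto (fun t => |u t θ|) (nhdsWithin b (Iio b)) (nhds h))
    {n : ℤ} (hn : n ≠ 0) :
    Filter.Tendsto (fun t => ∫ θ in (0 : ℝ)..2 * Real.pi,
      (u t θ : ℂ) * Complex.exp (-(n * (θ * Complex.I)))) (nhdsWithin b (Iio b)) (nhds 0) := by
  have hpi := Real.pi_pos
  have hnR : (0 : ℝ) < |(n : ℝ)| := abs_pos.2 (by exact_mod_cast hn)
  have hcu : ∀ τ ∈ Ioo a b, Continuous (u τ) := fun τ hτ =>
    continuous_iff_continuousAt.2 fun θ => (huB τ hτ θ).continuousAt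
  have hev : ∀ᶠ t in nhdsWithin b (Iio b), t ∈ Ioo a b := Ioo_mem_nhdsLT hab
  set e : ℝ → ℝ := fun t => ∫ θ in (0 : ℝ)..2 * Real.pi, (A t θ ^ 2 + B t θ ^ 2) with he
  have he0 : ∀ t, 0 ≤ e t := fun t =>
    intervalIntegral.integral_nonneg (by positivity) fun θ _ => by positivity
  -- the distance of the boundary values from `{-h, h}`
  set κ : ℝ → ℝ := fun t => ∫ θ in (0 : ℝ)..2 * Real.pi, (h - |u t θ|) with hκ
  have hκ0 : Filter.Tendsto κ (nhdsWithin b (Iio b)) (nhds 0) := by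
    have := intervalIntegral.tendsto_integral_filter_of_dominated_convergence
      (μ := volume) (a := 0) (b := 2 * Real.pi) (F := fun t θ => h - |u t θ|) (f := fun _ => (0 : ℝ))
      (l := nhdsWithin b (Iio b)) (fun _ => h) ?_ ?_ intervalIntegrable_const ?_
    · simpa using this
    · filter_upwards [hev] with t ht
      exact (continuous_const.sub (hcu t ht).abs).aestronglyMeasurable
    · filter_upwards [hev] with t ht
      refine Filter.Eventually.of_forall fun θ _ => ?_
      rw [Real.norm_eq_abs, abs_of_nonneg (by linarith [hbd t ht θ])]
      linarith [abs_nonneg (u t θ)]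
    · filter_upwards [hlim] with θ hθ hmem
      simpa using (hθ hmem).const_sub h
  -- the half period shift, which changes the sign of the `n`-th mode
  set x : ℝ := Real.pi / |(n : ℝ)| with hx
  have hx0 : 0 < x := by positivity
  have hmode : ∀ t ∈ Ioo a b, 2 * ‖∫ θ in (0 : ℝ)..2 * Real.pi,
      (u t θ : ℂ) * Complex.exp (-(n * (θ * Complex.I)))‖ ≤
      ∫ θ in (0 : ℝ)..2 * Real.pi, |u t (θ + x) - u t θ| := by
    intro t ht
    have hc := hcu t ht
    set f : ℝ → ℂ := fun θ => (u t θ : ℂ) * Complex.exp (-(n * (θ * Complex.I))) with hf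
    have hfc : Continuous f := by
      have : Continuous fun θ => (u t θ : ℂ) := Complex.continuous_ofReal.comp hc
      fun_prop
    have hfper : Function.Periodic f (2 * Real.pi) := by
      intro θ
      simp only [hf, hper t ht θ]
      have : -((n : ℂ) * (((θ + 2 * Real.pi : ℝ) : ℂ) * Complex.I)) =
          -(n * (θ * Complex.I)) + (-n : ℤ) * (2 * Real.pi * Complex.I) := by push_cast; ring
      rw [this, Complex.exp_add, Complex.exp_int_mul_two_pi_mul_I, mul_one]
    have hsign : Complex.exp (-(n * (x * Complex.I))) = -1 := by
      have hcase : (n : ℝ) * x = Real.pi ∨ (n : ℝ) * x = -Real.pi := by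
        rcases abs_choice (n : ℝ) with h1 | h1
        · left; rw [hx, h1]; rw [h1] at hnR; field_simp
        · right; rw [hx, h1]; rw [h1] at hnR
          have : (n : ℝ) ≠ 0 := by linarith [hnR]
          field_simp
      have : (n : ℂ) * (x * Complex.I) = ((n * x : ℝ) : ℂ) * Complex.I := by push_cast; ring
      rw [this]
      rcases hcase with h1 | h1
      · rw [h1, Complex.exp_neg, Complex.exp_pi_mul_I]; norm_num
      · rw [h1]; push_cast; rw [neg_mul, neg_neg, Complex.exp_pi_mul_I]
    have hshift : ∫ θ in (0 : ℝ)..2 * Real.pi, f (θ + x) = ∫ θ in (0 : ℝ)..2 * Real.pi, f θ := by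
      rw [intervalIntegral.integral_comp_add_right, add_comm (2 * Real.pi) x, zero_add,
        hfper.intervalIntegral_add_eq x 0, zero_add]
    have hpt : ∀ θ : ℝ, ((u t (θ + x) - u t θ : ℝ) : ℂ) * Complex.exp (-(n * (θ * Complex.I))) =
        -f (θ + x) - f θ := by
      intro θ
      simp only [hf]
      have : -((n : ℂ) * (((θ + x : ℝ) : ℂ) * Complex.I)) =
          -(n * (θ * Complex.I)) + -(n * (x * Complex.I)) := by push_cast; ring
      rw [this, Complex.exp_add, hsign]
      push_cast; ring
    have hI : ∫ θ in (0 : ℝ)..2 * Real.pi, ((u t (θ + x) - u t θ : ℝ) : ℂ) *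
        Complex.exp (-(n * (θ * Complex.I))) = -(2 * ∫ θ in (0 : ℝ)..2 * Real.pi, f θ) := by
      simp only [hpt]
      rw [intervalIntegral.integral_sub (Continuous.intervalIntegrable (by fun_prop) _ _)
        (hfc.intervalIntegrable _ _), intervalIntegral.integral_neg, hshift]
      ring
    have hle := intervalIntegral.norm_integral_le_integral_norm (μ := volume)
      (f := fun θ : ℝ => ((u t (θ + x) - u t θ : ℝ) : ℂ) *
        Complex.exp (-(n * (θ * Complex.I)))) (show (0 : ℝ) ≤ 2 * Real.pi by positivity)
    rw [hI, norm_neg, norm_mul] at hle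
    have hnorm : ∀ θ : ℝ, ‖((u t (θ + x) - u t θ : ℝ) : ℂ) *
        Complex.exp (-(n * (θ * Complex.I)))‖ = |u t (θ + x) - u t θ| := by
      intro θ
      rw [norm_mul, Complex.norm_real, Complex.norm_exp]
      simp
    simp only [hnorm] at hle
    simpa using hle
  -- finite energy bounds small shifts
  have hshiftN : ∀ N : ℕ, 0 < N → a < b - 2 * (x / N) → ∀ t ∈ Ioo (b - x / N) b,
      2 * h * ∫ θ in (0 : ℝ)..2 * Real.pi, |u t (θ + x) - u t θ| ≤
        6 * x * (∫ τ in (b - 2 * (x / N))..b, e τ) + 4 * h * N * κ t := by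
    intro N hN haN t ht
    have hN' : (0 : ℝ) < N := by exact_mod_cast hN
    set δ := x / N with hδ
    have hδ0 : 0 < δ := by positivity
    have hab' : t ∈ Ioo a b := ⟨by linarith [ht.1], ht.2⟩
    have hc := hcu t hab'
    have hts : Icc (t - δ) t ⊆ Ioo a b := fun τ hτ =>
      ⟨by linarith [ht.1, hτ.1], hτ.2.trans_lt ht.2⟩
    have hclamp : Continuous fun p : ℝ × ℝ => ((max (t - δ) (min t p.1), p.2) : ℝ × ℝ) := by
      fun_prop
    have hcm : ∀ p : ℝ × ℝ, ((max (t - δ) (min t p.1), p.2) : ℝ × ℝ) ∈ Ioo a b ×ˢ univ := fun p =>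
      ⟨hts ⟨le_max_left _ _, max_le (by linarith) (min_le_left _ _)⟩, mem_univ _⟩
    have hce : ∀ τ ∈ Icc (t - δ) t, max (t - δ) (min t τ) = τ := fun τ hτ => by
      rw [min_eq_right hτ.2, max_eq_right hτ.1]
    have hD := integral_shift_sq_le_energy (s := t - δ) (t := t) (by linarith) (u := u)
      (A := fun τ θ => A (max (t - δ) (min t τ)) θ) (B := fun τ θ => B (max (t - δ) (min t τ)) θ)
      (hA.comp_continuous hclamp hcm) (hB.comp_continuous hclamp hcm)
      (fun τ hτ θ => by rw [hce τ hτ]; exact huA τ (hts hτ) θ)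
      (fun τ hτ θ => by rw [hce τ hτ]; exact huB τ (hts hτ) θ)
      (fun τ hτ => hper τ (hts hτ))
      (fun τ hτ => by rw [hce τ hτ]; exact hperB τ (hts hτ))
    have hee : ∫ τ in (t - δ)..t, ∫ θ in (0 : ℝ)..2 * Real.pi,
        (A (max (t - δ) (min t τ)) θ ^ 2 + B (max (t - δ) (min t τ)) θ ^ 2) =
        ∫ τ in (t - δ)..t, e τ := by
      refine intervalIntegral.integral_congr fun τ hτ => ?_
      rw [uIcc_of_le (by linarith)] at hτ
      simp only [hce τ hτ, he]
    rw [hee, sub_sub_cancel] at hD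
    have hemono : ∫ τ in (t - δ)..t, e τ ≤ ∫ τ in (b - 2 * δ)..b, e τ := by
      refine intervalIntegral.integral_mono_interval (by linarith [ht.1]) (by linarith) ht.2.le
        (Filter.Eventually.of_forall he0) ?_
      rw [intervalIntegrable_iff_integrableOn_Ioo_of_le (by linarith)]
      exact hE.mono_set (Ioo_subset_Ioo_left haN.le)
    have h1 := integral_abs_shift_nsmul_le hc (by positivity) (hper t hab') δ N
    rw [show (N : ℝ) * δ = x by rw [hδ]; field_simp] at h1
    have h2 : 2 * h * ∫ θ in (0 : ℝ)..2 * Real.pi, |u t (θ + δ) - u t θ| ≤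
        (∫ θ in (0 : ℝ)..2 * Real.pi, (u t (θ + δ) - u t θ) ^ 2) + 4 * h * κ t := by
      have hk' : ∫ θ in (0 : ℝ)..2 * Real.pi, (h - |u t (θ + δ)|) = κ t :=
        intervalIntegral_comp_add_periodic (f := fun θ => h - |u t θ|)
          (fun θ => by simp only [hper t hab' θ]) δ
      have h3 : ∫ θ in (0 : ℝ)..2 * Real.pi, 2 * h * |u t (θ + δ) - u t θ| ≤
          ∫ θ in (0 : ℝ)..2 * Real.pi, ((u t (θ + δ) - u t θ) ^ 2 +
            2 * h * ((h - |u t (θ + δ)|) + (h - |u t θ|))) :=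
        intervalIntegral.integral_mono_on (by positivity)
          (Continuous.intervalIntegrable (by fun_prop) _ _)
          (Continuous.intervalIntegrable (by fun_prop) _ _)
          fun θ _ => two_mul_abs_sub_le (hbd t hab' _) (hbd t hab' _)
      rw [intervalIntegral.integral_add (Continuous.intervalIntegrable (by fun_prop) _ _)
        (Continuous.intervalIntegrable (by fun_prop) _ _), intervalIntegral.integral_const_mul,
        intervalIntegral.integral_const_mul, intervalIntegral.integral_add
        (Continuous.intervalIntegrable (by fun_prop) _ _)
        (Continuous.intervalIntegrable (by fun_prop) _ _), hk'] at h3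
      change _ ≤ _ + 2 * h * (κ t + κ t) at h3
      linarith
    calc 2 * h * ∫ θ in (0 : ℝ)..2 * Real.pi, |u t (θ + x) - u t θ|
        ≤ 2 * h * (N * ∫ θ in (0 : ℝ)..2 * Real.pi, |u t (θ + δ) - u t θ|) := by gcongr
      _ = N * (2 * h * ∫ θ in (0 : ℝ)..2 * Real.pi, |u t (θ + δ) - u t θ|) := by ring
      _ ≤ N * ((6 * δ * ∫ τ in (b - 2 * δ)..b, e τ) + 4 * h * κ t) := by
        refine mul_le_mul_of_nonneg_left (h2.trans ?_) hN'.le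
        have := mul_le_mul_of_nonneg_left hemono (show 0 ≤ 6 * δ by positivity)
        linarith
      _ = 6 * x * (∫ τ in (b - 2 * δ)..b, e τ) + 4 * h * N * κ t := by
        have : x = N * δ := by rw [hδ]; field_simp
        rw [this]; ring
  -- conclusion
  rw [Metric.tendsto_nhds]
  intro ε hε
  have hcol : Filter.Tendsto (fun N : ℕ => b - 2 * (x / N)) Filter.atTop
      (nhdsWithin b (Iio b)) := by
    refine tendsto_nhdsWithin_iff.2 ⟨?_, ?_⟩
    · have h1 : Filter.Tendsto (fun N : ℕ => x / (N : ℝ)) Filter.atTop (nhds 0) :=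
        tendsto_const_div_atTop_nhds_zero_nat x
      simpa using (h1.const_mul 2).const_sub b
    · filter_upwards [Filter.eventually_gt_atTop 0] with N hN
      have hN' : (0 : ℝ) < N := by exact_mod_cast hN
      have : 0 < x / N := by positivity
      change b - 2 * (x / N) < b
      linarith
  have hc2 : Filter.Tendsto (fun N : ℕ => 6 * x * ∫ τ in (b - 2 * (x / N))..b, e τ) Filter.atTop
      (nhds 0) := by
    simpa using ((tendsto_integral_collar hab hE).comp hcol).const_mul (6 * x)
  obtain ⟨N, hN, hNa, hNe⟩ := ((Filter.eventually_gt_atTop 0).and ((hcol.eventually hev).and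
    (hc2.eventually_lt_const (show 0 < 2 * h * ε by positivity)))).exists
  have hN' : (0 : ℝ) < N := by exact_mod_cast hN
  have hκN : Filter.Tendsto (fun t => 4 * h * N * κ t) (nhdsWithin b (Iio b)) (nhds 0) := by
    simpa using hκ0.const_mul (4 * h * N)
  filter_upwards [Ioo_mem_nhdsLT (show b - x / N < b by have : 0 < x / N := by positivity
                                                        linarith), hev,
    hκN.eventually_lt_const (show 0 < 2 * h * ε by positivity)] with t ht1 ht2 ht3
  rw [dist_zero_right]
  have h1 := hshiftN N hN hNa.1 t ht1
  have h2 := hmode t ht2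
  have h3 := mul_le_mul_of_nonneg_left h2 (show 0 ≤ 2 * h by positivity)
  refine lt_of_mul_lt_mul_left (a := 4 * h) ?_ (by positivity)
  linarith

/-! ### Fourier modes of periodic holomorphic functions on a strip -/

/-- The vertical strip `{a < Re w < b}`, which `exp` maps onto an annulus. -/
def strip (a b : ℝ) : Set ℂ := {w | a < w.re ∧ w.re < b}

lemma isOpen_strip (a b : ℝ) : IsOpen (strip a b) :=
  (isOpen_lt continuous_const Complex.continuous_re).inter
    (isOpen_lt Complex.continuous_re continuous_const)

lemma convex_strip (a b : ℝ) : Convex ℝ (strip a b) :=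
  (convex_halfSpace_re_gt a).inter (convex_halfSpace_re_lt b)

lemma ofReal_add_mul_I_mem_strip {a b t : ℝ} (ht : t ∈ Ioo a b) (θ : ℝ) :
    (t : ℂ) + θ * Complex.I ∈ strip a b := by
  simpa [strip] using ht

/-- By Cauchy's theorem, the integral of a periodic holomorphic function over a period on a vertical
line does not depend on the line. -/
lemma integral_vertical_eq {a b : ℝ} {f : ℂ → ℂ} (hf : DifferentiableOn ℂ f (strip a b))
    (hper : ∀ w ∈ strip a b, f (w + 2 * Real.pi * Complex.I) = f w) {s t : ℝ} (hs : s ∈ Ioo a b)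
    (ht : t ∈ Ioo a b) :
    ∫ θ in (0 : ℝ)..2 * Real.pi, f (t + θ * Complex.I) =
      ∫ θ in (0 : ℝ)..2 * Real.pi, f (s + θ * Complex.I) := by
  have h := Complex.integral_boundary_rect_eq_zero_of_differentiableOn f (s : ℂ)
    (t + (2 * Real.pi : ℝ) * Complex.I) (hf.mono fun w hw => by
      have : w.re ∈ uIcc s t := by simpa using hw.1
      exact (ordConnected_Ioo.uIcc_subset hs ht) this)
  have e : ∫ x in s..t, f (x + ((2 * Real.pi : ℝ) : ℂ) * Complex.I) = ∫ x in s..t, f x := by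
    refine intervalIntegral.integral_congr fun x hx => ?_
    have hx' := (ordConnected_Ioo.uIcc_subset hs ht) hx
    have := hper x (by simpa using ofReal_add_mul_I_mem_strip hx' 0)
    simpa using this
  simp only [Complex.ofReal_re, Complex.ofReal_im, Complex.add_re, Complex.mul_re, Complex.I_re,
    mul_zero, Complex.I_im, mul_one, sub_self, add_zero, Complex.add_im, Complex.mul_im, zero_add,
    Complex.ofReal_zero, zero_mul] at h
  rw [e, sub_self, zero_add, smul_eq_mul, smul_eq_mul, ← mul_sub] at h
  exact sub_eq_zero.1 ((mul_eq_zero.1 h).resolve_left Complex.I_ne_zero)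

/-- The `n`-th Fourier mode of a periodic holomorphic function is a multiple of `e ^ (n t)`. -/
lemma exists_fourierMode_eq {a b : ℝ} (hab : a < b) {f : ℂ → ℂ}
    (hf : DifferentiableOn ℂ f (strip a b))
    (hper : ∀ w ∈ strip a b, f (w + 2 * Real.pi * Complex.I) = f w) (n : ℤ) :
    ∃ c : ℂ, ∀ t ∈ Ioo a b, ∫ θ in (0 : ℝ)..2 * Real.pi,
      f (t + θ * Complex.I) * Complex.exp (-(n * (θ * Complex.I))) = c * Real.exp (n * t) := by
  have hmid : (a + b) / 2 ∈ Ioo a b := ⟨by linarith, by linarith⟩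
  refine ⟨∫ θ in (0 : ℝ)..2 * Real.pi, f (((a + b) / 2 : ℝ) + θ * Complex.I) *
    Complex.exp (-n * (((a + b) / 2 : ℝ) + θ * Complex.I)), fun t ht => ?_⟩
  have h := integral_vertical_eq (f := fun w => f w * Complex.exp (-n * w))
    (hf.mul (by fun_prop)) (fun w hw => by
      rw [hper w hw, show -(n : ℂ) * (w + 2 * Real.pi * Complex.I) =
        -n * w + (-n : ℤ) * (2 * Real.pi * Complex.I) by push_cast; ring, Complex.exp_add,
        Complex.exp_int_mul_two_pi_mul_I, mul_one]) hmid ht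
  rw [← h, ← intervalIntegral.integral_mul_const]
  congr 1
  ext θ
  rw [mul_assoc]
  congr 1
  rw [Complex.ofReal_exp, ← Complex.exp_add]
  congr 1
  push_cast; ring

/-- Parseval's identity, for Fourier modes without normalization. -/
lemma hasSum_sq_fourierMode {f : ℝ → ℂ} (hf : Continuous f) :
    HasSum (fun n : ℤ => ‖∫ θ in (0 : ℝ)..2 * Real.pi,
      f θ * Complex.exp (-(n * (θ * Complex.I)))‖ ^ 2)
      (2 * Real.pi * ∫ θ in (0 : ℝ)..2 * Real.pi, ‖f θ‖ ^ 2) := by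
  have hpi := Real.pi_pos
  have h2 : (0 : ℝ) < 2 * Real.pi := by positivity
  have hL : MemLp f 2 (volume.restrict (Ioc 0 (2 * Real.pi))) := by
    rw [memLp_two_iff_integrable_sq_norm hf.aestronglyMeasurable]
    exact ((hf.norm.pow 2).integrableOn_Icc (a := 0) (b := 2 * Real.pi)).mono_set
      Ioc_subset_Icc_self
  have h := (hasSum_sq_fourierCoeffOn h2 hL).mul_left ((2 * Real.pi) ^ 2)
  have e1 : ∀ n : ℤ, ‖∫ θ in (0 : ℝ)..2 * Real.pi,
      f θ * Complex.exp (-(n * (θ * Complex.I)))‖ ^ 2 =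
      (2 * Real.pi) ^ 2 * ‖fourierCoeffOn h2 f n‖ ^ 2 := by
    intro n
    rw [fourierCoeffOn_eq_integral, norm_smul, sub_zero, mul_pow ‖1 / (2 * Real.pi)‖]
    have e : ‖1 / (2 * Real.pi)‖ ^ 2 = ((2 * Real.pi) ^ 2)⁻¹ := by
      rw [Real.norm_of_nonneg (by positivity)]; field_simp
    rw [e, ← mul_assoc, mul_inv_cancel₀ (by positivity), one_mul]
    congr 2
    refine intervalIntegral.integral_congr fun θ _ => ?_
    rw [fourier_coe_apply, smul_eq_mul, mul_comm]
    congr 2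
    have : (Real.pi : ℂ) ≠ 0 := by exact_mod_cast hpi.ne'
    push_cast
    field_simp
  simp only [e1]
  have e2 : (2 * Real.pi) ^ 2 * (2 * Real.pi - 0)⁻¹ • ∫ x in (0 : ℝ)..2 * Real.pi, ‖f x‖ ^ 2 =
      2 * Real.pi * ∫ θ in (0 : ℝ)..2 * Real.pi, ‖f θ‖ ^ 2 := by
    rw [smul_eq_mul, sub_zero]; field_simp
  rwa [e2] at h

/-- A continuous periodic function all of whose nonzero Fourier modes vanish is equal to its mean. -/
lemma eq_const_of_fourierMode_eq_zero {f : ℝ → ℂ} (hf : Continuous f)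
    (hper : Function.Periodic f (2 * Real.pi))
    (h0 : ∀ n : ℤ, n ≠ 0 → ∫ θ in (0 : ℝ)..2 * Real.pi,
      f θ * Complex.exp (-(n * (θ * Complex.I))) = 0) (θ : ℝ) :
    f θ = (2 * Real.pi : ℝ)⁻¹ • ∫ θ in (0 : ℝ)..2 * Real.pi, f θ := by
  have hpi := Real.pi_pos
  have h2 : (0 : ℝ) < 2 * Real.pi := by positivity
  set m : ℂ := (2 * Real.pi : ℝ)⁻¹ • ∫ θ in (0 : ℝ)..2 * Real.pi, f θ with hm
  have hexp : ∀ n : ℤ, n ≠ 0 → ∫ θ in (0 : ℝ)..2 * Real.pi,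
      Complex.exp (-(n * (θ * Complex.I))) = 0 := by
    intro n hn
    have hc : (-(n * Complex.I) : ℂ) ≠ 0 := by simp [hn]
    have := integral_exp_mul_complex (a := 0) (b := 2 * Real.pi) hc
    rw [show (fun θ : ℝ => Complex.exp (-(n * (θ * Complex.I)))) =
      fun θ : ℝ => Complex.exp (-(n * Complex.I) * θ) by ext θ; ring_nf, this]
    rw [show -((n : ℂ) * Complex.I) * ((2 * Real.pi : ℝ) : ℂ) =
      ((-n : ℤ) : ℂ) * (2 * Real.pi * Complex.I) by push_cast; ring,
      Complex.exp_int_mul_two_pi_mul_I]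
    simp
  have hmodes : ∀ n : ℤ, ∫ θ in (0 : ℝ)..2 * Real.pi,
      (f θ - m) * Complex.exp (-(n * (θ * Complex.I))) = 0 := by
    intro n
    have e : ∫ θ in (0 : ℝ)..2 * Real.pi, (f θ - m) * Complex.exp (-(n * (θ * Complex.I))) =
        (∫ θ in (0 : ℝ)..2 * Real.pi, f θ * Complex.exp (-(n * (θ * Complex.I)))) -
        m * ∫ θ in (0 : ℝ)..2 * Real.pi, Complex.exp (-(n * (θ * Complex.I))) := by
      simp only [sub_mul]
      rw [intervalIntegral.integral_sub (Continuous.intervalIntegrable (by fun_prop) _ _)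
        (Continuous.intervalIntegrable (by fun_prop) _ _), intervalIntegral.integral_const_mul]
    rw [e]
    rcases eq_or_ne n 0 with rfl | hn
    · simp [hm]
      field_simp
      simp
    · rw [h0 n hn, hexp n hn]; simp
  have hs := hasSum_sq_fourierMode (f := fun θ => f θ - m) (by fun_prop)
  simp only [hmodes, norm_zero, ne_eq, OfNat.ofNat_ne_zero, not_false_eq_true, zero_pow] at hs
  have hz := hs.unique hasSum_zero
  have hz' : ∫ θ in (0 : ℝ)..2 * Real.pi, ‖f θ - m‖ ^ 2 = 0 :=
    (mul_eq_zero.1 hz).resolve_left h2.ne'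
  by_contra hne
  obtain ⟨θ', hθ', he⟩ := hper.exists_mem_Ico₀ h2 θ
  have hpos : 0 < ∫ θ in (0 : ℝ)..2 * Real.pi, ‖f θ - m‖ ^ 2 := by
    refine intervalIntegral.integral_pos h2 (by fun_prop) (fun _ _ => by positivity)
      ⟨θ', ⟨hθ'.1, hθ'.2.le⟩, ?_⟩
    have : f θ' - m ≠ 0 := by rw [← he]; exact sub_ne_zero.2 hne
    positivity
  linarith

/-- A harmonic function on an annulus whose nonzero Fourier modes tend to zero at both ends is an
affine function of `log |z|`. Here `u` is written in the coordinate `t + i θ = log z`, and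
`H = u_t - i u_θ` is holomorphic. -/
theorem constant_gradient_of_fourierMode_tendsto {a b : ℝ} (hab : a < b)
    {u A B : ℝ → ℝ → ℝ} {H : ℂ → ℂ} (hH : DifferentiableOn ℂ H (strip a b))
    (hHper : ∀ w ∈ strip a b, H (w + 2 * Real.pi * Complex.I) = H w)
    (hHAB : ∀ t ∈ Ioo a b, ∀ θ : ℝ, H (t + θ * Complex.I) = A t θ - Complex.I * B t θ)
    (huA : ∀ t ∈ Ioo a b, ∀ θ, HasDerivAt (fun t => u t θ) (A t θ) t)
    (huB : ∀ t ∈ Ioo a b, ∀ θ, HasDerivAt (fun θ => u t θ) (B t θ) θ)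
    (hcu : ContinuousOn (fun p : ℝ × ℝ => u p.1 p.2) (Ioo a b ×ˢ univ))
    (hper : ∀ t ∈ Ioo a b, Function.Periodic (u t) (2 * Real.pi))
    (hlimb : ∀ n : ℤ, n ≠ 0 → Filter.Tendsto (fun t => ∫ θ in (0 : ℝ)..2 * Real.pi,
      (u t θ : ℂ) * Complex.exp (-(n * (θ * Complex.I)))) (nhdsWithin b (Iio b)) (nhds 0))
    (hlima : ∀ n : ℤ, n ≠ 0 → Filter.Tendsto (fun t => ∫ θ in (0 : ℝ)..2 * Real.pi,
      (u t θ : ℂ) * Complex.exp (-(n * (θ * Complex.I)))) (nhdsWithin a (Ioi a)) (nhds 0)) :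
    ∃ α : ℝ, ∀ t ∈ Ioo a b, ∀ θ, A t θ = α ∧ B t θ = 0 := by
  have hpi := Real.pi_pos
  have hline : Continuous fun p : ℝ × ℝ => (p.1 : ℂ) + p.2 * Complex.I := by fun_prop
  have hHc : ContinuousOn (fun p : ℝ × ℝ => H (p.1 + p.2 * Complex.I)) (Ioo a b ×ˢ univ) :=
    hH.continuousOn.comp hline.continuousOn fun p hp => ofReal_add_mul_I_mem_strip hp.1 p.2
  have hAre : ∀ t ∈ Ioo a b, ∀ θ : ℝ, A t θ = (H (t + θ * Complex.I)).re := fun t ht θ => by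
    rw [hHAB t ht θ]; simp
  have hBim : ∀ t ∈ Ioo a b, ∀ θ : ℝ, B t θ = -(H (t + θ * Complex.I)).im := fun t ht θ => by
    rw [hHAB t ht θ]; simp
  have hA : ContinuousOn (fun p : ℝ × ℝ => A p.1 p.2) (Ioo a b ×ˢ univ) :=
    (Complex.continuous_re.comp_continuousOn hHc).congr fun p hp => hAre p.1 hp.1 p.2
  have hsec : ∀ t ∈ Ioo a b, Continuous fun θ : ℝ => H (t + θ * Complex.I) := fun t ht =>
    hH.continuousOn.comp_continuous (by fun_prop) fun θ => ofReal_add_mul_I_mem_strip ht θ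
  have hut : ∀ t ∈ Ioo a b, Continuous (u t) := fun t ht =>
    continuous_iff_continuousAt.2 fun θ => (huB t ht θ).continuousAt
  have hAt : ∀ t ∈ Ioo a b, Continuous (A t) := fun t ht =>
    (Complex.continuous_re.comp (hsec t ht)).congr fun θ => (hAre t ht θ).symm
  have hBt : ∀ t ∈ Ioo a b, Continuous (B t) := fun t ht =>
    (Complex.continuous_im.comp (hsec t ht)).neg.congr fun θ => (hBim t ht θ).symm
  have hzero : ∀ n : ℤ, n ≠ 0 → ∀ t ∈ Ioo a b, ∫ θ in (0 : ℝ)..2 * Real.pi,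
      H (t + θ * Complex.I) * Complex.exp (-(n * (θ * Complex.I))) = 0 := by
    intro n hn
    obtain ⟨c, hc⟩ := exists_fourierMode_eq hab hH hHper n
    have hn' : (n : ℂ) ≠ 0 := by exact_mod_cast hn
    have hnR : (n : ℝ) ≠ 0 := by exact_mod_cast hn
    set E : ℝ → ℂ := fun θ => Complex.exp (-(n * (θ * Complex.I))) with hE
    have hEc : Continuous E := by fun_prop
    have hE' : ∀ θ, HasDerivAt E (-(n * Complex.I) * E θ) θ := by
      intro θ
      have h1 : HasDerivAt (fun θ : ℝ => -((n : ℂ) * (θ * Complex.I))) (-(n * Complex.I)) θ := by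
        have := (((Complex.ofRealCLM.hasDerivAt (x := θ)).mul_const Complex.I).const_mul
          (n : ℂ)).fun_neg
        simpa using this
      simpa [hE, mul_comm] using h1.cexp
    set U : ℝ → ℂ := fun t => ∫ θ in (0 : ℝ)..2 * Real.pi, (u t θ : ℂ) * E θ with hU
    -- integration by parts in the angle
    have hparts : ∀ t ∈ Ioo a b, ∫ θ in (0 : ℝ)..2 * Real.pi, (B t θ : ℂ) * E θ =
        n * Complex.I * U t := by
      intro t ht
      have hEper : E (2 * Real.pi) = E 0 := by
        simp only [hE]
        rw [show -((n : ℂ) * (((2 * Real.pi : ℝ) : ℂ) * Complex.I)) =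
          ((-n : ℤ) : ℂ) * (2 * Real.pi * Complex.I) by push_cast; ring,
          Complex.exp_int_mul_two_pi_mul_I]
        simp
      have hu0 : u t (2 * Real.pi) = u t 0 := by simpa using hper t ht 0
      have hbt := hBt t ht
      have hutc := hut t ht
      have h1 : ∫ θ in (0 : ℝ)..2 * Real.pi,
          ((B t θ : ℂ) * E θ + (u t θ : ℂ) * (-(n * Complex.I) * E θ)) = 0 := by
        rw [intervalIntegral.integral_eq_sub_of_hasDerivAt
          (f := fun θ => (u t θ : ℂ) * E θ)
          (fun θ _ => (huB t ht θ).ofReal_comp.mul (hE' θ))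
          (Continuous.intervalIntegrable (by fun_prop) _ _), hEper, hu0, sub_self]
      rw [intervalIntegral.integral_add (Continuous.intervalIntegrable (by fun_prop) _ _)
        (Continuous.intervalIntegrable (by fun_prop) _ _)] at h1
      have h2 : ∫ θ in (0 : ℝ)..2 * Real.pi, (u t θ : ℂ) * (-(n * Complex.I) * E θ) =
          -(n * Complex.I) * U t := by
        rw [hU, ← intervalIntegral.integral_const_mul]
        congr 1; ext θ; ring
      rw [h2] at h1
      linear_combination h1
    have hmodeH : ∀ t ∈ Ioo a b, ∫ θ in (0 : ℝ)..2 * Real.pi,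
        ((A t θ : ℂ) + n * u t θ) * E θ = c * Real.exp (n * t) := by
      intro t ht
      have hat := hAt t ht
      have hbt := hBt t ht
      have hutc := hut t ht
      rw [← hc t ht]
      have h1 : ∫ θ in (0 : ℝ)..2 * Real.pi, H (t + θ * Complex.I) *
          Complex.exp (-(n * (θ * Complex.I))) =
          (∫ θ in (0 : ℝ)..2 * Real.pi, (A t θ : ℂ) * E θ) -
          Complex.I * ∫ θ in (0 : ℝ)..2 * Real.pi, (B t θ : ℂ) * E θ := by
        rw [← intervalIntegral.integral_const_mul, ← intervalIntegral.integral_sub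
          (Continuous.intervalIntegrable (by fun_prop) _ _)
          (Continuous.intervalIntegrable (by fun_prop) _ _)]
        refine intervalIntegral.integral_congr fun θ _ => ?_
        simp only [hHAB t ht θ, hE]
        ring
      have h2 : ∫ θ in (0 : ℝ)..2 * Real.pi, ((A t θ : ℂ) + n * u t θ) * E θ =
          (∫ θ in (0 : ℝ)..2 * Real.pi, (A t θ : ℂ) * E θ) + n * U t := by
        rw [hU, ← intervalIntegral.integral_const_mul, ← intervalIntegral.integral_add
          (Continuous.intervalIntegrable (by fun_prop) _ _)
          (Continuous.intervalIntegrable (by fun_prop) _ _)]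
        congr 1; ext θ; ring
      rw [h1, h2, hparts t ht]
      linear_combination (n : ℂ) * U t * Complex.I_sq
    have hFTC : ∀ s ∈ Ioo a b, ∀ t ∈ Ioo a b, Real.exp (n * t) * U t - Real.exp (n * s) * U s =
        c * ((Real.exp (2 * n * t) - Real.exp (2 * n * s)) / (2 * n)) := by
      intro s hs t ht
      have hsub : uIcc s t ⊆ Ioo a b := ordConnected_Ioo.uIcc_subset hs ht
      have h1 : ∀ θ : ℝ, ∫ τ in s..t, ((Real.exp (n * τ) : ℝ) : ℂ) *
          (((A τ θ : ℂ) + n * u τ θ) * E θ) =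
          Real.exp (n * t) * ((u t θ : ℂ) * E θ) - Real.exp (n * s) * ((u s θ : ℂ) * E θ) := by
        intro θ
        rw [intervalIntegral.integral_eq_sub_of_hasDerivAt
          (f := fun τ => ((Real.exp (n * τ) : ℝ) : ℂ) * ((u τ θ : ℂ) * E θ))]
        · intro τ hτ
          have h2 : HasDerivAt (fun τ : ℝ => Real.exp (n * τ)) (n * Real.exp (n * τ)) τ := by
            simpa [mul_comm] using ((hasDerivAt_id τ).const_mul (n : ℝ)).exp
          refine (h2.ofReal_comp.mul
            ((huA τ (hsub hτ) θ).ofReal_comp.mul_const (E θ))).congr_deriv ?_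
          push_cast
          ring
        · refine ContinuousOn.intervalIntegrable ?_
          have hm : MapsTo (fun τ : ℝ => (τ, θ)) (uIcc s t) (Ioo a b ×ˢ univ) := fun τ hτ =>
            ⟨hsub hτ, mem_univ _⟩
          have h3 : ContinuousOn (fun τ : ℝ => A τ θ) (uIcc s t) :=
            hA.comp (by fun_prop) hm
          have h4 : ContinuousOn (fun τ : ℝ => u τ θ) (uIcc s t) :=
            hcu.comp (by fun_prop) hm
          fun_prop
      have hutc := hut t ht
      have husc := hut s hs
      have h5 : Real.exp (n * t) * U t - Real.exp (n * s) * U s =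
          ∫ θ in (0 : ℝ)..2 * Real.pi, ∫ τ in s..t, ((Real.exp (n * τ) : ℝ) : ℂ) *
            (((A τ θ : ℂ) + n * u τ θ) * E θ) := by
        simp only [h1]
        rw [intervalIntegral.integral_sub (Continuous.intervalIntegrable (by fun_prop) _ _)
          (Continuous.intervalIntegrable (by fun_prop) _ _), intervalIntegral.integral_const_mul,
          intervalIntegral.integral_const_mul]
      rw [h5, ← intervalIntegral_swap_of_continuousOn (f := fun τ θ =>
        ((Real.exp (n * τ) : ℝ) : ℂ) * (((A τ θ : ℂ) + n * u τ θ) * E θ))]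
      · simp only [intervalIntegral.integral_const_mul]
        have h6 : ∀ τ ∈ uIcc s t, ((Real.exp (n * τ) : ℝ) : ℂ) *
            (∫ θ in (0 : ℝ)..2 * Real.pi, ((A τ θ : ℂ) + n * u τ θ) * E θ) =
            c * Complex.exp ((2 * n : ℂ) * τ) := by
          intro τ hτ
          rw [hmodeH τ (hsub hτ), mul_left_comm, ← Complex.ofReal_mul, ← Real.exp_add]
          push_cast
          ring_nf
        rw [intervalIntegral.integral_congr h6, intervalIntegral.integral_const_mul,
          integral_exp_mul_complex (by simpa using hn)]
        push_cast
        rfl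
      · have hm : uIcc s t ×ˢ uIcc 0 (2 * Real.pi) ⊆ Ioo a b ×ˢ (univ : Set ℝ) :=
          prod_mono hsub (subset_univ _)
        have h3 := hA.mono hm
        have h4 := hcu.mono hm
        fun_prop
    have hc0 : c = 0 := by
      have hmid : (a + b) / 2 ∈ Ioo a b := ⟨by linarith, by linarith⟩
      have hUb := hlimb n hn
      have hUa := hlima n hn
      -- the function `e^(nt) U - c e^(2nt) / 2n` is constant; compare its limits at the ends
      have hlimit : ∀ (l : Filter ℝ) (p : ℝ), l.NeBot → Filter.Tendsto U l (nhds 0) →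
          Filter.Tendsto (fun t : ℝ => t) l (nhds p) → (∀ᶠ t in l, t ∈ Ioo a b) →
          (0 - Real.exp (n * ((a + b) / 2)) * U ((a + b) / 2) : ℂ) =
          c * ((Real.exp (2 * n * p) - Real.exp (2 * n * ((a + b) / 2))) / (2 * n)) := by
        intro l p hl hU0 hp hev
        have hexp : ∀ m : ℝ, Filter.Tendsto (fun t : ℝ => ((Real.exp (m * t) : ℝ) : ℂ)) l
            (nhds (Real.exp (m * p) : ℝ)) := fun m =>
          ((by fun_prop : Continuous fun t : ℝ => ((Real.exp (m * t) : ℝ) : ℂ)).tendsto p).comp hp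
        have h1 := ((hexp n).mul hU0).sub_const (Real.exp (n * ((a + b) / 2)) * U ((a + b) / 2) : ℂ)
        have h2 := (((hexp (2 * n)).sub_const
          ((Real.exp (2 * n * ((a + b) / 2)) : ℝ) : ℂ)).div_const (2 * n : ℂ)).const_mul c
        rw [mul_zero] at h1
        refine tendsto_nhds_unique_of_eventuallyEq h1 h2 ?_
        filter_upwards [hev] with t ht using hFTC _ hmid t ht
      have eb := hlimit (nhdsWithin b (Iio b)) b inferInstance hUb
        (Filter.tendsto_id.mono_left nhdsWithin_le_nhds) (Ioo_mem_nhdsLT hab)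
      have ea := hlimit (nhdsWithin a (Ioi a)) a inferInstance hUa
        (Filter.tendsto_id.mono_left nhdsWithin_le_nhds) (Ioo_mem_nhdsGT hab)
      have hd : c * ((Real.exp (2 * n * b) - Real.exp (2 * n * a) : ℝ) : ℂ) = 0 := by
        have h3 := ea.symm.trans eb
        have h4 : (2 * n : ℂ) ≠ 0 := by simpa using hn
        field_simp at h3
        push_cast at h3 ⊢
        linear_combination -h3
      refine (mul_eq_zero.1 hd).resolve_right ?_
      intro h
      rw [Complex.ofReal_eq_zero, sub_eq_zero] at h
      have := Real.exp_injective h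
      have h5 : (2 * (n : ℝ)) ≠ 0 := by simpa using hn
      exact hab.ne (mul_left_cancel₀ h5 this).symm
    intro t ht
    rw [hc t ht, hc0, zero_mul]
  have hmid : (a + b) / 2 ∈ Ioo a b := ⟨by linarith, by linarith⟩
  set m : ℂ := (2 * Real.pi : ℝ)⁻¹ • ∫ θ in (0 : ℝ)..2 * Real.pi,
    H (((a + b) / 2 : ℝ) + θ * Complex.I) with hm
  have hconst : ∀ t ∈ Ioo a b, ∀ θ : ℝ, H (t + θ * Complex.I) = m := by
    intro t ht θ
    have := eq_const_of_fourierMode_eq_zero (hsec t ht) (fun θ => by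
      have := hHper _ (ofReal_add_mul_I_mem_strip ht θ)
      beta_reduce
      rw [← this]
      congr 1
      push_cast; ring) (fun n hn => hzero n hn t ht) θ
    rw [this, hm, integral_vertical_eq hH hHper hmid ht]
  refine ⟨m.re, fun t ht θ => ⟨by rw [hAre t ht θ, hconst t ht θ], ?_⟩⟩
  have hBc : ∀ θ, B t θ = -m.im := fun θ => by rw [hBim t ht θ, hconst t ht θ]
  have h1 : ∫ θ in (0 : ℝ)..2 * Real.pi, B t θ = u t (2 * Real.pi) - u t 0 :=
    intervalIntegral.integral_eq_sub_of_hasDerivAt (fun θ _ => huB t ht θ)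
      ((hBt t ht).intervalIntegrable _ _)
  have hu0 : u t (2 * Real.pi) = u t 0 := by simpa using hper t ht 0
  simp only [hBc, hu0, sub_self, intervalIntegral.integral_const, sub_zero, smul_eq_mul] at h1
  rw [hBc]
  exact (mul_eq_zero.1 h1).resolve_left (by positivity)

/-! ### The height function of a minimal annulus of finite area -/

/-- The complex gradient `F_x - i F_y` of a map. -/
def complexGradient (F : ℂ → E3) (z : ℂ) (j : Fin 3) : ℂ :=
  fderiv ℝ (fun w => F w j) z 1 - Complex.I * fderiv ℝ (fun w => F w j) z Complex.I

lemma IsMinimalAnnulus.contDiffOn {h S₀ S₁ : ℝ} {G : ℂ → E3} (hG : IsMinimalAnnulus h S₀ S₁ G) :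
    ContDiffOn ℝ 1 G (annulusDomain S₀ S₁) :=
  hG.harmonic.contDiffOn.of_le (by norm_num)

lemma IsMinimalAnnulus.hasComplexGradientAt {h S₀ S₁ : ℝ} {G : ℂ → E3}
    (hG : IsMinimalAnnulus h S₀ S₁ G) {z : ℂ} (hz : z ∈ annulusDomain S₀ S₁) :
    HasComplexGradientAt G (complexGradient G z) z :=
  hasComplexGradientAt_of_differentiableAt (hG.conformal z hz).differentiableAt

lemma IsMinimalAnnulus.differentiableOn_complexGradient {h S₀ S₁ : ℝ} {G : ℂ → E3}
    (hG : IsMinimalAnnulus h S₀ S₁ G) (j : Fin 3) :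
    DifferentiableOn ℂ (fun z => complexGradient G z j) (annulusDomain S₀ S₁) := by
  intro z hz
  have h1 : InnerProductSpace.HarmonicAt (fun w => G w j) z :=
    (hG.harmonic z hz).comp_CLM (EuclideanSpace.proj j : E3 →L[ℝ] ℝ)
  exact (HarmonicAt.differentiableAt_complex_partial h1).differentiableWithinAt

lemma HasComplexGradientAt.hasDerivAt_radial {F : ℂ → E3} {φ : Fin 3 → ℂ} {t θ : ℝ}
    (h : HasComplexGradientAt F φ (Complex.exp (t + θ * Complex.I))) (j : Fin 3) :
    HasDerivAt (fun t : ℝ => F (Complex.exp (t + θ * Complex.I)) j)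
      (φ j * Complex.exp (t + θ * Complex.I)).re t := by
  have h1 : HasDerivAt (fun t : ℝ => Complex.exp (t + θ * Complex.I))
      (Complex.exp (t + θ * Complex.I)) t := by
    have : HasDerivAt (fun t : ℝ => (t : ℂ) + θ * Complex.I) 1 t :=
      (Complex.ofRealCLM.hasDerivAt (x := t)).add_const _
    simpa using this.cexp
  exact (h j).comp_hasDerivAt t h1

lemma HasComplexGradientAt.hasDerivAt_angular {F : ℂ → E3} {φ : Fin 3 → ℂ} {t θ : ℝ}
    (h : HasComplexGradientAt F φ (Complex.exp (t + θ * Complex.I))) (j : Fin 3) :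
    HasDerivAt (fun θ : ℝ => F (Complex.exp (t + θ * Complex.I)) j)
      (-(φ j * Complex.exp (t + θ * Complex.I)).im) θ := by
  have h1 : HasDerivAt (fun θ : ℝ => Complex.exp (t + θ * Complex.I))
      (Complex.exp (t + θ * Complex.I) * Complex.I) θ := by
    have : HasDerivAt (fun θ : ℝ => (t : ℂ) + θ * Complex.I) Complex.I θ := by
      simpa using ((Complex.ofRealCLM.hasDerivAt (x := θ)).mul_const Complex.I).const_add (t : ℂ)
    exact this.cexp
  refine ((h j).comp_hasDerivAt θ h1).congr_deriv ?_
  rw [reMulCLM_apply, ← mul_assoc, Complex.mul_I_re]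

/-- Properness: the part of the surface in a compact subset of the slab stays away from both ends. -/
lemma IsMinimalAnnulus.exists_radii {h S₀ S₁ : ℝ} {G : ℂ → E3} (hG : IsMinimalAnnulus h S₀ S₁ G)
    {K : Set E3} (hK : IsCompact K) (hKs : K ⊆ slab h) :
    ∃ r₀ r₁ : ℝ, S₀ < r₀ ∧ r₁ < S₁ ∧ ∀ z ∈ annulusDomain S₀ S₁, G z ∈ K → r₀ ≤ ‖z‖ ∧ ‖z‖ ≤ r₁ := by
  have hK' : IsCompact ((↑) ⁻¹' K : Set (slab h)) :=
    Topology.IsInducing.subtypeVal.isCompact_preimage' hK (by simpa using hKs)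
  have hL := (hG.proper.isCompact_preimage hK').image continuous_subtype_val
  set L := Subtype.val '' ((hG.mapsTo.restrict G _ _) ⁻¹' ((↑) ⁻¹' K : Set (slab h))) with hLdef
  have hLA : L ⊆ annulusDomain S₀ S₁ := by
    rintro _ ⟨z, -, rfl⟩; exact z.2
  have hmem : ∀ z ∈ annulusDomain S₀ S₁, G z ∈ K → z ∈ L := fun z hz hzK =>
    ⟨⟨z, hz⟩, hzK, rfl⟩
  rcases L.eq_empty_or_nonempty with he | hne
  · refine ⟨S₀ + 1, S₁ - 1, by linarith, by linarith, fun z hz hzK => ?_⟩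
    have := hmem z hz hzK
    rw [he] at this
    exact this.elim
  · obtain ⟨p, hp, hpm⟩ := hL.exists_isMinOn hne continuous_norm.continuousOn
    obtain ⟨q, hq, hqm⟩ := hL.exists_isMaxOn hne continuous_norm.continuousOn
    exact ⟨‖p‖, ‖q‖, (hLA hp).1, (hLA hq).2, fun z hz hzK =>
      ⟨hpm (hmem z hz hzK), hqm (hmem z hz hzK)⟩⟩

/-- Along a path that approaches an end of the annulus and has bounded image, the height tends to
`±h`. -/
lemma IsMinimalAnnulus.tendsto_abs_height {h S₀ S₁ : ℝ} {G : ℂ → E3}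
    (hG : IsMinimalAnnulus h S₀ S₁ G) {γ : ℝ → ℂ} {l : Filter ℝ}
    (hγ : ∀ᶠ t in l, γ t ∈ annulusDomain S₀ S₁) {M : ℝ} (hM : ∀ᶠ t in l, ‖G (γ t)‖ ≤ M)
    (hend : (∀ r₀, S₀ < r₀ → ∀ᶠ t in l, ‖γ t‖ < r₀) ∨ (∀ r₁, r₁ < S₁ → ∀ᶠ t in l, r₁ < ‖γ t‖)) :
    Filter.Tendsto (fun t => |G (γ t) 2|) l (nhds h) := by
  rw [tendsto_order]
  constructor
  · intro m hm
    set K : Set E3 := {p | |p 2| ≤ m} ∩ Metric.closedBall 0 M with hKdef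
    have hK : IsCompact K := by
      refine (isCompact_closedBall (0 : E3) M).inter_left ?_
      exact isClosed_le (by fun_prop) continuous_const
    have hKs : K ⊆ slab h := fun p hp => abs_lt.1 (lt_of_le_of_lt hp.1 hm)
    obtain ⟨r₀, r₁, h0, h1, hr⟩ := hG.exists_radii hK hKs
    have hout : ∀ t, γ t ∈ annulusDomain S₀ S₁ → ‖G (γ t)‖ ≤ M → |G (γ t) 2| ≤ m →
        r₀ ≤ ‖γ t‖ ∧ ‖γ t‖ ≤ r₁ := fun t ht1 ht2 ht3 => hr _ ht1 ⟨ht3, by simpa using ht2⟩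
    rcases hend with he | he
    · filter_upwards [hγ, hM, he r₀ h0] with t ht1 ht2 ht3
      by_contra hle
      linarith [(hout t ht1 ht2 (not_lt.1 hle)).1]
    · filter_upwards [hγ, hM, he r₁ h1] with t ht1 ht2 ht3
      by_contra hle
      linarith [(hout t ht1 ht2 (not_lt.1 hle)).2]
  · intro m hm
    filter_upwards [hγ] with t ht
    exact (abs_lt.2 (hG.mapsTo ht)).trans hm

lemma continuousOn_intervalIntegral {a b c d : ℝ} {f : ℝ → ℝ → ℝ}
    (hf : ContinuousOn (fun p : ℝ × ℝ => f p.1 p.2) (Ioo a b ×ˢ univ)) :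
    ContinuousOn (fun t => ∫ θ in c..d, f t θ) (Ioo a b) := by
  intro t ht
  obtain ⟨s₀, hs₀, hs₀t⟩ := exists_between ht.1
  obtain ⟨s₁, hts₁, hs₁⟩ := exists_between ht.2
  have hclamp : Continuous fun p : ℝ × ℝ => ((max s₀ (min s₁ p.1), p.2) : ℝ × ℝ) := by fun_prop
  have hcm : ∀ p : ℝ × ℝ, ((max s₀ (min s₁ p.1), p.2) : ℝ × ℝ) ∈ Ioo a b ×ˢ univ := fun p =>
    ⟨⟨lt_of_lt_of_le hs₀ (le_max_left _ _), max_lt (hs₀t.trans ht.2)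
      (lt_of_le_of_lt (min_le_left _ _) hs₁)⟩, mem_univ _⟩
  have hc : Continuous fun τ => ∫ θ in c..d, f (max s₀ (min s₁ τ)) θ :=
    intervalIntegral.continuous_parametric_intervalIntegral_of_continuous'
      (f := fun τ θ => f (max s₀ (min s₁ τ)) θ) (hf.comp_continuous hclamp hcm) _ _
  refine (hc.continuousAt.congr ?_).continuousWithinAt
  filter_upwards [Ioo_mem_nhds hs₀t hts₁] with τ hτ
  rw [min_eq_right hτ.2.le, max_eq_right hτ.1.le]

lemma continuousOn_areaElement {S₀ S₁ : ℝ} (h₀ : 0 < S₀) (h₁ : 0 < S₁) {G : ℂ → E3}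
    (hG : ContDiffOn ℝ 1 G (annulusDomain S₀ S₁)) :
    ContinuousOn (fun p : ℝ × ℝ => Real.exp (2 * p.1) *
      ‖normalVector G (Complex.exp (p.1 + p.2 * Complex.I))‖)
      (Ioo (Real.log S₀) (Real.log S₁) ×ˢ univ) := by
  refine ContinuousOn.mul (by fun_prop) (((continuousOn_normalVector (isOpen_annulusDomain _ _)
    hG).comp (by fun_prop) fun p hp => ?_).norm)
  rw [exp_mem_annulusDomain_iff h₀ h₁]
  simpa using hp.1

lemma continuousOn_areaDensity {S₀ S₁ : ℝ} (h₀ : 0 < S₀) (h₁ : 0 < S₁) {G : ℂ → E3}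
    (hG : ContDiffOn ℝ 1 G (annulusDomain S₀ S₁)) :
    ContinuousOn (areaDensity G) (Ioo (Real.log S₀) (Real.log S₁)) :=
  continuousOn_intervalIntegral (f := fun t θ => Real.exp (2 * t) *
    ‖normalVector G (Complex.exp (t + θ * Complex.I))‖) (continuousOn_areaElement h₀ h₁ hG)

lemma areaDensity_nonneg (G : ℂ → E3) (t : ℝ) : 0 ≤ areaDensity G t :=
  intervalIntegral.integral_nonneg (by have := Real.pi_pos; positivity) fun _ _ => by positivity

lemma integrableOn_areaDensity {S₀ S₁ : ℝ} (h₀ : 0 < S₀) (h₁ : 0 < S₁) {G : ℂ → E3}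
    (hG : ContDiffOn ℝ 1 G (annulusDomain S₀ S₁)) (hfin : area S₀ S₁ G ≠ ⊤) :
    IntegrableOn (areaDensity G) (Ioo (Real.log S₀) (Real.log S₁)) := by
  refine ⟨(continuousOn_areaDensity h₀ h₁ hG).aestronglyMeasurable measurableSet_Ioo, ?_⟩
  rw [hasFiniteIntegral_iff_ofReal (Filter.Eventually.of_forall (areaDensity_nonneg G)),
    ← area_eq_lintegral_areaDensity h₀ h₁ hG]
  exact hfin.lt_top

/-- For almost every angle, the area element is integrable along the radius. -/
lemma ae_lintegral_radius_lt_top {S₀ S₁ : ℝ} (h₀ : 0 < S₀) (h₁ : 0 < S₁) {G : ℂ → E3}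
    (hG : ContDiffOn ℝ 1 G (annulusDomain S₀ S₁)) (hfin : area S₀ S₁ G ≠ ⊤) :
    ∀ᵐ θ : ℝ, θ ∈ uIoc 0 (2 * Real.pi) →
      IntegrableOn (fun t => Real.exp (2 * t) *
        ‖normalVector G (Complex.exp (t + θ * Complex.I))‖) (Ioo (Real.log S₀) (Real.log S₁)) := by
  have hpi := Real.pi_pos
  have hc := continuousOn_areaElement h₀ h₁ hG
  rw [uIoc_of_le (by positivity), ← ae_restrict_iff' measurableSet_Ioc]
  have hint : ∫⁻ t in Ioo (Real.log S₀) (Real.log S₁), ∫⁻ θ in Ioc 0 (2 * Real.pi),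
      ENNReal.ofReal (Real.exp (2 * t) * ‖normalVector G (Complex.exp (t + θ * Complex.I))‖) =
      area S₀ S₁ G := by
    rw [area_eq_lintegral_areaDensity h₀ h₁ hG]
    refine setLIntegral_congr_fun measurableSet_Ioo fun t ht => ?_
    rw [areaDensity, intervalIntegral.integral_of_le (by positivity),
      ofReal_integral_eq_lintegral_ofReal]
    · have : Continuous fun θ : ℝ => Real.exp (2 * t) *
          ‖normalVector G (Complex.exp (t + θ * Complex.I))‖ :=
        hc.comp_continuous (by fun_prop : Continuous fun θ : ℝ => ((t, θ) : ℝ × ℝ))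
          fun θ => ⟨ht, mem_univ _⟩
      exact (this.integrableOn_Icc (a := 0) (b := 2 * Real.pi)).mono_set Ioc_subset_Icc_self
    · exact Filter.Eventually.of_forall fun θ => by positivity
  have hmeas : AEMeasurable (Function.uncurry fun t θ : ℝ => ENNReal.ofReal (Real.exp (2 * t) *
      ‖normalVector G (Complex.exp (t + θ * Complex.I))‖))
      ((volume.restrict (Ioo (Real.log S₀) (Real.log S₁))).prod
        (volume.restrict (Ioc 0 (2 * Real.pi)))) := by
    rw [Measure.prod_restrict]
    exact ((hc.mono (prod_mono subset_rfl (subset_univ _))).aemeasurable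
      (measurableSet_Ioo.prod measurableSet_Ioc)).ennreal_ofReal
  rw [lintegral_lintegral_swap hmeas] at hint
  have hae := ae_lt_top' hmeas.lintegral_prod_left' (hint ▸ hfin)
  filter_upwards [hae] with θ hθ
  refine ⟨?_, ?_⟩
  · refine ContinuousOn.aestronglyMeasurable (hc.comp (by fun_prop :
      ContinuousOn (fun t : ℝ => ((t, θ) : ℝ × ℝ)) _) fun t ht => ⟨ht, mem_univ _⟩) measurableSet_Ioo
  · rw [hasFiniteIntegral_iff_ofReal (Filter.Eventually.of_forall fun t => by positivity)]
    exact hθ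

lemma abs_sub_le_setIntegral {a b : ℝ} {f f' g : ℝ → ℝ}
    (hf : ∀ τ ∈ Ioo a b, HasDerivAt f (f' τ) τ) (hf' : ContinuousOn f' (Ioo a b))
    (hg : IntegrableOn g (Ioo a b)) (hle : ∀ τ ∈ Ioo a b, |f' τ| ≤ g τ) {s t : ℝ}
    (hs : s ∈ Ioo a b) (ht : t ∈ Ioo a b) : |f t - f s| ≤ ∫ τ in Ioo a b, g τ := by
  have hsub : uIcc s t ⊆ Ioo a b := ordConnected_Ioo.uIcc_subset hs ht
  have hsub' : uIoc s t ⊆ Ioo a b := uIoc_subset_uIcc.trans hsub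
  have hi : IntervalIntegrable f' volume s t := (hf'.mono hsub).intervalIntegrable
  have hg0 : 0 ≤ᵐ[volume.restrict (Ioo a b)] g :=
    (ae_restrict_iff' measurableSet_Ioo).2 (Filter.Eventually.of_forall fun τ hτ =>
      (abs_nonneg _).trans (hle τ hτ))
  rw [← intervalIntegral.integral_eq_sub_of_hasDerivAt (fun τ hτ => hf τ (hsub hτ)) hi,
    ← Real.norm_eq_abs]
  calc _ ≤ ∫ τ in uIoc s t, ‖f' τ‖ := intervalIntegral.norm_integral_le_integral_norm_uIoc
    _ ≤ ∫ τ in uIoc s t, g τ := setIntegral_mono_on hi.norm.def' (hg.mono_set hsub')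
        measurableSet_uIoc fun τ hτ => hle τ (hsub' hτ)
    _ ≤ _ := setIntegral_mono_set hg hg0 hsub'.eventuallyLE

lemma norm_le_sum_abs (p : E3) : ‖p‖ ≤ |p 0| + |p 1| + |p 2| := by
  rw [← abs_of_nonneg (norm_nonneg p), ← abs_of_nonneg (show 0 ≤ |p 0| + |p 1| + |p 2| by positivity),
    ← sq_le_sq, norm_sq_e3, ← sq_abs (p 0), ← sq_abs (p 1), ← sq_abs (p 2)]
  nlinarith [mul_nonneg (abs_nonneg (p 0)) (abs_nonneg (p 1)),
    mul_nonneg (abs_nonneg (p 0)) (abs_nonneg (p 2)),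
    mul_nonneg (abs_nonneg (p 1)) (abs_nonneg (p 2))]

/-- The energy density is at most twice the area element, in logarithmic coordinates. -/
lemma IsMinimalAnnulus.normSq_gradient_le {h S₀ S₁ : ℝ} {G : ℂ → E3}
    (hG : IsMinimalAnnulus h S₀ S₁ G) {t θ : ℝ}
    (hz : Complex.exp (t + θ * Complex.I) ∈ annulusDomain S₀ S₁) (j : Fin 3) :
    Complex.normSq (complexGradient G (Complex.exp (t + θ * Complex.I)) j *
      Complex.exp (t + θ * Complex.I)) ≤
      2 * (Real.exp (2 * t) * ‖normalVector G (Complex.exp (t + θ * Complex.I))‖) := by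
  have hgr := hG.hasComplexGradientAt hz
  rw [hgr.norm_normalVector ((hG.conformal _ hz).isotropic hgr), map_mul]
  have e2 : Complex.normSq (Complex.exp (t + θ * Complex.I)) = Real.exp (2 * t) := by
    rw [Complex.normSq_eq_norm_sq, Complex.norm_exp, ← Real.exp_nat_mul]; simp
  have n0 := Complex.normSq_nonneg (complexGradient G (Complex.exp (t + θ * Complex.I)) 0)
  have n1 := Complex.normSq_nonneg (complexGradient G (Complex.exp (t + θ * Complex.I)) 1)
  have n2 := Complex.normSq_nonneg (complexGradient G (Complex.exp (t + θ * Complex.I)) 2)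
  have hle : Complex.normSq (complexGradient G (Complex.exp (t + θ * Complex.I)) j) ≤
      Complex.normSq (complexGradient G (Complex.exp (t + θ * Complex.I)) 0) +
      Complex.normSq (complexGradient G (Complex.exp (t + θ * Complex.I)) 1) +
      Complex.normSq (complexGradient G (Complex.exp (t + θ * Complex.I)) 2) := by
    fin_cases j <;> simp <;> linarith
  rw [e2]
  have := Real.exp_pos (2 * t)
  nlinarith

/-- A radius along which the area element is integrable has a bounded image. -/
lemma IsMinimalAnnulus.bounded_radius {h S₀ S₁ : ℝ} {G : ℂ → E3} (hG : IsMinimalAnnulus h S₀ S₁ G)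
    {θ : ℝ} (hθ : IntegrableOn (fun t => Real.exp (2 * t) *
        ‖normalVector G (Complex.exp (t + θ * Complex.I))‖) (Ioo (Real.log S₀) (Real.log S₁))) :
    ∃ M, ∀ t ∈ Ioo (Real.log S₀) (Real.log S₁), ‖G (Complex.exp (t + θ * Complex.I))‖ ≤ M := by
  have h₀ := hG.inner_pos
  have h₁ : 0 < S₁ := h₀.trans hG.inner_lt_outer
  have hab : Real.log S₀ < Real.log S₁ := Real.log_lt_log h₀ hG.inner_lt_outer
  have hexp : ∀ t ∈ Ioo (Real.log S₀) (Real.log S₁),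
      Complex.exp (t + θ * Complex.I) ∈ annulusDomain S₀ S₁ := by
    intro t ht
    rw [exp_mem_annulusDomain_iff h₀ h₁]
    simpa using ht
  obtain ⟨m, hm⟩ := exists_between hab
  have hint : IntegrableOn (fun t => 1 + 2 * (Real.exp (2 * t) *
      ‖normalVector G (Complex.exp (t + θ * Complex.I))‖)) (Ioo (Real.log S₀) (Real.log S₁)) :=
    (integrableOn_const (by simp)).add (hθ.const_mul 2)
  have hinc : ∀ j, ∀ t ∈ Ioo (Real.log S₀) (Real.log S₁),
      |G (Complex.exp (t + θ * Complex.I)) j - G (Complex.exp (m + θ * Complex.I)) j| ≤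
      ∫ t in Ioo (Real.log S₀) (Real.log S₁), (1 + 2 * (Real.exp (2 * t) *
      ‖normalVector G (Complex.exp (t + θ * Complex.I))‖)) := by
    intro j t ht
    refine abs_sub_le_setIntegral (f := fun t => G (Complex.exp (t + θ * Complex.I)) j)
      (fun τ hτ => (hG.hasComplexGradientAt (hexp τ hτ)).hasDerivAt_radial j) ?_ hint ?_ hm ht
    · refine Complex.continuous_re.comp_continuousOn (ContinuousOn.mul ?_ (by fun_prop))
      exact (hG.differentiableOn_complexGradient j).continuousOn.comp
        (f := fun t : ℝ => Complex.exp (t + θ * Complex.I)) (by fun_prop) hexp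
    · intro τ hτ
      have h1 := hG.normSq_gradient_le (hexp τ hτ) j
      set q := complexGradient G (Complex.exp (τ + θ * Complex.I)) j *
        Complex.exp (τ + θ * Complex.I)
      rw [Complex.normSq_apply] at h1
      have h2 : |q.re| ≤ 1 + q.re * q.re := by
        rw [← abs_mul_abs_self q.re]; nlinarith [sq_nonneg (|q.re| - 1), abs_nonneg q.re]
      nlinarith [mul_self_nonneg q.im]
  have habs : ∀ x y I : ℝ, |x - y| ≤ I → |x| ≤ I + |y| := fun x y I hxy => by
    have := abs_add_le (x - y) y
    rw [sub_add_cancel] at this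
    linarith
  refine ⟨_, fun t ht => (norm_le_sum_abs _).trans (add_le_add (add_le_add
    (habs _ _ _ (hinc 0 t ht)) (habs _ _ _ (hinc 1 t ht))) (habs _ _ _ (hinc 2 t ht)))⟩

/-- The reflection of `tendsto_fourierMode_of_finite_energy` to the left end of the strip. -/
theorem tendsto_fourierMode_of_finite_energy_left {a b h : ℝ} (hab : a < b) (hh : 0 < h)
    {u A B : ℝ → ℝ → ℝ}
    (hA : ContinuousOn (fun p : ℝ × ℝ => A p.1 p.2) (Ioo a b ×ˢ univ))
    (hB : ContinuousOn (fun p : ℝ × ℝ => B p.1 p.2) (Ioo a b ×ˢ univ))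
    (huA : ∀ t ∈ Ioo a b, ∀ θ, HasDerivAt (fun t => u t θ) (A t θ) t)
    (huB : ∀ t ∈ Ioo a b, ∀ θ, HasDerivAt (fun θ => u t θ) (B t θ) θ)
    (hper : ∀ t ∈ Ioo a b, Function.Periodic (u t) (2 * Real.pi))
    (hperB : ∀ t ∈ Ioo a b, Function.Periodic (B t) (2 * Real.pi))
    (hbd : ∀ t ∈ Ioo a b, ∀ θ, |u t θ| ≤ h)
    (hE : IntegrableOn (fun t => ∫ θ in (0 : ℝ)..2 * Real.pi, (A t θ ^ 2 + B t θ ^ 2)) (Ioo a b))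
    (hlim : ∀ᵐ θ : ℝ, θ ∈ uIoc 0 (2 * Real.pi) →
      Filter.Tendsto (fun t => |u t θ|) (nhdsWithin a (Ioi a)) (nhds h))
    {n : ℤ} (hn : n ≠ 0) :
    Filter.Tendsto (fun t => ∫ θ in (0 : ℝ)..2 * Real.pi,
      (u t θ : ℂ) * Complex.exp (-(n * (θ * Complex.I)))) (nhdsWithin a (Ioi a)) (nhds 0) := by
  have hneg : ∀ t, t ∈ Ioo (-b) (-a) → -t ∈ Ioo a b := fun t ht =>
    ⟨by linarith [ht.2], by linarith [ht.1]⟩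
  have hnegc : Continuous fun p : ℝ × ℝ => ((-p.1, p.2) : ℝ × ℝ) := by fun_prop
  have hnegm : MapsTo (fun p : ℝ × ℝ => ((-p.1, p.2) : ℝ × ℝ)) (Ioo (-b) (-a) ×ˢ univ)
      (Ioo a b ×ˢ univ) := fun p hp => ⟨hneg p.1 hp.1, mem_univ _⟩
  have htn : Filter.Tendsto (fun t : ℝ => -t) (nhdsWithin (-a) (Iio (-a)))
      (nhdsWithin a (Ioi a)) := by
    simpa using tendsto_neg_nhdsLT (a := -a)
  have htn' : Filter.Tendsto (fun t : ℝ => -t) (nhdsWithin a (Ioi a))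
      (nhdsWithin (-a) (Iio (-a))) := tendsto_neg_nhdsGT
  have hEneg : IntegrableOn (fun t => ∫ θ in (0 : ℝ)..2 * Real.pi,
      ((-A (-t) θ) ^ 2 + B (-t) θ ^ 2)) (Ioo (-b) (-a)) := by
    simp only [neg_sq]
    rw [← intervalIntegrable_iff_integrableOn_Ioo_of_le hab.le] at hE
    rw [← intervalIntegrable_iff_integrableOn_Ioo_of_le (neg_le_neg hab.le)]
    exact ((IntervalIntegrable.iff_comp_neg (by simp)).1 hE).symm
  have := tendsto_fourierMode_of_finite_energy (a := -b) (b := -a) (neg_lt_neg hab) hh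
    (u := fun t θ => u (-t) θ) (A := fun t θ => -A (-t) θ) (B := fun t θ => B (-t) θ)
    ((hA.comp hnegc.continuousOn hnegm).neg) (hB.comp hnegc.continuousOn hnegm)
    (fun t ht θ => by
      have := (huA (-t) (hneg t ht) θ).scomp t (hasDerivAt_neg t)
      simpa [Function.comp_def] using this)
    (fun t ht θ => huB (-t) (hneg t ht) θ)
    (fun t ht => hper (-t) (hneg t ht)) (fun t ht => hperB (-t) (hneg t ht))
    (fun t ht => hbd (-t) (hneg t ht)) hEneg
    (hlim.mono fun θ hθ hmem => (hθ hmem).comp htn) hn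
  simpa [Function.comp_def] using this.comp htn'

set_option maxHeartbeats 1000000 in
/-- The height of a minimal annulus of finite area is an affine function of `log |z|`, with values
`±h` at the two ends. Indeed almost every radius has a finite length, hence ends on the boundary of the
slab, and a function of finite energy with boundary values `±h` has constant boundary values. -/
theorem IsMinimalAnnulus.height_eq {h S₀ S₁ : ℝ} {G : ℂ → E3} (hh : 0 < h)
    (hG : IsMinimalAnnulus h S₀ S₁ G) (hfin : area S₀ S₁ G ≠ ⊤) :
    ∃ α β : ℝ, (∀ z ∈ annulusDomain S₀ S₁, complexGradient G z 2 * z = α) ∧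
      (∀ z ∈ annulusDomain S₀ S₁, G z 2 = α * Real.log ‖z‖ + β) ∧
      |α * Real.log S₀ + β| = h ∧ |α * Real.log S₁ + β| = h := by
  have hpi := Real.pi_pos
  have h₀ := hG.inner_pos
  have h₁ : 0 < S₁ := h₀.trans hG.inner_lt_outer
  set a := Real.log S₀ with ha
  set b := Real.log S₁ with hb
  have hab : a < b := Real.log_lt_log h₀ hG.inner_lt_outer
  have hexp : ∀ t ∈ Ioo a b, ∀ θ : ℝ, Complex.exp (t + θ * Complex.I) ∈ annulusDomain S₀ S₁ := by
    intro t ht θ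
    rw [exp_mem_annulusDomain_iff h₀ h₁]
    simpa using ht
  have hstrip : MapsTo Complex.exp (strip a b) (annulusDomain S₀ S₁) := fun w hw =>
    (exp_mem_annulusDomain_iff h₀ h₁ w).2 hw
  set H : Fin 3 → ℂ → ℂ := fun j w => complexGradient G (Complex.exp w) j * Complex.exp w with hHdef
  have hHd : ∀ j, DifferentiableOn ℂ (H j) (strip a b) := fun j =>
    ((hG.differentiableOn_complexGradient j).comp Complex.differentiable_exp.differentiableOn
      hstrip).mul Complex.differentiable_exp.differentiableOn
  have hperiod : ∀ t θ : ℝ, Complex.exp (t + ((θ + 2 * Real.pi : ℝ) : ℂ) * Complex.I) =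
      Complex.exp (t + θ * Complex.I) := by
    intro t θ
    rw [show (t : ℂ) + ((θ + 2 * Real.pi : ℝ) : ℂ) * Complex.I =
      (t + θ * Complex.I) + 2 * Real.pi * Complex.I by push_cast; ring, Complex.exp_periodic]
  set u : Fin 3 → ℝ → ℝ → ℝ := fun j t θ => G (Complex.exp (t + θ * Complex.I)) j with hu
  set A : Fin 3 → ℝ → ℝ → ℝ := fun j t θ => (H j (t + θ * Complex.I)).re with hA
  set B : Fin 3 → ℝ → ℝ → ℝ := fun j t θ => -(H j (t + θ * Complex.I)).im with hB
  have huA : ∀ j, ∀ t ∈ Ioo a b, ∀ θ, HasDerivAt (fun t => u j t θ) (A j t θ) t :=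
    fun j t ht θ => (hG.hasComplexGradientAt (hexp t ht θ)).hasDerivAt_radial j
  have huB : ∀ j, ∀ t ∈ Ioo a b, ∀ θ, HasDerivAt (fun θ => u j t θ) (B j t θ) θ :=
    fun j t ht θ => (hG.hasComplexGradientAt (hexp t ht θ)).hasDerivAt_angular j
  have hline : Continuous fun p : ℝ × ℝ => (p.1 : ℂ) + p.2 * Complex.I := by fun_prop
  have hHc : ∀ j, ContinuousOn (fun p : ℝ × ℝ => H j (p.1 + p.2 * Complex.I)) (Ioo a b ×ˢ univ) :=
    fun j => (hHd j).continuousOn.comp hline.continuousOn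
      fun p hp => ofReal_add_mul_I_mem_strip hp.1 p.2
  have hAc : ∀ j, ContinuousOn (fun p : ℝ × ℝ => A j p.1 p.2) (Ioo a b ×ˢ univ) := fun j =>
    Complex.continuous_re.comp_continuousOn (hHc j)
  have hBc : ∀ j, ContinuousOn (fun p : ℝ × ℝ => B j p.1 p.2) (Ioo a b ×ˢ univ) := fun j =>
    (Complex.continuous_im.comp_continuousOn (hHc j)).neg
  have huc : ∀ j, ContinuousOn (fun p : ℝ × ℝ => u j p.1 p.2) (Ioo a b ×ˢ univ) := fun j =>
    (by fun_prop : Continuous fun x : E3 => x j).comp_continuousOn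
      (hG.contDiffOn.continuousOn.comp (by fun_prop :
        ContinuousOn (fun p : ℝ × ℝ => Complex.exp (p.1 + p.2 * Complex.I)) _)
        fun p hp => hexp p.1 hp.1 p.2)
  have hper : ∀ j t, Function.Periodic (u j t) (2 * Real.pi) := fun j t θ => by
    simp only [hu, hperiod]
  have hHper : ∀ j w, H j (w + 2 * Real.pi * Complex.I) = H j w := fun j w => by
    simp only [hHdef, Complex.exp_periodic w]
  have hperB : ∀ j t, Function.Periodic (B j t) (2 * Real.pi) := fun j t θ => by
    simp only [hB, hHdef, hperiod]
  -- the energy density is at most twice the area element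
  set J : ℝ → ℝ → ℝ := fun t θ => Real.exp (2 * t) *
    ‖normalVector G (Complex.exp (t + θ * Complex.I))‖ with hJ
  have hJH : ∀ t ∈ Ioo a b, ∀ θ, ∀ j, A j t θ ^ 2 + B j t θ ^ 2 ≤ 2 * J t θ := by
    intro t ht θ j
    have h1 := hG.normSq_gradient_le (hexp t ht θ) j
    rw [Complex.normSq_apply] at h1
    refine le_trans (le_of_eq ?_) h1
    simp only [hA, hB, hHdef]
    ring
  have hE : IntegrableOn (fun t => ∫ θ in (0 : ℝ)..2 * Real.pi, (A 2 t θ ^ 2 + B 2 t θ ^ 2))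
      (Ioo a b) := by
    have hcE : ContinuousOn (fun p : ℝ × ℝ => A 2 p.1 p.2 ^ 2 + B 2 p.1 p.2 ^ 2)
        (Ioo a b ×ˢ univ) := ((hAc 2).pow 2).add ((hBc 2).pow 2)
    refine ((integrableOn_areaDensity h₀ h₁ hG.contDiffOn hfin).const_mul 2).mono'
      ((continuousOn_intervalIntegral (f := fun t θ => A 2 t θ ^ 2 + B 2 t θ ^ 2)
        hcE).aestronglyMeasurable measurableSet_Ioo) ?_
    refine (ae_restrict_iff' measurableSet_Ioo).2 (Filter.Eventually.of_forall fun t ht => ?_)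
    have hsec : Continuous fun θ : ℝ => ((t, θ) : ℝ × ℝ) := by fun_prop
    rw [Real.norm_of_nonneg (intervalIntegral.integral_nonneg (by positivity)
      fun _ _ => by positivity), areaDensity, ← intervalIntegral.integral_const_mul]
    exact intervalIntegral.integral_mono_on (by positivity)
      ((hcE.comp_continuous hsec fun θ => ⟨ht, mem_univ _⟩).intervalIntegrable _ _)
      ((((continuousOn_areaElement h₀ h₁ hG.contDiffOn).comp_continuous hsec
        fun θ => ⟨ht, mem_univ _⟩).const_mul 2).intervalIntegrable _ _)
      fun θ _ => hJH t ht θ 2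
  -- boundary values along almost every radius
  have hmid : (a + b) / 2 ∈ Ioo a b := ⟨by linarith, by linarith⟩
  have hnorm : ∀ t θ : ℝ, ‖Complex.exp (t + θ * Complex.I)‖ = Real.exp t := fun t θ => by
    rw [Complex.norm_exp]; simp
  have hevb : ∀ᶠ t in nhdsWithin b (Iio b), t ∈ Ioo a b := Ioo_mem_nhdsLT hab
  have heva : ∀ᶠ t in nhdsWithin a (Ioi a), t ∈ Ioo a b := Ioo_mem_nhdsGT hab
  have hradb : ∀ θ : ℝ, IntegrableOn (fun t => J t θ) (Ioo a b) →
      Filter.Tendsto (fun t => |u 2 t θ|) (nhdsWithin b (Iio b)) (nhds h) := by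
    intro θ hθ
    obtain ⟨M, hM⟩ := hG.bounded_radius hθ
    refine hG.tendsto_abs_height (γ := fun t => Complex.exp (t + θ * Complex.I)) (M := M)
      (hevb.mono fun t ht => hexp t ht θ) (hevb.mono fun t ht => hM t ht) (Or.inr fun r₁ hr₁ => ?_)
    simp only [hnorm]
    have hc : Filter.Tendsto Real.exp (nhdsWithin b (Iio b)) (nhds S₁) := by
      rw [← Real.exp_log h₁]; exact Real.continuous_exp.continuousWithinAt
    exact hc.eventually_const_lt hr₁
  have hrada : ∀ θ : ℝ, IntegrableOn (fun t => J t θ) (Ioo a b) →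
      Filter.Tendsto (fun t => |u 2 t θ|) (nhdsWithin a (Ioi a)) (nhds h) := by
    intro θ hθ
    obtain ⟨M, hM⟩ := hG.bounded_radius hθ
    refine hG.tendsto_abs_height (γ := fun t => Complex.exp (t + θ * Complex.I)) (M := M)
      (heva.mono fun t ht => hexp t ht θ) (heva.mono fun t ht => hM t ht) (Or.inl fun r₀ hr₀ => ?_)
    simp only [hnorm]
    have hc : Filter.Tendsto Real.exp (nhdsWithin a (Ioi a)) (nhds S₀) := by
      rw [← Real.exp_log h₀]; exact Real.continuous_exp.continuousWithinAt
    exact hc.eventually_lt_const hr₀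
  have hae := ae_lintegral_radius_lt_top h₀ h₁ hG.contDiffOn hfin
  have hbd : ∀ t ∈ Ioo a b, ∀ θ, |u 2 t θ| ≤ h := fun t ht θ =>
    (abs_lt.2 (hG.mapsTo (hexp t ht θ))).le
  have hlimb : ∀ n : ℤ, n ≠ 0 → Filter.Tendsto (fun t => ∫ θ in (0 : ℝ)..2 * Real.pi,
      (u 2 t θ : ℂ) * Complex.exp (-(n * (θ * Complex.I)))) (nhdsWithin b (Iio b)) (nhds 0) :=
    fun n hn => tendsto_fourierMode_of_finite_energy hab hh (hAc 2) (hBc 2) (huA 2) (huB 2)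
      (fun t _ => hper 2 t) (fun t _ => hperB 2 t) hbd hE
      (hae.mono fun θ hθ hmem => hradb θ (hθ hmem)) hn
  have hlima : ∀ n : ℤ, n ≠ 0 → Filter.Tendsto (fun t => ∫ θ in (0 : ℝ)..2 * Real.pi,
      (u 2 t θ : ℂ) * Complex.exp (-(n * (θ * Complex.I)))) (nhdsWithin a (Ioi a)) (nhds 0) :=
    fun n hn => tendsto_fourierMode_of_finite_energy_left hab hh (hAc 2) (hBc 2) (huA 2) (huB 2)
      (fun t _ => hper 2 t) (fun t _ => hperB 2 t) hbd hE
      (hae.mono fun θ hθ hmem => hrada θ (hθ hmem)) hn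
  obtain ⟨α, hα⟩ := constant_gradient_of_fourierMode_tendsto hab (hHd 2)
    (fun w _ => hHper 2 w) (fun t _ θ => by
      apply Complex.ext <;> simp [hA, hB]) (huA 2) (huB 2) (huc 2)
    (fun t _ => hper 2 t) hlimb hlima
  -- integrate the constant gradient
  set β := u 2 ((a + b) / 2) 0 - α * ((a + b) / 2) with hβ
  have hval : ∀ t ∈ Ioo a b, ∀ θ, u 2 t θ = α * t + β := by
    intro t ht θ
    have e1 : u 2 t θ = u 2 t 0 := by
      refine is_const_of_deriv_eq_zero (f := u 2 t) (fun θ => (huB 2 t ht θ).differentiableAt)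
        (fun θ => ?_) θ 0
      rw [(huB 2 t ht θ).deriv, (hα t ht θ).2]
    have hsub : uIcc ((a + b) / 2) t ⊆ Ioo a b := ordConnected_Ioo.uIcc_subset hmid ht
    have e2 : ∫ τ in ((a + b) / 2)..t, α = u 2 t 0 - u 2 ((a + b) / 2) 0 :=
      intervalIntegral.integral_eq_sub_of_hasDerivAt (f := fun τ => u 2 τ 0)
        (fun τ hτ => by
          have := huA 2 τ (hsub hτ) 0
          rwa [(hα τ (hsub hτ) 0).1] at this) intervalIntegrable_const
    rw [intervalIntegral.integral_const, smul_eq_mul] at e2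
    rw [e1, hβ]
    linarith
  have hrep : ∀ z ∈ annulusDomain S₀ S₁, Real.log ‖z‖ ∈ Ioo a b ∧
      z = Complex.exp ((Real.log ‖z‖ : ℝ) + (Complex.arg z : ℝ) * Complex.I) := by
    intro z hz
    refine ⟨⟨Real.log_lt_log h₀ hz.1, Real.log_lt_log (h₀.trans hz.1) hz.2⟩, ?_⟩
    exact (Complex.exp_log (annulusDomain_ne_zero h₀ hz)).symm
  obtain ⟨θ, hθmem, hθ⟩ : ∃ θ, θ ∈ uIoc 0 (2 * Real.pi) ∧
      IntegrableOn (fun t => J t θ) (Ioo a b) := by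
    rw [uIoc_of_le (by positivity), ← ae_restrict_iff' measurableSet_Ioc] at hae
    have hne : (volume.restrict (Ioc 0 (2 * Real.pi))) ≠ 0 := by
      rw [Ne, Measure.restrict_eq_zero, Real.volume_Ioc]
      simp [hpi]
    have := Filter.NeBot.mk (mt ae_eq_bot.1 hne)
    obtain ⟨θ, hθ, hm⟩ := (hae.and (ae_restrict_mem measurableSet_Ioc)).exists
    exact ⟨θ, by rwa [uIoc_of_le (by positivity)], hθ⟩
  refine ⟨α, β, fun z hz => ?_, fun z hz => ?_, ?_, ?_⟩
  · obtain ⟨h1, h2⟩ := hrep z hz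
    have h3 := hα _ h1 z.arg
    simp only [hA, hB, hHdef, ← h2, neg_eq_zero] at h3
    exact Complex.ext (by simpa using h3.1) (by simpa using h3.2)
  · obtain ⟨h1, h2⟩ := hrep z hz
    have h3 := hval _ h1 z.arg
    simpa only [hu, ← h2] using h3
  · refine tendsto_nhds_unique ?_ (hrada θ hθ)
    refine Filter.Tendsto.congr' (f₁ := fun t => |α * t + β|) ?_ ?_
    · filter_upwards [heva] with t ht
      rw [hval t ht θ]
    · exact (by fun_prop : Continuous fun t : ℝ => |α * t + β|).continuousWithinAt
  · refine tendsto_nhds_unique ?_ (hradb θ hθ)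
    refine Filter.Tendsto.congr' (f₁ := fun t => |α * t + β|) ?_ ?_
    · filter_upwards [hevb] with t ht
      rw [hval t ht θ]
    · exact (by fun_prop : Continuous fun t : ℝ => |α * t + β|).continuousWithinAt

/-! ### The logarithm of a holomorphic function of winding number one -/

/-- A continuous logarithm of `1` on a connected set is constant. Applied to differences, this compares
two continuous logarithms of the same function. -/
lemma eq_of_exp_eq_one_of_isPreconnected {X : Type*} [TopologicalSpace X] {S : Set X} (hS : IsPreconnected S)
    {f : X → ℂ} (hf : ContinuousOn f S) (h1 : ∀ x ∈ S, Complex.exp (f x) = 1) {x y : X}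
    (hx : x ∈ S) (hy : y ∈ S) : f x = f y := by
  have hpi := Real.pi_pos
  have key : ∀ x ∈ S, ∀ y ∈ S, (f x).im ≤ (f y).im := by
    intro x hx y hy
    by_contra! hlt
    obtain ⟨m, hm⟩ := Complex.exp_eq_one_iff.1 (h1 x hx)
    obtain ⟨n, hn⟩ := Complex.exp_eq_one_iff.1 (h1 y hy)
    have e1 : (f x).im = m * (2 * Real.pi) := by rw [hm]; simp
    have e2 : (f y).im = n * (2 * Real.pi) := by rw [hn]; simp
    rw [e1, e2] at hlt
    have hmn : n < m := by
      have := lt_of_mul_lt_mul_right hlt (by positivity)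
      exact_mod_cast this
    have hmn' : (n : ℝ) + 1 ≤ m := by exact_mod_cast hmn
    -- the imaginary part would take a value that is not a multiple of `2π`
    obtain ⟨z, hz, hzv⟩ := hS.intermediate_value hy hx
      (Complex.continuous_im.comp_continuousOn hf)
      (show (n + 1 / 2 : ℝ) * (2 * Real.pi) ∈ Icc (f y).im (f x).im by
        rw [e1, e2]; constructor <;> nlinarith)
    obtain ⟨l, hl⟩ := Complex.exp_eq_one_iff.1 (h1 z hz)
    have e3 : (f z).im = l * (2 * Real.pi) := by rw [hl]; simp
    change (f z).im = _ at hzv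
    rw [e3] at hzv
    have h4 := mul_right_cancel₀ (by positivity) hzv
    have h5 : (2 * l : ℝ) = 2 * n + 1 := by rw [h4]; ring
    have h6 : 2 * l = 2 * n + 1 := by exact_mod_cast h5
    omega
  obtain ⟨m, hm⟩ := Complex.exp_eq_one_iff.1 (h1 x hx)
  obtain ⟨n, hn⟩ := Complex.exp_eq_one_iff.1 (h1 y hy)
  refine Complex.ext ?_ (le_antisymm (key x hx y hy) (key y hy x hx))
  rw [hm, hn]; simp

/-- A continuous logarithm of a holomorphic function is holomorphic. -/
lemma differentiableOn_of_exp_comp {S : Set ℂ} (hS : IsOpen S) {Φ γ : ℂ → ℂ}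
    (hΦ : ContinuousOn Φ S) (hγ : DifferentiableOn ℂ γ S)
    (h : ∀ w ∈ S, Complex.exp (Φ w) = γ w) : DifferentiableOn ℂ Φ S := by
  intro w hw
  have hw' := hS.mem_nhds hw
  have hγw : γ w ≠ 0 := by rw [← h w hw]; exact Complex.exp_ne_zero _
  have hd : DifferentiableAt ℂ (fun v => Φ w + Complex.log (γ v / γ w)) w := by
    refine DifferentiableAt.const_add _ ?_
    refine ((hγ.differentiableAt hw').div_const _).clog ?_
    rw [div_self hγw]
    simp
  have hc : Filter.Tendsto (fun v => (Φ v - Φ w).im) (nhds w) (nhds 0) := by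
    have := (Complex.continuous_im.continuousAt.comp (x := w)
      ((hΦ.continuousAt hw').sub (continuousAt_const (y := Φ w)))).tendsto
    simpa [Function.comp_def] using this
  refine (hd.congr_of_eventuallyEq ?_).differentiableWithinAt
  filter_upwards [hw', hc.eventually_lt_const Real.pi_pos,
    hc.eventually_const_lt (show -Real.pi < 0 by linarith [Real.pi_pos])] with v hv h1 h2
  rw [← h v hv, ← h w hw, ← Complex.exp_sub, Complex.log_exp h2 h1.le]
  ring

/-- A periodic holomorphic function without zeros on a strip that winds once around `0` is
`exp (w + 2ψ)` with a periodic holomorphic function `ψ`. -/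
theorem exists_eq_exp_add_two_mul {a b : ℝ} {γ : ℂ → ℂ} (hγ : DifferentiableOn ℂ γ (strip a b))
    (hγ0 : ∀ w ∈ strip a b, γ w ≠ 0)
    (hper : ∀ w ∈ strip a b, γ (w + 2 * Real.pi * Complex.I) = γ w) {t₀ : ℝ} (ht₀ : t₀ ∈ Ioo a b)
    {φ : ℝ → ℂ} (hφ : Continuous φ) (hφγ : ∀ θ : ℝ, Complex.exp (φ θ) = γ (t₀ + θ * Complex.I))
    (hφ1 : ∀ θ, φ (θ + 2 * Real.pi) = φ θ + 2 * Real.pi * Complex.I) :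
    ∃ ψ : ℂ → ℂ, DifferentiableOn ℂ ψ (strip a b) ∧
      (∀ w ∈ strip a b, ψ (w + 2 * Real.pi * Complex.I) = ψ w) ∧
      ∀ w ∈ strip a b, γ w = Complex.exp (w + 2 * ψ w) := by
  have hmem : ∀ θ : ℝ, (t₀ : ℂ) + θ * Complex.I ∈ strip a b := ofReal_add_mul_I_mem_strip ht₀
  have hne : (strip a b).Nonempty := ⟨_, hmem 0⟩
  have hsc : IsSimplyConnected (strip a b) := by
    have := (convex_strip a b).contractibleSpace hne
    unfold IsSimplyConnected
    infer_instance
  obtain ⟨Φ, hΦc, hΦ⟩ := Complex.exists_continuousOn_eqOn_exp_comp hsc (isOpen_strip a b)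
    hγ.continuousOn (by rintro ⟨w, hw, h0⟩; exact hγ0 w hw h0)
  have hΦ' : ∀ w ∈ strip a b, Complex.exp (Φ w) = γ w := fun w hw => hΦ hw
  have hΦd := differentiableOn_of_exp_comp (isOpen_strip a b) hΦc hγ hΦ'
  have hshift : MapsTo (fun w : ℂ => w + 2 * Real.pi * Complex.I) (strip a b) (strip a b) := by
    intro w hw
    simpa [strip] using hw
  -- the increment of `Φ` over a period is constant, and it is that of `φ`
  have hD := @eq_of_exp_eq_one_of_isPreconnected _ _ _ (convex_strip a b).isPreconnected
    (fun w => Φ (w + 2 * Real.pi * Complex.I) - Φ w)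
    ((hΦc.comp (by fun_prop) hshift).sub hΦc) (fun w hw => by
      rw [Complex.exp_sub, hΦ' _ (hshift hw), hΦ' w hw, hper w hw, div_self (hγ0 w hw)])
  have hline : Continuous fun θ : ℝ => Φ (t₀ + θ * Complex.I) :=
    hΦc.comp_continuous (by fun_prop) hmem
  have hcmp := @eq_of_exp_eq_one_of_isPreconnected ℝ _ univ isPreconnected_univ
    (fun θ => Φ (t₀ + θ * Complex.I) - φ θ) (hline.sub hφ).continuousOn (fun θ _ => by
      rw [Complex.exp_sub, hΦ' _ (hmem θ), hφγ, div_self (hγ0 _ (hmem θ))])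
      (0 + 2 * Real.pi) 0 (mem_univ _) (mem_univ _)
  have h0 : Φ (t₀ + (0 : ℝ) * Complex.I + 2 * Real.pi * Complex.I) - Φ (t₀ + (0 : ℝ) * Complex.I) =
      2 * Real.pi * Complex.I := by
    simp only [hφ1 0] at hcmp
    rw [show (t₀ : ℂ) + (0 : ℝ) * Complex.I + 2 * Real.pi * Complex.I =
      t₀ + ((0 + 2 * Real.pi : ℝ) : ℂ) * Complex.I by push_cast; ring]
    linear_combination hcmp
  refine ⟨fun w => (Φ w - w) / 2, (hΦd.sub differentiableOn_id).div_const 2, fun w hw => ?_,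
    fun w hw => ?_⟩
  · have := hD hw (hmem 0)
    simp only [h0] at this
    linear_combination this / 2
  · rw [← hΦ' w hw]
    congr 1
    ring

/-! ### Mean values of `cosh` of a harmonic function -/

lemma cosh_le_cosh_odd_mul (m : ℤ) (hm : Odd m) (s : ℝ) : Real.cosh s ≤ Real.cosh (m * s) := by
  rw [Real.cosh_le_cosh, abs_mul]
  have h1 : (1 : ℝ) ≤ |(m : ℝ)| := by
    have : m ≠ 0 := by rintro rfl; simp at hm
    exact_mod_cast Int.one_le_abs this
  nlinarith [abs_nonneg s]

/-- Parseval's identity in each circle, and convexity of the exponential in each Fourier mode. -/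
lemma two_cosh_mul_integral_sq_le {a b c s : ℝ} {f : ℂ → ℂ}
    (hf : DifferentiableOn ℂ f (strip a b))
    (hper : ∀ w ∈ strip a b, f (w + 2 * Real.pi * Complex.I) = f w) (h₀ : c ∈ Ioo a b)
    (h₁ : c + s ∈ Ioo a b) (h₂ : c - s ∈ Ioo a b) {m : ℤ} (hm : Odd m) :
    2 * Real.cosh s * (Real.exp (m * c) * ∫ θ in (0 : ℝ)..2 * Real.pi, ‖f (c + θ * Complex.I)‖ ^ 2) ≤
      Real.exp (m * (c + s)) *
        (∫ θ in (0 : ℝ)..2 * Real.pi, ‖f ((c + s : ℝ) + θ * Complex.I)‖ ^ 2) +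
      Real.exp (m * (c - s)) *
        ∫ θ in (0 : ℝ)..2 * Real.pi, ‖f ((c - s : ℝ) + θ * Complex.I)‖ ^ 2 := by
  have hab : a < b := h₀.1.trans h₀.2
  have hpi := Real.pi_pos
  choose q hq using exists_fourierMode_eq hab hf hper
  have hsum : ∀ t ∈ Ioo a b, HasSum (fun n : ℤ => ‖q n‖ ^ 2 * Real.exp ((2 * n + m) * t))
      (Real.exp (m * t) * (2 * Real.pi *
        ∫ θ in (0 : ℝ)..2 * Real.pi, ‖f (t + θ * Complex.I)‖ ^ 2)) := by
    intro t ht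
    have hcont : Continuous fun θ : ℝ => f (t + θ * Complex.I) :=
      hf.continuousOn.comp_continuous (by fun_prop) (ofReal_add_mul_I_mem_strip ht)
    have h1 := (hasSum_sq_fourierMode hcont).mul_left (Real.exp (m * t))
    refine h1.congr_fun ?_
    intro n
    rw [hq n t ht, norm_mul, mul_pow, Complex.norm_real, Real.norm_eq_abs, Real.abs_exp,
      ← Real.exp_nat_mul, mul_left_comm, ← Real.exp_add]
    congr 2
    push_cast
    ring
  have h3 := hasSum_le (fun n => ?_) ((hsum c h₀).mul_left (2 * Real.cosh s))
    ((hsum _ h₁).add (hsum _ h₂))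
  · have h4 : 0 < 2 * Real.pi := by positivity
    refine le_of_mul_le_mul_left ?_ h4
    calc _ = _ := ?_
      _ ≤ _ := h3
      _ = _ := ?_
    · ring
    · push_cast; ring
  · have e : Real.exp ((2 * n + m) * (c + s)) + Real.exp ((2 * n + m) * (c - s)) =
        2 * Real.cosh (((2 * n + m : ℤ) : ℝ) * s) * Real.exp ((2 * n + m) * c) := by
      rw [Real.cosh_eq, mul_add, mul_sub, Real.exp_add, Real.exp_sub, Real.exp_neg]
      push_cast
      field_simp
    rw [← mul_add, e]
    have := cosh_le_cosh_odd_mul (2 * n + m) ((even_two_mul n).add_odd hm) s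
    have h5 := Real.exp_pos ((2 * n + m) * c)
    have h6 := mul_le_mul_of_nonneg_right this (mul_nonneg (sq_nonneg ‖q n‖) h5.le)
    nlinarith

lemma continuous_cosh_add_re {a b : ℝ} {ψ : ℂ → ℂ} (hψ : DifferentiableOn ℂ ψ (strip a b)) {t : ℝ}
    (ht : t ∈ Ioo a b) : Continuous fun θ : ℝ => Real.cosh (t + 2 * (ψ (t + θ * Complex.I)).re) := by
  have h1 : Continuous fun θ : ℝ => ψ (t + θ * Complex.I) :=
    hψ.continuousOn.comp_continuous (by fun_prop) (ofReal_add_mul_I_mem_strip ht)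
  exact Real.continuous_cosh.comp
    (continuous_const.add (continuous_const.mul (Complex.continuous_re.comp h1)))

/-- `cosh (t + 2 Re ψ)` is half the sum of `eᵗ |e^ψ|²` and `e⁻ᵗ |e^{-ψ}|²`, and only odd exponentials
occur in the Fourier expansions of these. -/
lemma two_cosh_mul_integral_cosh_le {a b c s : ℝ} {ψ : ℂ → ℂ}
    (hψ : DifferentiableOn ℂ ψ (strip a b))
    (hper : ∀ w ∈ strip a b, ψ (w + 2 * Real.pi * Complex.I) = ψ w) (h₀ : c ∈ Ioo a b)
    (h₁ : c + s ∈ Ioo a b) (h₂ : c - s ∈ Ioo a b) :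
    2 * Real.cosh s * (∫ θ in (0 : ℝ)..2 * Real.pi,
        Real.cosh (c + 2 * (ψ (c + θ * Complex.I)).re)) ≤
      (∫ θ in (0 : ℝ)..2 * Real.pi,
        Real.cosh ((c + s) + 2 * (ψ ((c + s : ℝ) + θ * Complex.I)).re)) +
      ∫ θ in (0 : ℝ)..2 * Real.pi,
        Real.cosh ((c - s) + 2 * (ψ ((c - s : ℝ) + θ * Complex.I)).re) := by
  have hsplit : ∀ t ∈ Ioo a b, ∫ θ in (0 : ℝ)..2 * Real.pi,
      Real.cosh (t + 2 * (ψ (t + θ * Complex.I)).re) =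
      (Real.exp t * (∫ θ in (0 : ℝ)..2 * Real.pi,
        ‖Complex.exp (ψ (t + θ * Complex.I))‖ ^ 2) +
      Real.exp (-t) * ∫ θ in (0 : ℝ)..2 * Real.pi,
        ‖Complex.exp (-ψ (t + θ * Complex.I))‖ ^ 2) / 2 := by
    intro t ht
    have h1 : Continuous fun θ : ℝ => ψ (t + θ * Complex.I) :=
      hψ.continuousOn.comp_continuous (by fun_prop) (ofReal_add_mul_I_mem_strip ht)
    have i1 : Continuous fun θ : ℝ => Real.exp t * ‖Complex.exp (ψ (t + θ * Complex.I))‖ ^ 2 :=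
      continuous_const.mul (h1.cexp.norm.pow 2)
    have i2 : Continuous fun θ : ℝ => Real.exp (-t) * ‖Complex.exp (-ψ (t + θ * Complex.I))‖ ^ 2 :=
      continuous_const.mul (h1.neg.cexp.norm.pow 2)
    rw [← intervalIntegral.integral_const_mul, ← intervalIntegral.integral_const_mul,
      ← intervalIntegral.integral_add
        (i1.intervalIntegrable _ _) (i2.intervalIntegrable _ _),
      ← intervalIntegral.integral_div]
    refine intervalIntegral.integral_congr fun θ _ => ?_
    simp only [Complex.norm_exp, ← Real.exp_nat_mul, ← Real.exp_add, Real.cosh_eq]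
    congr 3
    rw [Complex.neg_re]
    ring
  have e1 := two_cosh_mul_integral_sq_le (f := fun w => Complex.exp (ψ w)) hψ.cexp
    (fun w hw => by rw [hper w hw]) h₀ h₁ h₂ (m := 1) (by decide)
  have e2 := two_cosh_mul_integral_sq_le (f := fun w => Complex.exp (-ψ w)) hψ.neg.cexp
    (fun w hw => by rw [hper w hw]) h₀ h₁ h₂ (m := -1) (by decide)
  simp only [Int.cast_one, Int.cast_neg, one_mul, neg_one_mul] at e1 e2
  have s1 := hsplit _ h₁
  have s2 := hsplit _ h₂
  rw [hsplit c h₀, s1, s2]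
  linarith

/-- A version of `two_cosh_mul_integral_cosh_le` for squares, with a remainder that controls the case
of equality. -/
lemma four_pi_mul_cosh_sq_le {a b c s : ℝ} {ψ : ℂ → ℂ} (hψ : DifferentiableOn ℂ ψ (strip a b))
    (hper : ∀ w ∈ strip a b, ψ (w + 2 * Real.pi * Complex.I) = ψ w) (h₀ : c ∈ Ioo a b)
    (h₁ : c + s ∈ Ioo a b) (h₂ : c - s ∈ Ioo a b) :
    4 * Real.pi * Real.cosh s ^ 2 +
      ((∫ θ in (0 : ℝ)..2 * Real.pi,
        (Real.cosh ((c + s) + 2 * (ψ ((c + s : ℝ) + θ * Complex.I)).re) - Real.cosh s) ^ 2) +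
      ∫ θ in (0 : ℝ)..2 * Real.pi,
        (Real.cosh ((c - s) + 2 * (ψ ((c - s : ℝ) + θ * Complex.I)).re) - Real.cosh s) ^ 2) ≤
      (∫ θ in (0 : ℝ)..2 * Real.pi,
        Real.cosh ((c + s) + 2 * (ψ ((c + s : ℝ) + θ * Complex.I)).re) ^ 2) +
      ∫ θ in (0 : ℝ)..2 * Real.pi,
        Real.cosh ((c - s) + 2 * (ψ ((c - s : ℝ) + θ * Complex.I)).re) ^ 2 := by
  have hpi := Real.pi_pos
  have hexpand : ∀ t ∈ Ioo a b, ∫ θ in (0 : ℝ)..2 * Real.pi,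
      (Real.cosh (t + 2 * (ψ (t + θ * Complex.I)).re) - Real.cosh s) ^ 2 =
      (∫ θ in (0 : ℝ)..2 * Real.pi, Real.cosh (t + 2 * (ψ (t + θ * Complex.I)).re) ^ 2) -
      2 * Real.cosh s * (∫ θ in (0 : ℝ)..2 * Real.pi,
        Real.cosh (t + 2 * (ψ (t + θ * Complex.I)).re)) + 2 * Real.pi * Real.cosh s ^ 2 := by
    intro t ht
    have hc := continuous_cosh_add_re hψ ht
    simp only [sub_sq]
    rw [intervalIntegral.integral_add (Continuous.intervalIntegrable (by fun_prop) _ _)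
      (Continuous.intervalIntegrable (by fun_prop) _ _),
      intervalIntegral.integral_sub (Continuous.intervalIntegrable (by fun_prop) _ _)
      (Continuous.intervalIntegrable (by fun_prop) _ _), intervalIntegral.integral_const,
      ← intervalIntegral.integral_const_mul]
    simp only [sub_zero, smul_eq_mul]
    congr 2
    refine intervalIntegral.integral_congr fun θ _ => ?_
    ring
  have hI := two_cosh_mul_integral_cosh_le hψ hper h₀ h₁ h₂
  have hone : 2 * Real.pi ≤ ∫ θ in (0 : ℝ)..2 * Real.pi,
      Real.cosh (c + 2 * (ψ (c + θ * Complex.I)).re) := by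
    calc 2 * Real.pi = ∫ _ in (0 : ℝ)..2 * Real.pi, (1 : ℝ) := by simp
      _ ≤ _ := intervalIntegral.integral_mono_on (by positivity) intervalIntegrable_const
        ((continuous_cosh_add_re hψ h₀).intervalIntegrable _ _) fun θ _ => Real.one_le_cosh _
  have e1 := hexpand _ h₁
  have e2 := hexpand _ h₂
  simp only [Complex.ofReal_add, Complex.ofReal_sub] at e1 e2 hI ⊢
  rw [e1, e2]
  have := Real.one_le_cosh s
  nlinarith [mul_le_mul_of_nonneg_left hone (show 0 ≤ Real.cosh s by linarith)]

lemma eq_zero_of_intervalIntegral_sq_eq_zero {f : ℝ → ℝ} (hf : Continuous f)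
    (hper : Function.Periodic f (2 * Real.pi)) (h0 : ∫ θ in (0 : ℝ)..2 * Real.pi, f θ ^ 2 ≤ 0)
    (θ : ℝ) : f θ = 0 := by
  obtain ⟨θ', hθ', he⟩ := hper.exists_mem_Ico₀ Real.two_pi_pos θ
  rw [he]
  by_contra hne
  have hc : Continuous fun θ => f θ ^ 2 := hf.pow 2
  have := intervalIntegral.integral_pos Real.two_pi_pos hc.continuousOn
    (fun x _ => sq_nonneg (f x)) ⟨θ', Ico_subset_Icc_self hθ', sq_pos_of_ne_zero hne⟩
  linarith

/-- A holomorphic function with constant real part is constant. -/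
lemma eq_of_re_eq_const {S : Set ℂ} (hS : IsOpen S) (hS' : IsPreconnected S) {f : ℂ → ℂ}
    (hf : DifferentiableOn ℂ f S) {r : ℝ} (hr : ∀ w ∈ S, (f w).re = r) {x y : ℂ} (hx : x ∈ S)
    (hy : y ∈ S) : f x = f y := by
  refine hS.is_const_of_deriv_eq_zero hS' hf (fun w hw => ?_) hx hy
  have hd := ((hf.differentiableAt (hS.mem_nhds hw)).hasDerivAt).hasFDerivAt_re
  have hz : HasFDerivAt (fun w => (f w).re) (0 : ℂ →L[ℝ] ℝ) w :=
    (hasFDerivAt_const r w).congr_of_eventuallyEq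
      (by filter_upwards [hS.mem_nhds hw] with v hv using hr v hv)
  have h := hd.unique hz
  have h1 := congrArg (fun L => L 1) h
  have h2 := congrArg (fun L => L Complex.I) h
  simp only [reMulCLM_apply, zero_apply, mul_one, Complex.mul_I_re,
    neg_eq_zero] at h1 h2
  exact Complex.ext h1 h2

/-- Equality in `four_pi_mul_cosh_sq_le` for all `s` forces `ψ` to be constant. -/
lemma eq_const_of_integral_cosh_sq_le {c T : ℝ} (hT : 0 < T) {ψ : ℂ → ℂ}
    (hψ : DifferentiableOn ℂ ψ (strip (c - T) (c + T)))
    (hper : ∀ w ∈ strip (c - T) (c + T), ψ (w + 2 * Real.pi * Complex.I) = ψ w)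
    (heq : ∀ s ∈ Ioo (-T) T, (∫ θ in (0 : ℝ)..2 * Real.pi,
        Real.cosh ((c + s) + 2 * (ψ ((c + s : ℝ) + θ * Complex.I)).re) ^ 2) +
      (∫ θ in (0 : ℝ)..2 * Real.pi,
        Real.cosh ((c - s) + 2 * (ψ ((c - s : ℝ) + θ * Complex.I)).re) ^ 2) ≤
      4 * Real.pi * Real.cosh s ^ 2) :
    ∃ κ : ℂ, 2 * κ.re = -c ∧ ∀ w ∈ strip (c - T) (c + T), ψ w = κ := by
  have hpi := Real.pi_pos
  have hc0 : c ∈ Ioo (c - T) (c + T) := ⟨by linarith, by linarith⟩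
  have hline : ∀ t ∈ Ioo (c - T) (c + T), Continuous fun θ : ℝ => (ψ (t + θ * Complex.I)).re :=
    fun t ht => Complex.continuous_re.comp
      (hψ.continuousOn.comp_continuous (by fun_prop) (ofReal_add_mul_I_mem_strip ht))
  have hperiod : ∀ t ∈ Ioo (c - T) (c + T),
      Function.Periodic (fun θ : ℝ => (ψ (t + θ * Complex.I)).re) (2 * Real.pi) := by
    intro t ht θ
    simp only
    rw [← hper _ (ofReal_add_mul_I_mem_strip ht θ)]
    congr 2
    push_cast; ring
  -- the two possible values of the real part on each vertical line
  have hval : ∀ t ∈ Ioo (c - T) (c + T), ∀ θ : ℝ,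
      2 * (ψ (t + θ * Complex.I)).re = -c ∨ 2 * (ψ (t + θ * Complex.I)).re = c - 2 * t := by
    intro t ht θ
    have ht' : t - c ∈ Ioo (-T) T := ⟨by linarith [ht.1], by linarith [ht.2]⟩
    have h1 : c + (t - c) ∈ Ioo (c - T) (c + T) := ⟨by linarith [ht.1], by linarith [ht.2]⟩
    have h2 : c - (t - c) ∈ Ioo (c - T) (c + T) := ⟨by linarith [ht.2], by linarith [ht.1]⟩
    have h3 := (four_pi_mul_cosh_sq_le hψ hper hc0 h1 h2).trans (heq _ ht')
    have hnn : ∀ f : ℝ → ℝ, 0 ≤ ∫ θ in (0 : ℝ)..2 * Real.pi, f θ ^ 2 := fun f =>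
      intervalIntegral.integral_nonneg (by positivity) fun _ _ => sq_nonneg _
    have h4 := hnn fun θ =>
      Real.cosh ((c - (t - c)) + 2 * (ψ ((c - (t - c) : ℝ) + θ * Complex.I)).re) - Real.cosh (t - c)
    have h5 : ∫ θ in (0 : ℝ)..2 * Real.pi,
        (Real.cosh ((c + (t - c)) + 2 * (ψ ((c + (t - c) : ℝ) + θ * Complex.I)).re) -
          Real.cosh (t - c)) ^ 2 ≤ 0 := by linarith
    rw [add_sub_cancel] at h5
    have h6 := eq_zero_of_intervalIntegral_sq_eq_zero
      (f := fun θ : ℝ => Real.cosh (t + 2 * (ψ (t + θ * Complex.I)).re) - Real.cosh (t - c))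
      ((continuous_cosh_add_re hψ ht).sub continuous_const) (fun θ => by
        have := hperiod t ht θ
        simp only at this ⊢
        rw [this]) h5 θ
    have h7 := le_antisymm (Real.cosh_le_cosh.1 (sub_eq_zero.1 h6).le)
      (Real.cosh_le_cosh.1 (sub_eq_zero.1 h6).ge)
    rcases abs_eq_abs.1 h7 with h | h
    · left; linarith
    · right; linarith
  -- the mean value of `ψ` over a period does not depend on the line, hence is that on `Re w = c`
  have hmean : ∀ t ∈ Ioo (c - T) (c + T),
      ∫ θ in (0 : ℝ)..2 * Real.pi, (ψ (t + θ * Complex.I)).re = 2 * Real.pi * (-c / 2) := by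
    have hre : ∀ t ∈ Ioo (c - T) (c + T),
        ∫ θ in (0 : ℝ)..2 * Real.pi, (ψ (t + θ * Complex.I)).re =
        (∫ θ in (0 : ℝ)..2 * Real.pi, ψ (t + θ * Complex.I)).re := by
      intro t ht
      have hi : IntervalIntegrable (fun θ : ℝ => ψ (t + θ * Complex.I)) volume 0 (2 * Real.pi) :=
        (hψ.continuousOn.comp_continuous (by fun_prop)
          (ofReal_add_mul_I_mem_strip ht)).intervalIntegrable _ _
      exact Complex.reCLM.intervalIntegral_comp_comm hi
    intro t ht
    rw [hre t ht, integral_vertical_eq hψ hper hc0 ht, ← hre c hc0]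
    have : ∀ θ : ℝ, (ψ (c + θ * Complex.I)).re = -c / 2 := fun θ => by
      rcases hval c hc0 θ with h | h <;> linarith
    simp only [this, intervalIntegral.integral_const, smul_eq_mul, sub_zero]
  have hre : ∀ w ∈ strip (c - T) (c + T), (ψ w).re = -c / 2 := by
    intro w hw
    have ht : w.re ∈ Ioo (c - T) (c + T) := hw
    suffices h : ∀ θ : ℝ, (ψ (w.re + θ * Complex.I)).re = -c / 2 by
      simpa using h w.im
    intro θ
    by_contra hne
    obtain ⟨θ', hθ', he⟩ := (hperiod _ ht).exists_mem_Ico₀ Real.two_pi_pos θ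
    rw [he] at hne
    have hcont := hline _ ht
    have hI := hmean _ ht
    rcases le_total w.re c with hle | hle
    · have hnn : ∀ θ : ℝ, 0 ≤ (ψ (w.re + θ * Complex.I)).re + c / 2 := fun θ => by
        rcases hval _ ht θ with h | h <;> linarith
      have := intervalIntegral.integral_pos Real.two_pi_pos
        (hcont.add_const (c / 2)).continuousOn (fun x _ => hnn x)
        ⟨θ', Ico_subset_Icc_self hθ', lt_of_le_of_ne (hnn θ') fun h => hne (by linarith)⟩
      rw [intervalIntegral.integral_add (hcont.intervalIntegrable _ _) intervalIntegrable_const,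
        hI, intervalIntegral.integral_const] at this
      simp at this
      linarith
    · have hnn : ∀ θ : ℝ, 0 ≤ -(c / 2) - (ψ (w.re + θ * Complex.I)).re := fun θ => by
        rcases hval _ ht θ with h | h <;> linarith
      have hc' : Continuous fun θ : ℝ => -(c / 2) - (ψ (w.re + θ * Complex.I)).re :=
        continuous_const.sub hcont
      have := intervalIntegral.integral_pos Real.two_pi_pos hc'.continuousOn (fun x _ => hnn x)
        ⟨θ', Ico_subset_Icc_self hθ', lt_of_le_of_ne (hnn θ') fun h => hne (by linarith)⟩
      rw [intervalIntegral.integral_sub intervalIntegrable_const (hcont.intervalIntegrable _ _),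
        hI, intervalIntegral.integral_const] at this
      simp at this
      linarith
  have hcm : (c : ℂ) ∈ strip (c - T) (c + T) := by simpa [strip] using hT
  refine ⟨ψ c, by linarith [hre _ hcm], fun w hw => ?_⟩
  exact eq_of_re_eq_const (isOpen_strip _ _) (convex_strip _ _).isPreconnected hψ hre hw hcm

/-! ### The area of catenoid waists -/

/-- The area of the catenoid of neck radius `h / T` between the heights `-h` and `h`. -/
def waistArea (h T : ℝ) : ℝ := ∫ t in -T..T, 2 * Real.pi * (h / T) ^ 2 * Real.cosh t ^ 2

lemma hasDerivAt_mul_sinh_sub_cosh (t : ℝ) :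
    HasDerivAt (fun t => t * Real.sinh t - Real.cosh t) (t * Real.cosh t) t := by
  refine (((hasDerivAt_id' t).mul (Real.hasDerivAt_sinh t)).sub
    (Real.hasDerivAt_cosh t)).congr_deriv ?_
  ring

lemma strictMonoOn_mul_sinh_sub_cosh :
    StrictMonoOn (fun t => t * Real.sinh t - Real.cosh t) (Ici 0) := by
  refine strictMonoOn_of_deriv_pos (convex_Ici 0) (by fun_prop) fun t ht => ?_
  rw [interior_Ici] at ht
  rw [(hasDerivAt_mul_sinh_sub_cosh t).deriv]
  exact mul_pos ht (Real.cosh_pos t)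

/-- The equation `s tanh s = 1` has a positive solution. -/
lemma exists_mul_sinh_eq_cosh : ∃ s : ℝ, 0 < s ∧ s * Real.sinh s = Real.cosh s := by
  have hc : ContinuousOn (fun t => t * Real.sinh t - Real.cosh t) (Icc 0 2) := by fun_prop
  have h2 : 0 ≤ 2 * Real.sinh 2 - Real.cosh 2 := by
    have h1 : Real.exp (-2) ≤ 1 := Real.exp_le_one_iff.2 (by norm_num)
    have h3 : (3 : ℝ) ≤ Real.exp 2 := by linarith [Real.add_one_le_exp 2]
    rw [Real.sinh_eq, Real.cosh_eq]
    linarith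
  obtain ⟨s, hs, h0⟩ := intermediate_value_Icc (by norm_num : (0 : ℝ) ≤ 2) hc
    (show (0 : ℝ) ∈ Icc _ _ from ⟨by simp, h2⟩)
  simp only at h0
  refine ⟨s, lt_of_le_of_ne hs.1 ?_, by linarith⟩
  rintro rfl
  simp at h0

lemma waistArea_eq (h : ℝ) {T : ℝ} (hT : T ≠ 0) :
    waistArea h T = 2 * Real.pi * h ^ 2 * ((T + Real.sinh T * Real.cosh T) / T ^ 2) := by
  have hd : ∀ t ∈ uIcc (-T) T, HasDerivAt (fun t => (t + Real.sinh t * Real.cosh t) / 2)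
      (Real.cosh t ^ 2) t := by
    intro t _
    refine (((hasDerivAt_id' t).add ((Real.hasDerivAt_sinh t).mul
      (Real.hasDerivAt_cosh t))).div_const 2).congr_deriv ?_
    linarith [Real.cosh_sq t]
  rw [waistArea, intervalIntegral.integral_const_mul,
    intervalIntegral.integral_eq_sub_of_hasDerivAt hd
      (Continuous.intervalIntegrable (by fun_prop) _ _), Real.sinh_neg, Real.cosh_neg]
  field_simp
  ring

lemma hasDerivAt_add_sinh_mul_cosh_div {t : ℝ} (ht : 0 < t) :
    HasDerivAt (fun t => (t + Real.sinh t * Real.cosh t) / t ^ 2)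
      (2 * Real.sinh t * (t * Real.sinh t - Real.cosh t) / t ^ 3) t := by
  refine (((hasDerivAt_id' t).add ((Real.hasDerivAt_sinh t).mul
      (Real.hasDerivAt_cosh t))).div (hasDerivAt_pow 2 t) (by positivity)).congr_deriv ?_
  simp only [Pi.add_apply, Pi.mul_apply]
  field_simp
  push_cast
  have := Real.cosh_sq t
  ring_nf
  rw [this]
  ring

/-- Among the catenoid waists, the area is least, and only so, for the solution of `s tanh s = 1`. -/
lemma waistArea_lt {h s T : ℝ} (hh : 0 < h) (hs : 0 < s) (hs1 : s * Real.sinh s = Real.cosh s)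
    (hT : 0 < T) (hne : T ≠ s) : waistArea h s < waistArea h T := by
  rw [waistArea_eq h hs.ne', waistArea_eq h hT.ne']
  have hpi := Real.pi_pos
  refine mul_lt_mul_of_pos_left ?_ (by positivity)
  have hcont : ∀ S : Set ℝ, S ⊆ Ioi 0 →
      ContinuousOn (fun t => (t + Real.sinh t * Real.cosh t) / t ^ 2) S := fun S hS t ht =>
    (hasDerivAt_add_sinh_mul_cosh_div (hS ht)).continuousAt.continuousWithinAt
  rcases lt_or_gt_of_ne hne with hlt | hlt
  · have hanti : StrictAntiOn (fun t => (t + Real.sinh t * Real.cosh t) / t ^ 2) (Icc T s) := by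
      refine strictAntiOn_of_deriv_neg (convex_Icc _ _)
        (hcont _ fun t ht => hT.trans_le ht.1) fun t ht => ?_
      rw [interior_Icc] at ht
      have ht0 : 0 < t := hT.trans ht.1
      rw [(hasDerivAt_add_sinh_mul_cosh_div ht0).deriv]
      have := strictMonoOn_mul_sinh_sub_cosh (mem_Ici.2 ht0.le) (mem_Ici.2 hs.le) ht.2
      have := Real.sinh_pos_iff.2 ht0
      refine div_neg_of_neg_of_pos (mul_neg_of_pos_of_neg (by positivity) ?_) (by positivity)
      simp only at *
      linarith
    exact hanti (left_mem_Icc.2 hlt.le) (right_mem_Icc.2 hlt.le) hlt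
  · have hmono : StrictMonoOn (fun t => (t + Real.sinh t * Real.cosh t) / t ^ 2) (Icc s T) := by
      refine strictMonoOn_of_deriv_pos (convex_Icc _ _)
        (hcont _ fun t ht => hs.trans_le ht.1) fun t ht => ?_
      rw [interior_Icc] at ht
      have ht0 : 0 < t := hs.trans ht.1
      rw [(hasDerivAt_add_sinh_mul_cosh_div ht0).deriv]
      have := strictMonoOn_mul_sinh_sub_cosh (mem_Ici.2 hs.le) (mem_Ici.2 ht0.le) ht.1
      have := Real.sinh_pos_iff.2 ht0
      refine div_pos (mul_pos (by positivity) ?_) (by positivity)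
      simp only at *
      linarith
    exact hmono (left_mem_Icc.2 hlt.le) (right_mem_Icc.2 hlt.le) hlt

/-! ### Weierstrass data of an annulus of degree one -/

lemma circleMap_zero_exp (t θ : ℝ) :
    circleMap 0 (Real.exp t) θ = Complex.exp (t + θ * Complex.I) := by
  rw [circleMap_zero, Complex.exp_add, Complex.ofReal_exp]

/-- The Weierstrass data of a minimal annulus of finite area, of degree one: the height is
`α (log |z| - c)`, and the Gauss map is `z exp (2ψ)`. -/
theorem IsMinimalAnnulusOfDegree.exists_weierstrass {h S₀ S₁ : ℝ} {G : ℂ → E3} (hh : 0 < h)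
    (hG : IsMinimalAnnulusOfDegree h 1 S₀ S₁ G) (hfin : area S₀ S₁ G ≠ ⊤) :
    ∃ c T α : ℝ, ∃ ψ : ℂ → ℂ, 0 < T ∧ Real.log S₀ = c - T ∧ Real.log S₁ = c + T ∧ |α| * T = h ∧
      DifferentiableOn ℂ ψ (strip (c - T) (c + T)) ∧
      (∀ w ∈ strip (c - T) (c + T), ψ (w + 2 * Real.pi * Complex.I) = ψ w) ∧
      (∀ w ∈ strip (c - T) (c + T), gaussMap G (Complex.exp w) = Complex.exp (w + 2 * ψ w)) ∧
      (∀ z ∈ annulusDomain S₀ S₁, complexGradient G z 2 * z = α) ∧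
      (∀ z ∈ annulusDomain S₀ S₁, G z 2 = α * (Real.log ‖z‖ - c)) := by
  obtain ⟨hG, hne, hw⟩ := hG
  obtain ⟨α, β, hα, hβ, ha, hb⟩ := hG.height_eq hh hfin
  have h₀ := hG.inner_pos
  have h₁ : 0 < S₁ := h₀.trans hG.inner_lt_outer
  have hab : Real.log S₀ < Real.log S₁ := Real.log_lt_log h₀ hG.inner_lt_outer
  set a := Real.log S₀ with ha'
  set b := Real.log S₁ with hb'
  have hexp : MapsTo Complex.exp (strip a b) (annulusDomain S₀ S₁) := fun w hw =>
    (exp_mem_annulusDomain_iff h₀ h₁ w).2 hw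
  obtain ⟨t₀, ht₀⟩ := exists_between hab
  have hmem : ∀ θ : ℝ, (t₀ : ℂ) + θ * Complex.I ∈ strip a b := ofReal_add_mul_I_mem_strip ht₀
  have hα0 : α ≠ 0 := by
    rintro rfl
    have hz := hexp (hmem 0)
    have h2 := ((hG.hasComplexGradientAt hz).norm_normalVector_eq_gaussMap (hG.conformal _ hz)
      (hne _ hz).1 (hne _ hz).2).1
    have h3 := hα _ hz
    rw [Complex.ofReal_zero, mul_eq_zero] at h3
    exact h3.elim h2 (Complex.exp_ne_zero _)
  have hsum : α * a + β = -(α * b + β) := by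
    refine (abs_eq_abs.1 (ha.trans hb.symm)).resolve_left fun heq => hab.ne ?_
    exact mul_left_cancel₀ hα0 (by linarith)
  -- the Gauss map is holomorphic
  have hgd : DifferentiableOn ℂ (gaussMap G) (annulusDomain S₀ S₁) := by
    have hd : DifferentiableOn ℂ (fun z => complexGradient G z 2 /
        (complexGradient G z 0 - Complex.I * complexGradient G z 1)) (annulusDomain S₀ S₁) := by
      refine (hG.differentiableOn_complexGradient 2).div
        ((hG.differentiableOn_complexGradient 0).sub
          ((hG.differentiableOn_complexGradient 1).const_mul _)) fun z hz => ?_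
      exact ((hG.hasComplexGradientAt hz).gaussMap_mul
        ((hG.conformal z hz).isotropic (hG.hasComplexGradientAt hz)) (hG.conformal z hz)
        (hne z hz).1).1
    refine hd.congr fun z hz => ?_
    obtain ⟨h1, h2⟩ := (hG.hasComplexGradientAt hz).gaussMap_mul
        ((hG.conformal z hz).isotropic (hG.hasComplexGradientAt hz)) (hG.conformal z hz)
        (hne z hz).1
    rw [eq_div_iff h1, h2]
  obtain ⟨φ, hφ, hφ1, hφ2⟩ := hw (Real.exp t₀) ⟨(Real.log_lt_iff_lt_exp h₀).1 ht₀.1,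
    (Real.lt_log_iff_exp_lt h₁).1 ht₀.2⟩
  obtain ⟨ψ, hψ, hψper, hψg⟩ := exists_eq_exp_add_two_mul (γ := fun w => gaussMap G (Complex.exp w))
    (hgd.comp Complex.differentiable_exp.differentiableOn hexp)
    (fun w hw => (hne _ (hexp hw)).2) (fun w _ => by simp only [Complex.exp_periodic w]) ht₀ hφ
    (fun θ => by rw [hφ1, circleMap_zero_exp]) (fun θ => by rw [hφ2]; push_cast; ring)
  have e1 : (a + b) / 2 - (b - a) / 2 = a := by ring
  have e2 : (a + b) / 2 + (b - a) / 2 = b := by ring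
  refine ⟨(a + b) / 2, (b - a) / 2, α, ψ, by linarith, e1.symm, e2.symm, ?_, ?_, ?_, ?_, hα, ?_⟩
  · rw [← hb, show α * b + β = α * ((b - a) / 2) by linarith, abs_mul,
      abs_of_pos (show 0 < (b - a) / 2 by linarith)]
  · rwa [e1, e2]
  · rwa [e1, e2]
  · rwa [e1, e2]
  · intro z hz
    rw [hβ z hz]
    linarith

/-! ### The area inequality -/

/-- The area element of a minimal annulus in terms of its Weierstrass data. -/
lemma IsMinimalAnnulusOfDegree.areaDensity_eq {h S₀ S₁ α t : ℝ} {G : ℂ → E3} {ψ : ℂ → ℂ}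
    (hG : IsMinimalAnnulusOfDegree h 1 S₀ S₁ G)
    (hψ : ∀ w ∈ strip (Real.log S₀) (Real.log S₁),
      gaussMap G (Complex.exp w) = Complex.exp (w + 2 * ψ w))
    (hα : ∀ z ∈ annulusDomain S₀ S₁, complexGradient G z 2 * z = α)
    (ht : t ∈ Ioo (Real.log S₀) (Real.log S₁)) :
    areaDensity G t =
      α ^ 2 * ∫ θ in (0 : ℝ)..2 * Real.pi, Real.cosh (t + 2 * (ψ (t + θ * Complex.I)).re) ^ 2 := by
  obtain ⟨hG, hne, -⟩ := hG
  have h₀ := hG.inner_pos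
  have h₁ : 0 < S₁ := h₀.trans hG.inner_lt_outer
  rw [areaDensity, ← intervalIntegral.integral_const_mul]
  refine intervalIntegral.integral_congr fun θ _ => ?_
  have hw := ofReal_add_mul_I_mem_strip ht θ
  have hz : Complex.exp (t + θ * Complex.I) ∈ annulusDomain S₀ S₁ :=
    (exp_mem_annulusDomain_iff h₀ h₁ _).2 hw
  rw [((hG.hasComplexGradientAt hz).norm_normalVector_eq_gaussMap (hG.conformal _ hz)
      (hne _ hz).1 (hne _ hz).2).2, hψ _ hw]
  have e1 : Real.exp (2 * t) * ‖complexGradient G (Complex.exp (t + θ * Complex.I)) 2‖ ^ 2 =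
      α ^ 2 := by
    have := congrArg (fun x => ‖x‖ ^ 2) (hα _ hz)
    simp only [norm_mul, mul_pow, Complex.norm_real, Real.norm_eq_abs, sq_abs] at this
    rw [← this, Complex.norm_exp, ← Real.exp_nat_mul, mul_comm]
    congr 2
    simp
  have e2 : ‖Complex.exp ((t + θ * Complex.I) + 2 * ψ (t + θ * Complex.I))‖ =
      Real.exp (t + 2 * (ψ (t + θ * Complex.I)).re) := by
    rw [Complex.norm_exp]; simp
  rw [e2, ← Real.exp_neg, ← Real.cosh_eq, ← mul_assoc, e1]

/-- Twice an integral over an interval, folded about the midpoint. -/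
lemma two_mul_integral_symm {f : ℝ → ℝ} {c T : ℝ} (hT : 0 ≤ T)
    (hf : IntegrableOn f (Ioo (c - T) (c + T))) :
    IntervalIntegrable (fun s => f (c + s) + f (c - s)) volume (-T) T ∧
    ∫ s in -T..T, (f (c + s) + f (c - s)) = 2 * ∫ t in Ioo (c - T) (c + T), f t := by
  have hi : IntervalIntegrable f volume (c - T) (c + T) := by
    rwa [intervalIntegrable_iff_integrableOn_Ioo_of_le (by linarith)]
  have i1 : IntervalIntegrable (fun s => f (c + s)) volume (-T) T := by
    have := hi.comp_add_left c
    simpa [sub_sub_cancel_left] using this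
  have i2 : IntervalIntegrable (fun s => f (c - s)) volume (-T) T := by
    have := hi.comp_sub_left c
    simpa using this.symm
  refine ⟨i1.add i2, ?_⟩
  rw [intervalIntegral.integral_add i1 i2, intervalIntegral.integral_comp_add_left,
    intervalIntegral.integral_comp_sub_left, ← integral_Ioc_eq_integral_Ioo,
    ← intervalIntegral.integral_of_le (by linarith)]
  rw [sub_neg_eq_add, ← sub_eq_add_neg]
  ring

/-- The area of a minimal annulus of degree one in the slab is at least that of a catenoid waist with
the same conformal type, and in the case of equality the logarithm of the Gauss map is affine. -/
theorem IsMinimalAnnulusOfDegree.waistArea_le {h S₀ S₁ : ℝ} {G : ℂ → E3} (hh : 0 < h)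
    (hG : IsMinimalAnnulusOfDegree h 1 S₀ S₁ G) (hfin : area S₀ S₁ G ≠ ⊤) :
    ∃ c T α : ℝ, 0 < T ∧ Real.log S₀ = c - T ∧ Real.log S₁ = c + T ∧ |α| * T = h ∧
      (∀ z ∈ annulusDomain S₀ S₁, complexGradient G z 2 * z = α) ∧
      (∀ z ∈ annulusDomain S₀ S₁, G z 2 = α * (Real.log ‖z‖ - c)) ∧
      ENNReal.ofReal (waistArea h T) ≤ area S₀ S₁ G ∧
      (area S₀ S₁ G ≤ ENNReal.ofReal (waistArea h T) →
        ∃ κ : ℂ, Real.log ‖κ‖ = -c ∧ κ ≠ 0 ∧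
          ∀ z ∈ annulusDomain S₀ S₁, gaussMap G z = κ * z) := by
  obtain ⟨c, T, α, ψ, hT, hS₀, hS₁, hαT, hψ, hper, hψg, hα, hx3⟩ := hG.exists_weierstrass hh hfin
  refine ⟨c, T, α, hT, hS₀, hS₁, hαT, hα, hx3, ?_⟩
  have hpi := Real.pi_pos
  have h₀ := hG.1.inner_pos
  have h₁ : 0 < S₁ := h₀.trans hG.1.inner_lt_outer
  have hint := integrableOn_areaDensity h₀ h₁ hG.1.contDiffOn hfin
  have hcont := continuousOn_areaDensity h₀ h₁ hG.1.contDiffOn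
  have hdens : ∀ t ∈ Ioo (c - T) (c + T), areaDensity G t = α ^ 2 *
      ∫ θ in (0 : ℝ)..2 * Real.pi, Real.cosh (t + 2 * (ψ (t + θ * Complex.I)).re) ^ 2 :=
    fun t ht => hG.areaDensity_eq (by rwa [hS₀, hS₁]) hα (by rwa [hS₀, hS₁])
  have harea : area S₀ S₁ G = ENNReal.ofReal (∫ t in Ioo (c - T) (c + T), areaDensity G t) := by
    rw [area_eq_lintegral_areaDensity h₀ h₁ hG.1.contDiffOn, ofReal_integral_eq_lintegral_ofReal
      (by rwa [hS₀, hS₁] at hint) (Filter.Eventually.of_forall (areaDensity_nonneg G)), hS₀, hS₁]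
  rw [hS₀, hS₁] at hint hcont
  have hc0 : c ∈ Ioo (c - T) (c + T) := ⟨by linarith, by linarith⟩
  have hp : ∀ s ∈ Ioo (-T) T, c + s ∈ Ioo (c - T) (c + T) := fun s hs =>
    ⟨by linarith [hs.1], by linarith [hs.2]⟩
  have hm : ∀ s ∈ Ioo (-T) T, c - s ∈ Ioo (c - T) (c + T) := fun s hs =>
    ⟨by linarith [hs.2], by linarith [hs.1]⟩
  have hnn : ∀ f : ℝ → ℝ, 0 ≤ ∫ θ in (0 : ℝ)..2 * Real.pi, f θ ^ 2 := fun f =>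
    intervalIntegral.integral_nonneg (by positivity) fun _ _ => sq_nonneg _
  have hle : ∀ s ∈ Ioo (-T) T, 4 * Real.pi * α ^ 2 * Real.cosh s ^ 2 ≤
      areaDensity G (c + s) + areaDensity G (c - s) := by
    intro s hs
    rw [hdens _ (hp s hs), hdens _ (hm s hs), ← mul_add]
    have h1 := four_pi_mul_cosh_sq_le hψ hper hc0 (hp s hs) (hm s hs)
    have h2 := mul_le_mul_of_nonneg_left ((le_add_of_nonneg_right
      (add_nonneg (hnn _) (hnn _))).trans h1) (sq_nonneg α)
    linarith
  obtain ⟨hi, hI⟩ := two_mul_integral_symm hT.le hint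
  have hαh : α ^ 2 = (h / T) ^ 2 := by
    rw [← hαT, mul_div_assoc, div_self hT.ne', mul_one, sq_abs]
  have hW : ∫ s in -T..T, 4 * Real.pi * α ^ 2 * Real.cosh s ^ 2 = 2 * waistArea h T := by
    rw [waistArea, ← intervalIntegral.integral_const_mul]
    refine intervalIntegral.integral_congr fun t _ => ?_
    simp only [hαh]
    ring
  have hcosh : IntervalIntegrable (fun s => 4 * Real.pi * α ^ 2 * Real.cosh s ^ 2) volume (-T) T :=
    Continuous.intervalIntegrable (by fun_prop) _ _
  have hmono : waistArea h T ≤ ∫ t in Ioo (c - T) (c + T), areaDensity G t := by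
    have := intervalIntegral.integral_mono_on_of_le_Ioo (by linarith) hcosh hi hle
    linarith
  rw [harea]
  refine ⟨ENNReal.ofReal_le_ofReal hmono, fun hge => ?_⟩
  have hge' : ∫ t in Ioo (c - T) (c + T), areaDensity G t ≤ waistArea h T := by
    refine (ENNReal.ofReal_le_ofReal_iff ?_).1 hge
    exact intervalIntegral.integral_nonneg (by linarith) fun _ _ => by positivity
  -- equality of the integrals forces equality of the continuous integrands
  have heq : ∀ s ∈ Ioo (-T) T, areaDensity G (c + s) + areaDensity G (c - s) ≤
      4 * Real.pi * α ^ 2 * Real.cosh s ^ 2 := by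
    have hd : ContinuousOn (fun s => areaDensity G (c + s) + areaDensity G (c - s) -
        4 * Real.pi * α ^ 2 * Real.cosh s ^ 2) (Ioo (-T) T) :=
      ((hcont.comp (by fun_prop) hp).add (hcont.comp (by fun_prop) hm)).sub (by fun_prop)
    have hz : ∫ s in Ioo (-T) T, (areaDensity G (c + s) + areaDensity G (c - s) -
        4 * Real.pi * α ^ 2 * Real.cosh s ^ 2) = 0 := by
      rw [← integral_Ioc_eq_integral_Ioo, ← intervalIntegral.integral_of_le (by linarith),
        intervalIntegral.integral_sub hi hcosh, hI, hW]
      linarith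
    have hae := (setIntegral_eq_zero_iff_of_nonneg_ae
      ((ae_restrict_iff' measurableSet_Ioo).2 (Filter.Eventually.of_forall fun s hs =>
        sub_nonneg.2 (hle s hs)))
      ((intervalIntegrable_iff_integrableOn_Ioo_of_le (by linarith)).1 (hi.sub hcosh))).1 hz
    have := Measure.eqOn_open_of_ae_eq hae isOpen_Ioo hd continuousOn_const
    intro s hs
    exact (sub_eq_zero.1 (this hs)).le
  have hα2 : 0 < α ^ 2 := by rw [hαh]; positivity
  obtain ⟨κ, hκ, hψκ⟩ := eq_const_of_integral_cosh_sq_le hT hψ hper fun s hs => by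
    have h1 := heq s hs
    rw [hdens _ (hp s hs), hdens _ (hm s hs), ← mul_add] at h1
    exact le_of_mul_le_mul_left (by linarith) hα2
  refine ⟨Complex.exp (2 * κ), ?_, Complex.exp_ne_zero _, fun z hz => ?_⟩
  · rw [Complex.norm_exp, Real.log_exp]
    simpa using hκ
  · have hz0 := annulusDomain_ne_zero h₀ hz
    have hw : Complex.log z ∈ strip (c - T) (c + T) := by
      rw [← hS₀, ← hS₁]
      exact (exp_mem_annulusDomain_iff h₀ h₁ _).1 (by rwa [Complex.exp_log hz0])
    have := hψg _ hw
    rw [hψκ _ hw, Complex.exp_add, Complex.exp_log hz0] at this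
    rw [this, mul_comm]

/-! ### Annuli with linear Gauss map are catenoid waists -/

lemma isPreconnected_annulusDomain {R₀ R₁ : ℝ} (h₀ : 0 < R₀) (h₁ : 0 < R₁) :
    IsPreconnected (annulusDomain R₀ R₁) := by
  have : annulusDomain R₀ R₁ = Complex.exp '' strip (Real.log R₀) (Real.log R₁) := by
    ext z
    refine ⟨fun hz => ?_, ?_⟩
    · have hz0 := annulusDomain_ne_zero h₀ hz
      exact ⟨Complex.log z, (exp_mem_annulusDomain_iff h₀ h₁ _).1 (by rwa [Complex.exp_log hz0]),
        Complex.exp_log hz0⟩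
    · rintro ⟨w, hw, rfl⟩
      exact (exp_mem_annulusDomain_iff h₀ h₁ w).2 hw
  rw [this]
  exact (convex_strip _ _).isPreconnected.image _ Complex.continuous_exp.continuousOn

lemma HasComplexGradientAt.comp_hasDerivAt {F : ℂ → E3} {φ : Fin 3 → ℂ} {m : ℂ → ℂ} {m' z : ℂ}
    (h : HasComplexGradientAt F φ (m z)) (hm : HasDerivAt m m' z) :
    HasComplexGradientAt (fun z => F (m z)) (fun j => φ j * m') z := by
  intro j
  refine ((h j).comp z (hm.hasFDerivAt.restrictScalars ℝ)).congr_fderiv ?_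
  ext v
  simp only [ContinuousLinearMap.comp_apply, reMulCLM_apply, ContinuousLinearMap.coe_restrictScalars',
    ContinuousLinearMap.toSpanSingleton_apply, smul_eq_mul]
  congr 1
  ring

/-- A minimal annulus whose Gauss map is linear and whose height is logarithmic is, up to a horizontal
translation, a catenoid: the Weierstrass representation determines the complex gradient. -/
theorem IsMinimalAnnulus.eq_catenoid_add {h S₀ S₁ α c : ℝ} {κ : ℂ} {G : ℂ → E3}
    (hG : IsMinimalAnnulus h S₀ S₁ G) (hN : ∀ z ∈ annulusDomain S₀ S₁, unitNormal G z 2 ≠ 1)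
    (hα0 : α ≠ 0) (hα : ∀ z ∈ annulusDomain S₀ S₁, complexGradient G z 2 * z = α)
    (hx : ∀ z ∈ annulusDomain S₀ S₁, G z 2 = α * (Real.log ‖z‖ - c))
    (hκ : Real.log ‖κ‖ = -c) (hκ0 : κ ≠ 0)
    (hg : ∀ z ∈ annulusDomain S₀ S₁, gaussMap G z = κ * z) :
    ∃ v : E3, v 2 = 0 ∧ ∀ z ∈ annulusDomain S₀ S₁, G z = catenoid α (-κ * z) + v := by
  have h₀ := hG.inner_pos
  have h₁ : 0 < S₁ := h₀.trans hG.inner_lt_outer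
  have hgrad : ∀ z ∈ annulusDomain S₀ S₁, ∀ j,
      complexGradient G z j = catenoidGradient α (-κ * z) j * -κ := by
    intro z hz
    have hz0 := annulusDomain_ne_zero h₀ hz
    have hgr := hG.hasComplexGradientAt hz
    have hiso := (hG.conformal z hz).isotropic hgr
    obtain ⟨hη, hgη⟩ := hgr.gaussMap_mul hiso (hG.conformal z hz) (hN z hz)
    have hαC : (α : ℂ) ≠ 0 := Complex.ofReal_ne_zero.2 hα0
    have e2 : complexGradient G z 2 = α / z := by rw [eq_div_iff hz0, hα z hz]
    have e3 : complexGradient G z 0 - Complex.I * complexGradient G z 1 = α / (κ * z ^ 2) := by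
      rw [hg z hz, e2] at hgη
      field_simp at hgη ⊢
      linear_combination hgη
    have e4 : complexGradient G z 0 + Complex.I * complexGradient G z 1 = -α * κ := by
      refine mul_left_cancel₀ hη ?_
      have hI := Complex.I_sq
      have : (complexGradient G z 0 - Complex.I * complexGradient G z 1) *
          (complexGradient G z 0 + Complex.I * complexGradient G z 1) =
          -complexGradient G z 2 ^ 2 := by
        linear_combination hiso - complexGradient G z 1 ^ 2 * hI
      rw [this, e2, e3]
      field_simp
    intro j
    fin_cases j
    · simp only [catenoidGradient, Fin.zero_eta, Matrix.cons_val_zero]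
      have : complexGradient G z 0 = (α / (κ * z ^ 2) + -α * κ) / 2 := by rw [← e3, ← e4]; ring
      rw [this]
      field_simp
      ring
    · simp only [catenoidGradient, Fin.mk_one, Matrix.cons_val_one, Matrix.cons_val_zero]
      have : complexGradient G z 1 = Complex.I * (α / (κ * z ^ 2) - -α * κ) / 2 := by
        rw [← e3, ← e4]
        linear_combination complexGradient G z 1 * Complex.I_sq
      rw [this]
      field_simp
      ring
    · simp only [catenoidGradient, Fin.reduceFinMk, Matrix.cons_val]
      rw [e2]
      field_simp
  have hd : ∀ z ∈ annulusDomain S₀ S₁, ∀ j,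
      HasFDerivAt (fun z => G z j - catenoid α (-κ * z) j) (0 : ℂ →L[ℝ] ℝ) z := by
    intro z hz j
    have hz0 := annulusDomain_ne_zero h₀ hz
    have hm : HasDerivAt (fun z => -κ * z) (-κ) z := by
      simpa using (hasDerivAt_id z).const_mul (-κ)
    have h1 := (hG.hasComplexGradientAt hz j).sub ((HasComplexGradientAt.comp_hasDerivAt
      (hasComplexGradientAt_catenoid α (mul_ne_zero (neg_ne_zero.2 hκ0) hz0)) hm) j)
    refine h1.congr_fderiv ?_
    rw [hgrad z hz j, sub_self]
  have hconst : ∀ j, ∃ r : ℝ, ∀ z ∈ annulusDomain S₀ S₁, G z j - catenoid α (-κ * z) j = r := by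
    intro j
    exact (isOpen_annulusDomain S₀ S₁).exists_is_const_of_fderiv_eq_zero (𝕜 := ℝ)
      (isPreconnected_annulusDomain h₀ h₁)
      (fun z hz => (hd z hz j).differentiableAt.differentiableWithinAt)
      fun z hz => (hd z hz j).fderiv
  choose r hr using hconst
  have h2 : ∀ z ∈ annulusDomain S₀ S₁, G z 2 = catenoid α (-κ * z) 2 := by
    intro z hz
    have hz0 := annulusDomain_ne_zero h₀ hz
    rw [hx z hz, catenoid_apply_two, norm_mul, norm_neg,
      Real.log_mul (norm_ne_zero_iff.2 hκ0) (norm_ne_zero_iff.2 hz0), hκ]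
    ring
  refine ⟨!₂[r 0, r 1, 0], by simp, fun z hz => ?_⟩
  ext j
  fin_cases j
  · have := hr 0 z hz
    simp only [Fin.zero_eta, PiLp.add_apply, Matrix.cons_val_zero]
    linarith
  · have := hr 1 z hz
    simp only [Fin.mk_one, PiLp.add_apply, Matrix.cons_val_one,
      Matrix.cons_val_zero]
    linarith
  · simpa using h2 z hz

lemma injOn_catenoid {c : ℝ} (hc : c ≠ 0) : InjOn (catenoid c) {0}ᶜ := by
  intro z hz w hw heq
  have hz' : 0 < ‖z‖ := norm_pos_iff.2 hz
  have hw' : 0 < ‖w‖ := norm_pos_iff.2 hw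
  have e2 := congrArg (fun p : E3 => p 2) heq
  simp only [catenoid_apply_two] at e2
  have hn : ‖z‖ = ‖w‖ := Real.log_injOn_pos hz' hw' (mul_left_cancel₀ hc e2)
  have e0 := congrArg (fun p : E3 => p 0) heq
  have e1 := congrArg (fun p : E3 => p 1) heq
  have hch := (Real.cosh_pos (Real.log ‖w‖)).ne'
  simp only [catenoid, hn, PiLp.toLp_apply, Matrix.cons_val_zero, Matrix.cons_val_one] at e0 e1
  have hcc := mul_ne_zero hc hch
  have f0 := mul_left_cancel₀ hcc e0
  have f1 := mul_left_cancel₀ hcc e1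
  exact Complex.ext ((div_left_inj' hw'.ne').1 f0) ((div_left_inj' hw'.ne').1 f1)

/-- A change of sign of the neck radius amounts to the antipodal map `z ↦ -1 / z̄` of the parameter. -/
lemma catenoid_neg (c : ℝ) {z : ℂ} (hz : z ≠ 0) :
    catenoid (-c) z = catenoid c (-(starRingEnd ℂ z)⁻¹) := by
  have hn : ‖z‖ ≠ 0 := norm_ne_zero_iff.2 hz
  have hsq : Complex.normSq z = ‖z‖ ^ 2 := Complex.normSq_eq_norm_sq z
  ext j
  fin_cases j <;> simp [catenoid, hsq, Complex.inv_re, Complex.inv_im, Real.cosh_neg] <;> field_simp <;> simp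

lemma catenoid_image_neg (c T : ℝ) :
    catenoid (-c) '' annulusDomain (Real.exp (-T)) (Real.exp T) ⊆
      catenoid c '' annulusDomain (Real.exp (-T)) (Real.exp T) := by
  rintro _ ⟨z, hz, rfl⟩
  have hz0 := annulusDomain_exp_ne_zero hz
  refine ⟨-(starRingEnd ℂ z)⁻¹, ?_, (catenoid_neg c hz0).symm⟩
  rw [mem_annulusDomain_exp_iff hz0] at hz
  rw [mem_annulusDomain_exp_iff (by simpa using hz0)]
  simp only [norm_neg, norm_inv, RCLike.norm_conj, Real.log_inv]
  exact ⟨by linarith [hz.2], by linarith [hz.1]⟩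

lemma catenoid_image_abs (c T : ℝ) :
    catenoid |c| '' annulusDomain (Real.exp (-T)) (Real.exp T) =
      catenoid c '' annulusDomain (Real.exp (-T)) (Real.exp T) := by
  rcases abs_choice c with h | h
  · rw [h]
  · rw [h]
    refine (catenoid_image_neg c T).antisymm ?_
    have := catenoid_image_neg (-c) T
    rwa [neg_neg] at this

/-- A map with the properties in `IsMinimalAnnulus.eq_catenoid_add` parametrizes a horizontal translate
of a catenoid waist injectively. -/
lemma injOn_and_image_of_eq_catenoid {S₀ S₁ α c T : ℝ} (h₀ : 0 < S₀) (h₁ : 0 < S₁)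
    (hS₀ : Real.log S₀ = c - T) (hS₁ : Real.log S₁ = c + T) (hα0 : α ≠ 0) {κ : ℂ}
    (hκ : Real.log ‖κ‖ = -c) (hκ0 : κ ≠ 0) {G : ℂ → E3} {v : E3}
    (hG : ∀ z ∈ annulusDomain S₀ S₁, G z = catenoid α (-κ * z) + v) :
    InjOn G (annulusDomain S₀ S₁) ∧ G '' annulusDomain S₀ S₁ =
      (fun p => p + v) '' (catenoid |α| '' annulusDomain (Real.exp (-T)) (Real.exp T)) := by
  have hnκ : -κ ≠ 0 := neg_ne_zero.2 hκ0
  have hmem : ∀ z, z ≠ 0 → (z ∈ annulusDomain S₀ S₁ ↔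
      -κ * z ∈ annulusDomain (Real.exp (-T)) (Real.exp T)) := by
    intro z hz
    rw [mem_annulusDomain_exp_iff (mul_ne_zero hnκ hz), norm_mul, norm_neg,
      Real.log_mul (norm_ne_zero_iff.2 hκ0) (norm_ne_zero_iff.2 hz), hκ]
    have := exp_mem_annulusDomain_iff h₀ h₁ (Complex.log z)
    rw [Complex.exp_log hz, Complex.log_re, hS₀, hS₁] at this
    rw [this]
    constructor <;> rintro ⟨h1, h2⟩ <;> constructor <;> linarith
  constructor
  · intro z hz w hw heq
    rw [hG z hz, hG w hw, add_left_inj] at heq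
    have hz0 := annulusDomain_ne_zero h₀ hz
    have hw0 := annulusDomain_ne_zero h₀ hw
    exact mul_left_cancel₀ hnκ
      (injOn_catenoid hα0 (mul_ne_zero hnκ hz0) (mul_ne_zero hnκ hw0) heq)
  · rw [catenoid_image_abs]
    ext p
    constructor
    · rintro ⟨z, hz, rfl⟩
      exact ⟨_, ⟨_, (hmem z (annulusDomain_ne_zero h₀ hz)).1 hz, rfl⟩, (hG z hz).symm⟩
    · rintro ⟨_, ⟨w, hw, rfl⟩, rfl⟩
      have hw0 := annulusDomain_exp_ne_zero hw
      have e : -κ * ((-κ)⁻¹ * w) = w := by field_simp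
      have hz : (-κ)⁻¹ * w ∈ annulusDomain S₀ S₁ := by
        rw [hmem _ (mul_ne_zero (inv_ne_zero hnκ) hw0), e]
        exact hw
      exact ⟨_, hz, by simp only [hG _ hz, e]⟩

/-! ### The area of an injective parametrization of a catenoid waist -/

/-- The inverse of the parametrization of a catenoid. -/
def catenoidInv (c : ℝ) (p : E3) : ℂ :=
  Real.exp (p 2 / c) * (p 0 + p 1 * Complex.I) / ‖(p 0 + p 1 * Complex.I : ℂ)‖

lemma catenoid_horizontal (c : ℝ) (z : ℂ) :
    (catenoid c z 0 : ℂ) + catenoid c z 1 * Complex.I =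
      (c * Real.cosh (Real.log ‖z‖) / ‖z‖ : ℝ) * z := by
  apply Complex.ext <;> simp [catenoid] <;> ring

lemma catenoidInv_catenoid {c : ℝ} (hc : 0 < c) {z : ℂ} (hz : z ≠ 0) :
    catenoidInv c (catenoid c z) = z := by
  have hn : 0 < ‖z‖ := norm_pos_iff.2 hz
  have hch := Real.cosh_pos (Real.log ‖z‖)
  rw [catenoidInv, catenoid_horizontal, catenoid_apply_two, mul_div_cancel_left₀ _ hc.ne',
    Real.exp_log hn, norm_mul, Complex.norm_real, Real.norm_of_nonneg (by positivity)]
  have h1 : (‖z‖ : ℂ) ≠ 0 := Complex.ofReal_ne_zero.2 hn.ne'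
  have h2 : (c : ℂ) ≠ 0 := Complex.ofReal_ne_zero.2 hc.ne'
  have h3 : (Real.cosh (Real.log ‖z‖) : ℂ) ≠ 0 := Complex.ofReal_ne_zero.2 hch.ne'
  push_cast at h3 ⊢
  field_simp

lemma differentiableAt_catenoidInv (c : ℝ) {p : E3} (hp : (p 0 + p 1 * Complex.I : ℂ) ≠ 0) :
    DifferentiableAt ℝ (catenoidInv c) p := by
  have hj : ∀ j, DifferentiableAt ℝ (fun p : E3 => (p j : ℂ)) p := fun j =>
    (Complex.ofRealCLM.comp (EuclideanSpace.proj j : E3 →L[ℝ] ℝ)).differentiableAt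
  have hh : DifferentiableAt ℝ (fun p : E3 => (p 0 + p 1 * Complex.I : ℂ)) p :=
    (hj 0).add ((hj 1).mul_const _)
  have he : DifferentiableAt ℝ (fun p : E3 => ((Real.exp (p 2 / c) : ℝ) : ℂ)) p :=
    Complex.ofRealCLM.differentiableAt.comp p (DifferentiableAt.exp (by
      simp only [div_eq_mul_inv]
      exact ((EuclideanSpace.proj 2 : E3 →L[ℝ] ℝ).differentiableAt).mul_const _))
  have hn : DifferentiableAt ℝ
      (fun p : E3 => ((‖(p 0 + p 1 * Complex.I : ℂ)‖⁻¹ : ℝ) : ℂ)) p :=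
    Complex.ofRealCLM.differentiableAt.comp p ((hh.norm ℝ hp).inv (norm_ne_zero_iff.2 hp))
  refine ((he.mul hh).mul hn).congr_of_eventuallyEq (Filter.Eventually.of_forall fun q => ?_)
  simp only [catenoidInv, Pi.mul_apply, Complex.ofReal_inv, div_eq_mul_inv]

/-- Area is invariant under reparametrization: an injective parametrization of a translate of a
catenoid waist has the area of the waist. -/
theorem area_eq_of_injOn_of_image_eq {S₀ S₁ c T : ℝ} (hc : 0 < c) {G : ℂ → E3} {v : E3}
    (hd : ∀ z ∈ annulusDomain S₀ S₁, DifferentiableAt ℝ G z) (hinj : InjOn G (annulusDomain S₀ S₁))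
    (himg : G '' annulusDomain S₀ S₁ =
      (fun p => p + v) '' (catenoid c '' annulusDomain (Real.exp (-T)) (Real.exp T))) :
    area S₀ S₁ G = area (Real.exp (-T)) (Real.exp T) (catenoid c) := by
  set A := annulusDomain S₀ S₁ with hA
  set W := annulusDomain (Real.exp (-T)) (Real.exp T) with hW
  have hAo : IsOpen A := isOpen_annulusDomain _ _
  set P : ℂ → ℂ := fun z => catenoidInv c (G z - v) with hP
  have hrep : ∀ z ∈ A, ∃ w ∈ W, G z = catenoid c w + v ∧ P z = w := by
    intro z hz
    obtain ⟨_, ⟨w, hw, rfl⟩, hwz⟩ := himg.subset (mem_image_of_mem G hz)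
    refine ⟨w, hw, hwz.symm, ?_⟩
    simp only [hP, ← hwz, add_sub_cancel_right]
    exact catenoidInv_catenoid hc (annulusDomain_exp_ne_zero hw)
  have hGP : ∀ z ∈ A, P z ∈ W ∧ G z = catenoid c (P z) + v := by
    intro z hz
    obtain ⟨w, hw, h1, h2⟩ := hrep z hz
    rw [h2]
    exact ⟨hw, h1⟩
  have hPd : ∀ z ∈ A, DifferentiableAt ℝ P z := by
    intro z hz
    refine (differentiableAt_catenoidInv c ?_).comp z ((hd z hz).sub_const v)
    obtain ⟨h1, h2⟩ := hGP z hz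
    have hw0 := annulusDomain_exp_ne_zero h1
    rw [h2, add_sub_cancel_right, catenoid_horizontal]
    have := Real.cosh_pos (Real.log ‖P z‖)
    have := norm_pos_iff.2 hw0
    exact mul_ne_zero (Complex.ofReal_ne_zero.2 (by positivity)) hw0
  have hPinj : InjOn P A := by
    intro z hz w hw heq
    refine hinj hz hw ?_
    rw [(hGP z hz).2, (hGP w hw).2, heq]
  have hPimg : P '' A = W := by
    refine Subset.antisymm (by rintro _ ⟨z, hz, rfl⟩; exact (hGP z hz).1) fun w hw => ?_
    obtain ⟨z, hz, hzw⟩ := himg.superset ⟨_, ⟨w, hw, rfl⟩, rfl⟩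
    refine ⟨z, hz, ?_⟩
    simp only [hP, hzw, add_sub_cancel_right]
    exact catenoidInv_catenoid hc (annulusDomain_exp_ne_zero hw)
  have hN : ∀ z ∈ A, normalVector G z = (fderiv ℝ P z).det • normalVector (catenoid c) (P z) := by
    intro z hz
    have hw0 := annulusDomain_exp_ne_zero (hGP z hz).1
    rw [← normalVector_comp ((contDiffAt_catenoid c hw0).differentiableAt (by simp)) (hPd z hz)]
    have hev : G =ᶠ[nhds z] fun z => catenoid c (P z) + v := by
      filter_upwards [hAo.mem_nhds hz] with y hy using (hGP y hy).2
    rw [normalVector_congr hev]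
    simp only [normalVector, fderiv_add_const]
  rw [area, area, ← hA, ← hW, ← hPimg, lintegral_image_eq_lintegral_abs_det_fderiv_mul volume
    hAo.measurableSet (fun z hz => (hPd z hz).hasFDerivAt.hasFDerivWithinAt) hPinj]
  refine setLIntegral_congr_fun hAo.measurableSet fun z hz => ?_
  rw [hN z hz, norm_smul, ENNReal.ofReal_mul (norm_nonneg _), Real.norm_eq_abs]

/-! ### The second variation of area of the catenoid -/

lemma hasFDerivAt_re (z : ℂ) : HasFDerivAt Complex.re (reMulCLM 1) z := by
  refine Complex.reCLM.hasFDerivAt.congr_fderiv ?_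
  ext v; simp

lemma hasFDerivAt_im (z : ℂ) : HasFDerivAt Complex.im (reMulCLM (-Complex.I)) z := by
  refine Complex.imCLM.hasFDerivAt.congr_fderiv ?_
  ext v; simp

lemma hasFDerivAt_inv_one_add_normSq (z : ℂ) :
    HasFDerivAt (fun w => (1 + Complex.normSq w)⁻¹)
      (reMulCLM (-2 * starRingEnd ℂ z / (1 + Complex.normSq z) ^ 2)) z := by
  have h0 := Complex.normSq_nonneg z
  have h1 : 1 + Complex.normSq z ≠ 0 := by positivity
  have hn : HasFDerivAt (fun w : ℂ => 1 + (w.re * w.re + w.im * w.im)) _ z :=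
    (((hasFDerivAt_re z).mul (hasFDerivAt_re z)).add
      ((hasFDerivAt_im z).mul (hasFDerivAt_im z))).const_add 1
  simp only [← Complex.normSq_apply] at hn
  refine ((hasDerivAt_inv h1).comp_hasFDerivAt z hn).congr_fderiv ?_
  ext v
  have e : -2 * starRingEnd ℂ z / (1 + Complex.normSq z : ℂ) ^ 2 * v =
      ((-2 / (1 + Complex.normSq z) ^ 2 : ℝ) : ℂ) * (starRingEnd ℂ z * v) := by push_cast; ring
  rw [reMulCLM_apply, e, Complex.re_ofReal_mul]
  simp
  ring

/-- The unit normal of the catenoid is the inverse stereographic projection of `-z`, so its energy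
density is twice the area density of the spherical metric. -/
lemma normSq_fderiv_catenoidNormal (z : ℂ) :
    ‖fderiv ℝ catenoidNormal z 1‖ ^ 2 + ‖fderiv ℝ catenoidNormal z Complex.I‖ ^ 2 =
      8 / (1 + Complex.normSq z) ^ 2 := by
  have h0 := Complex.normSq_nonneg z
  have h1 : 1 + Complex.normSq z ≠ 0 := by positivity
  set s : ℝ := 1 + Complex.normSq z with hs
  set q : ℂ := -2 * starRingEnd ℂ z / (s : ℂ) ^ 2 with hq
  have hinv : HasFDerivAt (fun w => (1 + Complex.normSq w)⁻¹) (reMulCLM q) z := by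
    have := hasFDerivAt_inv_one_add_normSq z
    rw [hq, hs]
    push_cast
    exact this
  have hg : HasComplexGradientAt catenoidNormal
      ![-2 * (s⁻¹ + z.re * q), -2 * (-Complex.I * s⁻¹ + z.im * q), -2 * q] z := by
    intro j
    fin_cases j
    · refine ((((hasFDerivAt_re z).mul hinv).const_mul (-2)).congr_of_eventuallyEq
        (Filter.Eventually.of_forall fun w => ?_)).congr_fderiv ?_
      · simp [catenoidNormal]; ring
      · ext v
        simp [-mul_eq_mul_left_iff]
        ring
    · refine ((((hasFDerivAt_im z).mul hinv).const_mul (-2)).congr_of_eventuallyEq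
        (Filter.Eventually.of_forall fun w => ?_)).congr_fderiv ?_
      · simp [catenoidNormal]; ring
      · ext v
        simp [-mul_eq_mul_left_iff]
        ring
    · refine (((hinv.const_mul (-2)).const_add 1).congr_of_eventuallyEq
        (Filter.Eventually.of_forall fun w => ?_)).congr_fderiv ?_
      · simp [catenoidNormal]; ring
      · ext v
        simp
        ring
  obtain ⟨-, hv⟩ := hg.hasFDerivAt
  have hqe : q = ((-2 / s ^ 2 : ℝ) : ℂ) * starRingEnd ℂ z := by rw [hq]; push_cast; ring
  have hqr : q.re = -2 / s ^ 2 * z.re := by rw [hqe, Complex.re_ofReal_mul, Complex.conj_re]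
  have hqi : q.im = 2 / s ^ 2 * z.im := by
    rw [hqe, Complex.im_ofReal_mul, Complex.conj_im]; ring
  rw [norm_sq_e3, norm_sq_e3]
  simp only [hv]
  simp [-mul_eq_mul_left_iff, hqr, hqi, -Complex.ofReal_inv, -Complex.ofReal_mul]
  have hsz : s = 1 + (z.re * z.re + z.im * z.im) := by rw [hs, Complex.normSq_apply]
  field_simp
  rw [hsz]
  ring

/-- The integrand of the second variation of area of the catenoid, where `|∇N|² = 8 / (1 + |z|²)²`. -/
def jacobiDensity (u : ℂ → ℝ) (z : ℂ) : ℝ :=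
  (fderiv ℝ u z 1) ^ 2 + (fderiv ℝ u z Complex.I) ^ 2 - 8 / (1 + Complex.normSq z) ^ 2 * u z ^ 2

lemma isStableOn_catenoid_iff {c : ℝ} (hc : c ≠ 0) {D : Set ℂ} (hD : IsOpen D) (hD0 : D ⊆ {0}ᶜ) :
    IsStableOn (catenoid c) D ↔ ∀ u : ℂ → ℝ, ContDiff ℝ ∞ u → HasCompactSupport u →
      tsupport u ⊆ D → 0 ≤ ∫ z in D, jacobiDensity u z := by
  refine forall₄_congr fun u _ _ _ => ?_
  have : ∀ z ∈ D, fderiv ℝ (unitNormal (catenoid c)) z = fderiv ℝ catenoidNormal z := by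
    intro z hz
    refine Filter.EventuallyEq.fderiv_eq ?_
    filter_upwards [hD.mem_nhds hz] with w hw using unitNormal_catenoid hc (hD0 hw)
  rw [setIntegral_congr_fun hD.measurableSet fun z hz => ?_]
  simp only [jacobiDensity]
  rw [this z hz, normSq_fderiv_catenoidNormal]

/-- Integration over an annulus in logarithmic polar coordinates. -/
lemma integral_annulusDomain_exp {a b M : ℝ} {f : ℂ → ℝ}
    (hf : ContinuousOn f (annulusDomain (Real.exp a) (Real.exp b)))
    (hM : ∀ z ∈ annulusDomain (Real.exp a) (Real.exp b), |f z| ≤ M) :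
    ∫ z in annulusDomain (Real.exp a) (Real.exp b), f z =
      ∫ θ in Ioo (-Real.pi) Real.pi, ∫ t in Ioo a b,
        Real.exp (2 * t) * f (Complex.exp (t + θ * Complex.I)) := by
  have hpol : ∀ r θ : ℝ, Complex.polarCoord.symm (r, θ) = r * Complex.exp (θ * Complex.I) := by
    intro r θ; simp [Complex.exp_mul_I]
  have hmem : ∀ r θ : ℝ, 0 < r →
      (Complex.polarCoord.symm (r, θ) ∈ annulusDomain (Real.exp a) (Real.exp b) ↔
      r ∈ Ioo (Real.exp a) (Real.exp b)) := by
    intro r θ hr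
    rw [hpol]
    simp [annulusDomain, abs_of_pos hr, Complex.norm_exp_ofReal_mul_I]
  have hcont : ContinuousOn (fun p : ℝ × ℝ => p.1 * f (Complex.polarCoord.symm p))
      (Ioo (Real.exp a) (Real.exp b) ×ˢ Ioo (-Real.pi) Real.pi) := by
    refine continuousOn_fst.mul (hf.comp ?_ ?_)
    · change ContinuousOn (fun p : ℝ × ℝ => Complex.polarCoord.symm p) _
      simp_rw [Complex.polarCoord_symm_apply]
      fun_prop
    · rintro ⟨r, θ⟩ ⟨hr, _⟩
      exact (hmem r θ ((Real.exp_pos a).trans hr.1)).2 hr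
  have hms : MeasurableSet (Ioo (Real.exp a) (Real.exp b) ×ˢ Ioo (-Real.pi) Real.pi) :=
    measurableSet_Ioo.prod measurableSet_Ioo
  have hint : IntegrableOn (fun p : ℝ × ℝ => p.1 * f (Complex.polarCoord.symm p))
      (Ioo (Real.exp a) (Real.exp b) ×ˢ Ioo (-Real.pi) Real.pi) (volume.prod volume) := by
    refine IntegrableOn.of_bound ?_ (hcont.aestronglyMeasurable hms) (Real.exp b * M) ?_
    · rw [Measure.prod_prod]
      simp [ENNReal.mul_lt_top_iff]
    · refine (ae_restrict_iff' hms).2 (Filter.Eventually.of_forall ?_)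
      rintro ⟨r, θ⟩ ⟨hr, -⟩
      have hr0 : 0 < r := (Real.exp_pos a).trans hr.1
      rw [norm_mul, Real.norm_of_nonneg hr0.le]
      exact mul_le_mul hr.2.le (hM _ ((hmem r θ hr0).2 hr)) (norm_nonneg _) (Real.exp_pos b).le
  calc
    _ = ∫ z, (annulusDomain (Real.exp a) (Real.exp b)).indicator f z :=
      (integral_indicator (isOpen_annulusDomain _ _).measurableSet).symm
    _ = ∫ p in polarCoord.target, p.1 •
          (annulusDomain (Real.exp a) (Real.exp b)).indicator f (Complex.polarCoord.symm p) :=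
      (Complex.integral_comp_polarCoord_symm _).symm
    _ = ∫ p in polarCoord.target,
          (Ioo (Real.exp a) (Real.exp b) ×ˢ Ioo (-Real.pi) Real.pi).indicator
          (fun p => p.1 * f (Complex.polarCoord.symm p)) p := by
      refine setIntegral_congr_fun polarCoord.open_target.measurableSet ?_
      rintro ⟨r, θ⟩ ⟨hr, hθ⟩
      have hr : 0 < r := hr
      by_cases h : r ∈ Ioo (Real.exp a) (Real.exp b)
      · have h' := (hmem r θ hr).2 h
        have h'' : (r, θ) ∈ Ioo (Real.exp a) (Real.exp b) ×ˢ Ioo (-Real.pi) Real.pi := ⟨h, hθ⟩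
        beta_reduce
        rw [indicator_of_mem h', indicator_of_mem h'', smul_eq_mul]
      · have h' := fun h' => h ((hmem r θ hr).1 h')
        have h'' : (r, θ) ∉ Ioo (Real.exp a) (Real.exp b) ×ˢ Ioo (-Real.pi) Real.pi :=
          fun h' => h h'.1
        beta_reduce
        rw [indicator_of_notMem h', indicator_of_notMem h'', smul_eq_mul, mul_zero]
    _ = ∫ p in Ioo (Real.exp a) (Real.exp b) ×ˢ Ioo (-Real.pi) Real.pi,
          p.1 * f (Complex.polarCoord.symm p) := by
      rw [setIntegral_indicator hms, inter_eq_right.2]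
      rintro ⟨r, θ⟩ ⟨hr, hθ⟩
      exact ⟨(Real.exp_pos a).trans hr.1, hθ⟩
    _ = ∫ θ in Ioo (-Real.pi) Real.pi, ∫ r in Ioo (Real.exp a) (Real.exp b),
          r * f (Complex.polarCoord.symm (r, θ)) := by
      rw [Measure.volume_eq_prod, ← Measure.prod_restrict] at *
      rw [integral_prod_symm]
      rwa [IntegrableOn, ← Measure.prod_restrict] at hint
    _ = _ := by
      refine setIntegral_congr_fun measurableSet_Ioo fun θ _ => ?_
      have himg : Real.exp '' Ioo a b = Ioo (Real.exp a) (Real.exp b) := by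
        ext r
        constructor
        · rintro ⟨t, ht, rfl⟩
          exact ⟨Real.exp_lt_exp.2 ht.1, Real.exp_lt_exp.2 ht.2⟩
        · intro hr
          have hr0 : 0 < r := (Real.exp_pos a).trans hr.1
          exact ⟨Real.log r, ⟨(Real.lt_log_iff_exp_lt hr0).2 hr.1,
            (Real.log_lt_iff_lt_exp hr0).2 hr.2⟩, Real.exp_log hr0⟩
      rw [← himg, integral_image_eq_integral_abs_deriv_smul measurableSet_Ioo
        (fun t _ => (Real.hasDerivAt_exp t).hasDerivWithinAt) Real.exp_injective.injOn]
      refine setIntegral_congr_fun measurableSet_Ioo fun t _ => ?_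
      rw [abs_of_pos (Real.exp_pos t), smul_eq_mul, ← mul_assoc, ← Real.exp_add, hpol,
        Complex.exp_add, Complex.ofReal_exp, two_mul]

/-! ### The Jacobi function of the catenoid waist -/

/-- The Jacobi function `1 - t tanh t` of the catenoid, the normal component of dilations. -/
def waistJacobi (t : ℝ) : ℝ := 1 - t * (Real.sinh t / Real.cosh t)

/-- The derivative of `waistJacobi`. -/
def waistJacobiDeriv (t : ℝ) : ℝ := -(Real.sinh t / Real.cosh t) - t / Real.cosh t ^ 2

lemma hasDerivAt_sinh_div_cosh (t : ℝ) :
    HasDerivAt (fun t => Real.sinh t / Real.cosh t) (1 / Real.cosh t ^ 2) t := by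
  refine ((Real.hasDerivAt_sinh t).div (Real.hasDerivAt_cosh t)
    (Real.cosh_pos t).ne').congr_deriv ?_
  rw [← Real.cosh_sq_sub_sinh_sq t]
  ring

lemma hasDerivAt_waistJacobi (t : ℝ) : HasDerivAt waistJacobi (waistJacobiDeriv t) t := by
  refine (((hasDerivAt_id' t).mul (hasDerivAt_sinh_div_cosh t)).const_sub 1).congr_deriv ?_
  simp only [waistJacobiDeriv]
  ring

/-- The Jacobi equation `w'' = -(2 / cosh² t) w`. -/
lemma hasDerivAt_waistJacobiDeriv (t : ℝ) :
    HasDerivAt waistJacobiDeriv (-(2 / Real.cosh t ^ 2) * waistJacobi t) t := by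
  have hc := (Real.cosh_pos t).ne'
  refine ((hasDerivAt_sinh_div_cosh t).neg.sub ((hasDerivAt_id' t).div
    ((Real.hasDerivAt_cosh t).pow 2) (pow_ne_zero 2 hc))).congr_deriv ?_
  simp only [waistJacobi]
  push_cast
  simp only [Pi.pow_apply]
  field_simp
  ring

lemma continuous_waistJacobi : Continuous waistJacobi :=
  continuous_iff_continuousAt.2 fun t => (hasDerivAt_waistJacobi t).continuousAt

lemma continuous_waistJacobiDeriv : Continuous waistJacobiDeriv :=
  continuous_iff_continuousAt.2 fun t => (hasDerivAt_waistJacobiDeriv t).continuousAt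

lemma contDiff_waistJacobi : ContDiff ℝ ∞ waistJacobi := by
  unfold waistJacobi
  exact contDiff_const.sub (contDiff_id.mul
    (Real.contDiff_sinh.div Real.contDiff_cosh fun t => (Real.cosh_pos t).ne'))

lemma waistJacobi_neg (t : ℝ) : waistJacobi (-t) = waistJacobi t := by
  simp [waistJacobi, neg_div]

lemma waistJacobiDeriv_neg (t : ℝ) : waistJacobiDeriv (-t) = -waistJacobiDeriv t := by
  simp [waistJacobiDeriv, neg_div]; ring

lemma waistJacobiDeriv_neg_of_pos {t : ℝ} (ht : 0 < t) : waistJacobiDeriv t < 0 := by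
  have h1 := Real.cosh_pos t
  have h2 := Real.sinh_pos_iff.2 ht
  have : 0 < Real.sinh t / Real.cosh t := by positivity
  have : 0 < t / Real.cosh t ^ 2 := by positivity
  simp only [waistJacobiDeriv]
  linarith

lemma waistJacobi_eq_div (t : ℝ) :
    waistJacobi t = -(t * Real.sinh t - Real.cosh t) / Real.cosh t := by
  have := (Real.cosh_pos t).ne'
  rw [waistJacobi]
  field_simp
  ring

lemma waistJacobi_eq_zero {s : ℝ} (hs : s * Real.sinh s = Real.cosh s) : waistJacobi s = 0 := by
  rw [waistJacobi_eq_div, hs]; simp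

lemma waistJacobi_pos {s t : ℝ} (hs : s * Real.sinh s = Real.cosh s)
    (ht : t ∈ Ioo (-s) s) : 0 < waistJacobi t := by
  have habs : waistJacobi t = waistJacobi |t| := by
    rcases abs_choice t with h | h <;> rw [h]
    rw [waistJacobi_neg]
  have hlt : |t| < s := abs_lt.2 ht
  have := strictMonoOn_mul_sinh_sub_cosh (mem_Ici.2 (abs_nonneg t))
    (mem_Ici.2 ((abs_nonneg t).trans hlt.le)) hlt
  simp only at this
  rw [habs, waistJacobi_eq_div]
  exact div_pos (by linarith) (Real.cosh_pos _)

lemma waistJacobi_le_one {t : ℝ} : waistJacobi t ≤ 1 := by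
  have h : 0 ≤ t * Real.sinh t := by
    rcases le_total 0 t with h | h
    · exact mul_nonneg h (Real.sinh_nonneg_iff.2 h)
    · exact mul_nonneg_of_nonpos_of_nonpos h (Real.sinh_nonpos_iff.2 h)
  have := div_nonneg h (Real.cosh_pos t).le
  rw [waistJacobi, ← mul_div_assoc]
  linarith

/-- The second variation in the axial direction is nonnegative where the Jacobi function is
positive: complete the square with the solution `w' / w` of the Riccati equation. -/
lemma integral_sq_deriv_sub_nonneg {s a : ℝ} (hs : s * Real.sinh s = Real.cosh s) (ha : 0 < a)
    (has : a < s) {f f' : ℝ → ℝ} (hf : ∀ t, HasDerivAt f (f' t) t) (hf' : Continuous f')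
    (h1 : f (-a) = 0) (h2 : f a = 0) :
    0 ≤ ∫ t in -a..a, (f' t ^ 2 - 2 / Real.cosh t ^ 2 * f t ^ 2) := by
  have hfc : Continuous f := continuous_iff_continuousAt.2 fun t => (hf t).continuousAt
  have hsub : uIcc (-a) a ⊆ Ioo (-s) s := by
    rw [uIcc_of_le (by linarith)]
    exact Icc_subset_Ioo (by linarith) has
  have hw : ∀ t ∈ uIcc (-a) a, waistJacobi t ≠ 0 := fun t ht => (waistJacobi_pos hs (hsub ht)).ne'
  set p : ℝ → ℝ := fun t => waistJacobiDeriv t / waistJacobi t with hp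
  have hpd : ∀ t ∈ uIcc (-a) a, HasDerivAt p (-(2 / Real.cosh t ^ 2) - p t ^ 2) t := by
    intro t ht
    refine ((hasDerivAt_waistJacobiDeriv t).div (hasDerivAt_waistJacobi t) (hw t ht)).congr_deriv ?_
    have := hw t ht
    have := (Real.cosh_pos t).ne'
    simp only [hp]
    field_simp
  have hpc : ContinuousOn p (uIcc (-a) a) := fun t ht => (hpd t ht).continuousAt.continuousWithinAt
  have hcosh : ∀ t : ℝ, Real.cosh t ^ 2 ≠ 0 := fun t => pow_ne_zero 2 (Real.cosh_pos t).ne'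
  have hP : ∀ t ∈ uIcc (-a) a, HasDerivAt (fun t => p t * f t ^ 2)
      ((-(2 / Real.cosh t ^ 2) - p t ^ 2) * f t ^ 2 + p t * (2 * f t * f' t)) t := by
    intro t ht
    refine ((hpd t ht).mul ((hf t).pow 2)).congr_deriv ?_
    simp
  have hc1 : ContinuousOn (fun t => (-(2 / Real.cosh t ^ 2) - p t ^ 2) * f t ^ 2 +
      p t * (2 * f t * f' t)) (uIcc (-a) a) := by
    have : Continuous fun t => 2 / Real.cosh t ^ 2 :=
      continuous_const.div (Real.continuous_cosh.pow 2) hcosh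
    exact ((this.neg.continuousOn.sub (hpc.pow 2)).mul (hfc.pow 2).continuousOn).add
      (hpc.mul ((continuous_const.mul hfc).mul hf').continuousOn)
  have hc2 : Continuous (fun t => f' t ^ 2 - 2 / Real.cosh t ^ 2 * f t ^ 2) := by
    have : Continuous fun t => 2 / Real.cosh t ^ 2 :=
      continuous_const.div (Real.continuous_cosh.pow 2) hcosh
    fun_prop
  have h0 := intervalIntegral.integral_eq_sub_of_hasDerivAt hP hc1.intervalIntegrable
  simp only [h1, h2] at h0
  rw [show (0 : ℝ) = p a * 0 ^ 2 - p (-a) * 0 ^ 2 by ring, ← h0]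
  refine intervalIntegral.integral_mono_on (by linarith) hc1.intervalIntegrable
    (hc2.intervalIntegrable _ _) fun t _ => ?_
  nlinarith [sq_nonneg (f' t - p t * f t)]

lemma continuous_jacobiDensity {u : ℂ → ℝ} (hu : ContDiff ℝ ∞ u) :
    Continuous (jacobiDensity u) := by
  have hd : Continuous (fderiv ℝ u) := hu.continuous_fderiv (by simp)
  have hV : Continuous fun z : ℂ => 8 / (1 + Complex.normSq z) ^ 2 :=
    continuous_const.div ((continuous_const.add Complex.continuous_normSq).pow 2) fun z => by
      have := Complex.normSq_nonneg z
      positivity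
  unfold jacobiDensity
  exact (((hd.clm_apply continuous_const).pow 2).add ((hd.clm_apply continuous_const).pow 2)).sub
    (hV.mul (hu.continuous.pow 2))

lemma jacobiDensity_eq_zero {u : ℂ → ℝ} {z : ℂ} (hz : z ∉ tsupport u) : jacobiDensity u z = 0 := by
  have h1 : u z = 0 := image_eq_zero_of_notMem_tsupport hz
  have h2 : fderiv ℝ u z = 0 := fderiv_of_notMem_tsupport ℝ hz
  simp [jacobiDensity, h1, h2]

lemma integrable_jacobiDensity {u : ℂ → ℝ} (hu : ContDiff ℝ ∞ u) (hc : HasCompactSupport u) :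
    Integrable (jacobiDensity u) :=
  (continuous_jacobiDensity hu).integrable_of_hasCompactSupport
    (HasCompactSupport.intro hc fun _ hz => jacobiDensity_eq_zero hz)

lemma hasDerivAt_radial {u : ℂ → ℝ} {t θ : ℝ}
    (hu : DifferentiableAt ℝ u (Complex.exp (t + θ * Complex.I))) :
    HasDerivAt (fun t : ℝ => u (Complex.exp (t + θ * Complex.I)))
      (fderiv ℝ u (Complex.exp (t + θ * Complex.I)) (Complex.exp (t + θ * Complex.I))) t := by
  have h1 : HasDerivAt (fun t : ℝ => Complex.exp (t + θ * Complex.I))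
      (Complex.exp (t + θ * Complex.I)) t := by
    have : HasDerivAt (fun t : ℝ => (t : ℂ) + θ * Complex.I) 1 t :=
      (Complex.ofRealCLM.hasDerivAt (x := t)).add_const _
    simpa using this.cexp
  exact hu.hasFDerivAt.comp_hasDerivAt t h1

lemma normSq_exp (t θ : ℝ) : Complex.normSq (Complex.exp (t + θ * Complex.I)) = Real.exp (2 * t) := by
  rw [Complex.normSq_eq_norm_sq, Complex.norm_exp, ← Real.exp_nat_mul]; simp

lemma exp_mul_potential (t : ℝ) :
    Real.exp (2 * t) * (8 / (1 + Real.exp (2 * t)) ^ 2) = 2 / Real.cosh t ^ 2 := by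
  have h1 := Real.exp_pos t
  rw [Real.cosh_eq, Real.exp_neg, show Real.exp (2 * t) = Real.exp t ^ 2 by
    rw [← Real.exp_nat_mul]; push_cast; rfl]
  field_simp
  ring

/-- The waist of the catenoid is stable in its part between two zeros of the Jacobi function. -/
theorem isStableOn_catenoid {c s T : ℝ} (hc : c ≠ 0) (hs : s * Real.sinh s = Real.cosh s)
    (hT : 0 < T) (hTs : T ≤ s) :
    IsStableOn (catenoid c) (annulusDomain (Real.exp (-T)) (Real.exp T)) := by
  rw [isStableOn_catenoid_iff hc (isOpen_annulusDomain _ _)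
    fun z hz => annulusDomain_exp_ne_zero hz]
  intro u hu hcs hsupp
  -- a slightly smaller waist that contains the support
  obtain ⟨a, ha0, haT, ha⟩ : ∃ a, 0 < a ∧ a < T ∧ ∀ z ∈ tsupport u, |Real.log ‖z‖| < a := by
    rcases (tsupport u).eq_empty_or_nonempty with he | hne
    · exact ⟨T / 2, by linarith, by linarith, by simp [he]⟩
    · have hcont : ContinuousOn (fun z : ℂ => |Real.log ‖z‖|) (tsupport u) := by
        refine ContinuousOn.abs (continuous_norm.continuousOn.log fun z hz => ?_)
        exact norm_ne_zero_iff.2 (annulusDomain_exp_ne_zero (hsupp hz))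
      obtain ⟨p, hp, hpm⟩ := hcs.isCompact.exists_isMaxOn hne hcont
      have hpT : |Real.log ‖p‖| < T :=
        abs_lt.2 ((mem_annulusDomain_exp_iff (annulusDomain_exp_ne_zero (hsupp hp))).1 (hsupp hp))
      obtain ⟨a, h1, h2⟩ := exists_between hpT
      exact ⟨a, (abs_nonneg _).trans_lt h1, h2, fun z hz => (hpm hz).trans_lt h1⟩
  have hsub : annulusDomain (Real.exp (-a)) (Real.exp a) ⊆
      annulusDomain (Real.exp (-T)) (Real.exp T) := fun z hz =>
    ⟨(Real.exp_lt_exp.2 (by linarith)).trans hz.1, hz.2.trans (Real.exp_lt_exp.2 haT)⟩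
  rw [setIntegral_eq_of_subset_of_forall_sdiff_eq_zero (isOpen_annulusDomain _ _).measurableSet hsub
    fun z hz => ?_]
  swap
  · by_contra hne
    have hzs : z ∈ tsupport u := by
      by_contra hns
      exact hne (jacobiDensity_eq_zero hns)
    exact hz.2 ((mem_annulusDomain_exp_iff (annulusDomain_exp_ne_zero hz.1)).2
      (abs_lt.1 (ha z hzs)))
  have hcont := continuous_jacobiDensity hu
  obtain ⟨M, hM⟩ := (HasCompactSupport.intro hcs
    fun z hz => jacobiDensity_eq_zero hz).exists_bound_of_continuous hcont
  rw [integral_annulusDomain_exp hcont.continuousOn fun z _ => hM z]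
  refine setIntegral_nonneg measurableSet_Ioo fun θ _ => ?_
  have hd : Differentiable ℝ u := hu.differentiable (by simp)
  have hz0 : ∀ t : ℝ, |t| = a → u (Complex.exp (t + θ * Complex.I)) = 0 := by
    intro t ht
    by_contra hne
    have := ha _ (subset_tsupport u hne)
    rw [Complex.norm_exp, Real.log_exp] at this
    simp [ht] at this
  have hdc : Continuous fun t : ℝ =>
      fderiv ℝ u (Complex.exp (t + θ * Complex.I)) (Complex.exp (t + θ * Complex.I)) := by
    have h1 : Continuous (fderiv ℝ u) := hu.continuous_fderiv (by simp)
    have h2 : Continuous fun t : ℝ => Complex.exp (t + θ * Complex.I) := by fun_prop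
    exact (h1.comp h2).clm_apply h2
  have h1D := integral_sq_deriv_sub_nonneg hs ha0 (haT.trans_le hTs)
    (f := fun t => u (Complex.exp (t + θ * Complex.I))) (fun t => hasDerivAt_radial (hd _)) hdc
    (by exact_mod_cast hz0 (-a) (by simp [abs_of_pos ha0]))
    (hz0 a (abs_of_pos ha0))
  rw [intervalIntegral.integral_of_le (by linarith), integral_Ioc_eq_integral_Ioo] at h1D
  have hline : Continuous fun t : ℝ => Complex.exp (t + θ * Complex.I) := by fun_prop
  have hcosh : Continuous fun t => 2 / Real.cosh t ^ 2 :=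
    continuous_const.div (Real.continuous_cosh.pow 2) fun t => pow_ne_zero 2 (Real.cosh_pos t).ne'
  refine h1D.trans (setIntegral_mono_on ?_ ?_ measurableSet_Ioo fun t _ => ?_)
  · exact (((hdc.pow 2).sub (hcosh.mul ((hu.continuous.comp hline).pow 2))).integrableOn_Icc).mono_set
      Ioo_subset_Icc_self
  · have : Continuous fun t : ℝ =>
        Real.exp (2 * t) * jacobiDensity u (Complex.exp (t + θ * Complex.I)) :=
      (by fun_prop : Continuous fun t : ℝ => Real.exp (2 * t)).mul (hcont.comp hline)
    exact this.integrableOn_Icc.mono_set Ioo_subset_Icc_self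
  · simp only [jacobiDensity]
    rw [normSq_exp, mul_sub, ← mul_assoc, exp_mul_potential]
    refine sub_le_sub_right ?_ _
    rw [clm_apply_eq_re_im (fderiv ℝ u _) (Complex.exp (t + θ * Complex.I)),
      ← normSq_exp t θ, Complex.normSq_apply]
    set z := Complex.exp (t + θ * Complex.I)
    set p := fderiv ℝ u z 1
    set q := fderiv ℝ u z Complex.I
    simp only [smul_eq_mul]
    nlinarith [sq_nonneg (z.re * q - z.im * p)]

/-! ### Instability of domains larger than the waist -/

/-- A smooth function that vanishes for `x ≤ 1` and equals `x` for `x ≥ 2`. -/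
def smoothRamp (x : ℝ) : ℝ := x * Real.smoothTransition (x - 1)

lemma contDiff_smoothRamp : ContDiff ℝ ∞ smoothRamp :=
  contDiff_id.mul (Real.smoothTransition.contDiff.comp (contDiff_id.sub contDiff_const))

lemma smoothRamp_of_le {x : ℝ} (hx : x ≤ 1) : smoothRamp x = 0 := by
  rw [smoothRamp, Real.smoothTransition.zero_of_nonpos (by linarith), mul_zero]

lemma smoothRamp_of_ge {x : ℝ} (hx : 2 ≤ x) : smoothRamp x = x := by
  rw [smoothRamp, Real.smoothTransition.one_of_one_le (by linarith), mul_one]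

lemma abs_smoothRamp_le (x : ℝ) : |smoothRamp x| ≤ |x| := by
  rw [smoothRamp, abs_mul, abs_of_nonneg (Real.smoothTransition.nonneg _)]
  exact mul_le_of_le_one_right (abs_nonneg x) (Real.smoothTransition.le_one _)

lemma deriv_smoothRamp_of_gt {x : ℝ} (hx : 2 < x) : deriv smoothRamp x = 1 := by
  have : smoothRamp =ᶠ[nhds x] id := by
    filter_upwards [Ioi_mem_nhds hx] with y hy using smoothRamp_of_ge (le_of_lt hy)
  rw [this.deriv_eq, deriv_id]

lemma exists_abs_deriv_smoothRamp_le : ∃ C, ∀ x, |deriv smoothRamp x| ≤ C := by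
  have hc : Continuous (deriv smoothRamp) := contDiff_smoothRamp.continuous_deriv (by simp)
  obtain ⟨C, hC⟩ := (isCompact_Icc (a := (1 : ℝ)) (b := 2)).exists_bound_of_continuousOn
    hc.continuousOn
  refine ⟨max C 1, fun x => ?_⟩
  rcases lt_or_ge x 1 with h1 | h1
  · have : smoothRamp =ᶠ[nhds x] fun _ => 0 := by
      filter_upwards [Iio_mem_nhds h1] with y hy using smoothRamp_of_le (le_of_lt hy)
    rw [this.deriv_eq, deriv_const]
    simp
  · rcases le_or_gt x 2 with h2 | h2
    · exact (hC x ⟨h1, h2⟩).trans (le_max_left _ _)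
    · rw [deriv_smoothRamp_of_gt h2]
      simp

/-- The Jacobi function on the plane, cut off where it is less than `1 / n` and extended by zero; it is
unchanged where the Jacobi function exceeds `2 / n`. -/
def cutoffJacobi (s : ℝ) (n : ℕ) : ℂ → ℝ :=
  (annulusDomain (Real.exp (-s)) (Real.exp s)).indicator
    fun z => smoothRamp (n * waistJacobi (Real.log ‖z‖)) / n

/-- A compact set in the waist that contains the support of `cutoffJacobi`. -/
lemma exists_isCompact_cutoffJacobi {s : ℝ} (hs : s * Real.sinh s = Real.cosh s) {n : ℕ}
    (hn : 0 < n) : ∃ K : Set ℂ, IsCompact K ∧ K ⊆ annulusDomain (Real.exp (-s)) (Real.exp s) ∧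
      ∀ z, z ∉ K → cutoffJacobi s n z = 0 := by
  have hn' : (0 : ℝ) < n := by exact_mod_cast hn
  set S : Set ℂ := {z | Real.exp (-s) ≤ ‖z‖} ∩ {z | ‖z‖ ≤ Real.exp s} with hS
  have hScl : IsClosed S := (isClosed_le continuous_const continuous_norm).inter
    (isClosed_le continuous_norm continuous_const)
  have hS0 : ∀ z ∈ S, z ≠ 0 := fun z hz => norm_pos_iff.1 ((Real.exp_pos _).trans_le hz.1)
  have hcont : ContinuousOn (fun z : ℂ => waistJacobi (Real.log ‖z‖)) S :=
    continuous_waistJacobi.comp_continuousOn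
      (continuous_norm.continuousOn.log fun z hz => norm_ne_zero_iff.2 (hS0 z hz))
  have hlog : ∀ z ∈ S, Real.log ‖z‖ ∈ Icc (-s) s := fun z hz =>
    ⟨(Real.le_log_iff_exp_le (norm_pos_iff.2 (hS0 z hz))).2 hz.1,
      (Real.log_le_iff_le_exp (norm_pos_iff.2 (hS0 z hz))).2 hz.2⟩
  refine ⟨S ∩ (fun z : ℂ => waistJacobi (Real.log ‖z‖)) ⁻¹' Ici (n : ℝ)⁻¹, ?_, ?_, ?_⟩
  · refine Metric.isCompact_of_isClosed_isBounded (hcont.preimage_isClosed_of_isClosed hScl isClosed_Ici) ?_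
    refine (Metric.isBounded_closedBall (x := (0 : ℂ)) (r := Real.exp s)).subset fun z hz => ?_
    simpa using hz.1.2
  · rintro z ⟨hz, hw⟩
    have hw' : 0 < waistJacobi (Real.log ‖z‖) := lt_of_lt_of_le (by positivity) hw
    rw [mem_annulusDomain_exp_iff (hS0 z hz)]
    obtain ⟨h1, h2⟩ := hlog z hz
    constructor
    · refine lt_of_le_of_ne h1 fun h => hw'.ne' ?_
      rw [← h, waistJacobi_neg, waistJacobi_eq_zero hs]
    · refine lt_of_le_of_ne h2 fun h => hw'.ne' ?_
      rw [h, waistJacobi_eq_zero hs]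
  · intro z hz
    by_cases hzA : z ∈ annulusDomain (Real.exp (-s)) (Real.exp s)
    · rw [cutoffJacobi, indicator_of_mem hzA]
      have : waistJacobi (Real.log ‖z‖) < (n : ℝ)⁻¹ := by
        by_contra! hle
        exact hz ⟨⟨hzA.1.le, hzA.2.le⟩, hle⟩
      rw [smoothRamp_of_le, zero_div]
      have := mul_le_mul_of_nonneg_left this.le hn'.le
      rwa [mul_inv_cancel₀ hn'.ne'] at this
    · rw [cutoffJacobi, indicator_of_notMem hzA]

/-- The cut-off Jacobi functions are test functions supported in the waist. -/
lemma cutoffJacobi_properties {s : ℝ} (hs : s * Real.sinh s = Real.cosh s) {n : ℕ} (hn : 0 < n) :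
    ContDiff ℝ ∞ (cutoffJacobi s n) ∧ HasCompactSupport (cutoffJacobi s n) ∧
    tsupport (cutoffJacobi s n) ⊆ annulusDomain (Real.exp (-s)) (Real.exp s) ∧
    ∀ z ∈ annulusDomain (Real.exp (-s)) (Real.exp s),
      cutoffJacobi s n z = smoothRamp (n * waistJacobi (Real.log ‖z‖)) / n ∧
      ∀ v, fderiv ℝ (cutoffJacobi s n) z v = deriv smoothRamp (n * waistJacobi (Real.log ‖z‖)) *
        (waistJacobiDeriv (Real.log ‖z‖) * (z⁻¹ * v).re) := by
  have hn' : (n : ℝ) ≠ 0 := by exact_mod_cast hn.ne'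
  obtain ⟨K, hK, hKA, hK0⟩ := exists_isCompact_cutoffJacobi hs hn
  have hsupp : tsupport (cutoffJacobi s n) ⊆ K :=
    closure_minimal (fun z hz => by_contra fun h => hz (hK0 z h)) hK.isClosed
  have hev : ∀ z ∈ annulusDomain (Real.exp (-s)) (Real.exp s), cutoffJacobi s n =ᶠ[nhds z]
      fun z => smoothRamp (n * waistJacobi (Real.log ‖z‖)) / n := fun z hz => by
    filter_upwards [(isOpen_annulusDomain _ _).mem_nhds hz] with w hw
    exact indicator_of_mem hw _
  refine ⟨contDiff_iff_contDiffAt.2 fun z => ?_, HasCompactSupport.intro hK hK0, hsupp.trans hKA,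
    fun z hz => ⟨(hev z hz).eq_of_nhds, fun v => ?_⟩⟩
  · by_cases hz : z ∈ tsupport (cutoffJacobi s n)
    swap
    · exact contDiffAt_const.congr_of_eventuallyEq (notMem_tsupport_iff_eventuallyEq.1 hz)
    have hzA := hKA (hsupp hz)
    have hz0 := annulusDomain_exp_ne_zero hzA
    refine ContDiffAt.congr_of_eventuallyEq ?_ (hev z hzA)
    have hL : ContDiffAt ℝ ∞ (fun z : ℂ => Real.log ‖z‖) z :=
      (contDiffAt_norm ℝ hz0).log (norm_ne_zero_iff.2 hz0)
    exact (contDiff_smoothRamp.contDiffAt.comp z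
      (contDiffAt_const.mul (contDiff_waistJacobi.contDiffAt.comp z hL))).div_const _
  · have hz0 := annulusDomain_exp_ne_zero hz
    have h1 : HasDerivAt smoothRamp (deriv smoothRamp (n * waistJacobi (Real.log ‖z‖)))
        (n * waistJacobi (Real.log ‖z‖)) :=
      (contDiff_smoothRamp.differentiable (by simp)).differentiableAt.hasDerivAt
    have h2 := (h1.comp (Real.log ‖z‖) ((hasDerivAt_waistJacobi _).const_mul (n : ℝ))).div_const
      (n : ℝ)
    have h3 := h2.comp_hasFDerivAt z (hasFDerivAt_log_norm hz0)
    rw [(hev z hz).fderiv_eq]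
    refine (congrArg (fun L => L v) h3.fderiv).trans ?_
    simp only [smul_apply, reMulCLM_apply, smul_eq_mul]
    field_simp

/-- A connected open set larger than the waist contains a point of its boundary. -/
lemma exists_mem_abs_log_norm_eq {s : ℝ} (hs : 0 < s) {D : Set ℂ} (hD : IsPreconnected D)
    (hWD : annulusDomain (Real.exp (-s)) (Real.exp s) ⊂ D) (hD0 : D ⊆ {0}ᶜ) :
    ∃ p ∈ D, |Real.log ‖p‖| = s := by
  by_contra! hne
  set V : Set ℂ := {z | ‖z‖ < Real.exp (-s)} ∪ {z | Real.exp s < ‖z‖} with hV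
  have hVo : IsOpen V := (isOpen_lt continuous_norm continuous_const).union
    (isOpen_lt continuous_const continuous_norm)
  have hlt : Real.exp (-s) < Real.exp s := Real.exp_lt_exp.2 (by linarith)
  have hcov : D ⊆ annulusDomain (Real.exp (-s)) (Real.exp s) ∪ V := by
    intro z hz
    have hz0 : z ≠ 0 := hD0 hz
    have hzn := norm_pos_iff.2 hz0
    rcases lt_or_gt_of_ne (hne z hz) with h | h
    · exact Or.inl ((mem_annulusDomain_exp_iff hz0).2 (abs_lt.1 h))
    · right
      rcases lt_abs.1 h with h | h
      · exact Or.inr ((Real.lt_log_iff_exp_lt hzn).1 h)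
      · exact Or.inl ((Real.log_lt_iff_lt_exp hzn).1 (by linarith))
  have hdis : D ∩ (annulusDomain (Real.exp (-s)) (Real.exp s) ∩ V) = ∅ := by
    ext z
    simp only [mem_inter_iff, mem_empty_iff_false, iff_false, not_and]
    rintro - ⟨h1, h2⟩ (h3 | h3)
    · exact lt_asymm h1 h3
    · exact lt_asymm h2 h3
  have h1 : (1 : ℂ) ∈ annulusDomain (Real.exp (-s)) (Real.exp s) := by
    rw [mem_annulusDomain_exp_iff one_ne_zero]
    simpa using hs
  rcases isPreconnected_iff_subset_of_disjoint.1 hD _ _ (isOpen_annulusDomain _ _) hVo hcov hdis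
    with h | h
  · exact hWD.2 h
  · have : (1 : ℂ) ∈ D ∩ (annulusDomain (Real.exp (-s)) (Real.exp s) ∩ V) :=
      ⟨hWD.1 h1, h1, h (hWD.1 h1)⟩
    rw [hdis] at this
    exact this

/-- In logarithmic coordinates, the second variation at the Jacobi function is an exact
derivative. -/
lemma integral_waist_eq {s ε : ℝ} (hs0 : 0 < s) (hs : s * Real.sinh s = Real.cosh s)
    {f f' : ℝ → ℝ} (hf : ∀ t, HasDerivAt f (f' t) t) (hf' : Continuous f') :
    ∫ t in Ioo (-s) s, (waistJacobiDeriv t ^ 2 - 2 / Real.cosh t ^ 2 * waistJacobi t ^ 2 +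
      2 * ε * (waistJacobiDeriv t * f' t - 2 / Real.cosh t ^ 2 * waistJacobi t * f t)) =
      2 * ε * (waistJacobiDeriv s * (f s + f (-s))) := by
  have hfc : Continuous f := continuous_iff_continuousAt.2 fun t => (hf t).continuousAt
  have hP : ∀ t ∈ uIcc (-s) s, HasDerivAt
      (fun t => waistJacobi t * waistJacobiDeriv t + 2 * ε * (waistJacobiDeriv t * f t))
      (waistJacobiDeriv t ^ 2 - 2 / Real.cosh t ^ 2 * waistJacobi t ^ 2 +
      2 * ε * (waistJacobiDeriv t * f' t - 2 / Real.cosh t ^ 2 * waistJacobi t * f t)) t := by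
    intro t _
    refine (((hasDerivAt_waistJacobi t).mul (hasDerivAt_waistJacobiDeriv t)).add
      (((hasDerivAt_waistJacobiDeriv t).mul (hf t)).const_mul (2 * ε))).congr_deriv ?_
    ring
  have hc : Continuous fun t => waistJacobiDeriv t ^ 2 - 2 / Real.cosh t ^ 2 * waistJacobi t ^ 2 +
      2 * ε * (waistJacobiDeriv t * f' t - 2 / Real.cosh t ^ 2 * waistJacobi t * f t) := by
    have h1 : Continuous fun t => 2 / Real.cosh t ^ 2 :=
      continuous_const.div (Real.continuous_cosh.pow 2) fun t => pow_ne_zero 2 (Real.cosh_pos t).ne'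
    have h2 := continuous_waistJacobi
    have h3 := continuous_waistJacobiDeriv
    exact ((h3.pow 2).sub (h1.mul (h2.pow 2))).add (continuous_const.mul
      ((h3.mul hf').sub ((h1.mul h2).mul hfc)))
  rw [← integral_Ioc_eq_integral_Ioo, ← intervalIntegral.integral_of_le (by linarith),
    intervalIntegral.integral_eq_sub_of_hasDerivAt hP (hc.intervalIntegrable _ _),
    waistJacobi_neg, waistJacobi_eq_zero hs, waistJacobiDeriv_neg]
  ring

/-- The second variation is a quadratic form. The term in `ε²` is separated, because `ψ` need not be
supported in the waist. -/
lemma jacobiDensity_add_mul {u ψ : ℂ → ℝ} {z : ℂ} (ε : ℝ) (hu : DifferentiableAt ℝ u z)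
    (hψ : DifferentiableAt ℝ ψ z) :
    jacobiDensity (fun z => u z + ε * ψ z) z - ε ^ 2 * jacobiDensity ψ z =
      (fderiv ℝ u z 1) ^ 2 + (fderiv ℝ u z Complex.I) ^ 2 -
        8 / (1 + Complex.normSq z) ^ 2 * u z ^ 2 +
      2 * ε * (fderiv ℝ u z 1 * fderiv ℝ ψ z 1 + fderiv ℝ u z Complex.I * fderiv ℝ ψ z Complex.I -
        8 / (1 + Complex.normSq z) ^ 2 * u z * ψ z) := by
  have : fderiv ℝ (fun z => u z + ε * ψ z) z = fderiv ℝ u z + ε • fderiv ℝ ψ z := by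
    rw [fderiv_fun_add hu (hψ.const_mul ε), fderiv_const_mul hψ]
  simp only [jacobiDensity, this, add_apply, smul_apply, smul_eq_mul]
  ring

/-- The second variation at the Jacobi function of the waist, extended by zero and perturbed by `ε ψ`,
is bounded below on a stable domain: approximate by the cut-off Jacobi functions. -/
lemma neg_sq_mul_integral_le {s ε : ℝ} (hs0 : 0 < s) (hs : s * Real.sinh s = Real.cosh s)
    {D : Set ℂ} (hD : IsOpen D) (hWD : annulusDomain (Real.exp (-s)) (Real.exp s) ⊆ D)
    (hstable : ∀ u : ℂ → ℝ, ContDiff ℝ ∞ u → HasCompactSupport u →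
      tsupport u ⊆ D → 0 ≤ ∫ z in D, jacobiDensity u z)
    {ψ : ℂ → ℝ} (hψ : ContDiff ℝ ∞ ψ) (hψc : HasCompactSupport ψ) (hψD : tsupport ψ ⊆ D) :
    -(ε ^ 2 * ∫ z in D, jacobiDensity ψ z) ≤
      2 * ε * ∫ θ in Ioo (-Real.pi) Real.pi, waistJacobiDeriv s *
        (ψ (Complex.exp (s + θ * Complex.I)) +
          ψ (Complex.exp ((-s : ℝ) + θ * Complex.I))) := by
  set A := annulusDomain (Real.exp (-s)) (Real.exp s) with hA
  have hAo : IsOpen A := isOpen_annulusDomain _ _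
  have hA0 : ∀ z ∈ A, z ≠ 0 := fun z hz => annulusDomain_exp_ne_zero hz
  have hψd : Differentiable ℝ ψ := hψ.differentiable (by simp)
  set L : ℂ → ℝ := fun z => Real.log ‖z‖ with hL
  set V : ℂ → ℝ := fun z => 8 / (1 + Complex.normSq z) ^ 2 with hV
  set g₁ : ℂ → ℝ := fun z => waistJacobiDeriv (L z) ^ 2 * ((z⁻¹ * 1).re ^ 2 +
    (z⁻¹ * Complex.I).re ^ 2) with hg₁
  set g₂ : ℂ → ℝ := fun z => waistJacobiDeriv (L z) * ((z⁻¹ * 1).re * fderiv ℝ ψ z 1 +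
    (z⁻¹ * Complex.I).re * fderiv ℝ ψ z Complex.I) with hg₂
  -- the integrand, for a multiple `x` of the Jacobi function with a multiple `y` of its gradient
  set E : ℝ → ℝ → ℂ → ℝ := fun y x z => y ^ 2 * g₁ z - V z * x ^ 2 +
    2 * ε * (y * g₂ z - V z * x * ψ z) with hE
  set a : ℕ → ℂ → ℝ := fun n z => deriv smoothRamp (n * waistJacobi (L z)) with ha
  set b : ℕ → ℂ → ℝ := fun n z => smoothRamp (n * waistJacobi (L z)) / n with hb
  -- continuity and bounds
  set S : Set ℂ := {z | Real.exp (-s) ≤ ‖z‖} ∩ {z | ‖z‖ ≤ Real.exp s} with hS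
  have hAS : A ⊆ S := fun z hz => ⟨hz.1.le, hz.2.le⟩
  have hScl : IsClosed S := (isClosed_le continuous_const continuous_norm).inter
    (isClosed_le continuous_norm continuous_const)
  have hSc : IsCompact S := by
    refine Metric.isCompact_of_isClosed_isBounded hScl
      ((Metric.isBounded_closedBall (x := (0 : ℂ)) (r := Real.exp s)).subset fun z hz => ?_)
    simpa using hz.2
  have hS0 : ∀ z ∈ S, z ≠ 0 := fun z hz => norm_pos_iff.1 ((Real.exp_pos _).trans_le hz.1)
  have hLc : ContinuousOn L S :=
    continuous_norm.continuousOn.log fun z hz => norm_ne_zero_iff.2 (hS0 z hz)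
  have hinv : ContinuousOn (fun z : ℂ => z⁻¹) S := continuousOn_inv₀.mono fun z hz => hS0 z hz
  have hr1 : ContinuousOn (fun z : ℂ => (z⁻¹ * 1).re) S :=
    Complex.continuous_re.comp_continuousOn (hinv.mul continuousOn_const)
  have hr2 : ContinuousOn (fun z : ℂ => (z⁻¹ * Complex.I).re) S :=
    Complex.continuous_re.comp_continuousOn (hinv.mul continuousOn_const)
  have hw' : ContinuousOn (fun z => waistJacobiDeriv (L z)) S :=
    continuous_waistJacobiDeriv.comp_continuousOn hLc
  have hw : ContinuousOn (fun z => waistJacobi (L z)) S :=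
    continuous_waistJacobi.comp_continuousOn hLc
  have hψ' : ∀ v, Continuous fun z => fderiv ℝ ψ z v := fun v =>
    (hψ.continuous_fderiv (by simp)).clm_apply continuous_const
  have hg₁c : ContinuousOn g₁ S := (hw'.pow 2).mul ((hr1.pow 2).add (hr2.pow 2))
  have hg₂c : ContinuousOn g₂ S := hw'.mul
    ((hr1.mul (hψ' 1).continuousOn).add (hr2.mul (hψ' Complex.I).continuousOn))
  have hVc : Continuous V :=
    continuous_const.div ((continuous_const.add Complex.continuous_normSq).pow 2) fun z => by
      have := Complex.normSq_nonneg z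
      positivity
  have hEc : ∀ y x : ℂ → ℝ, ContinuousOn y S → ContinuousOn x S →
      ContinuousOn (fun z => E (y z) (x z) z) S := fun y x hy hx =>
    (((hy.pow 2).mul hg₁c).sub (hVc.continuousOn.mul (hx.pow 2))).add (continuousOn_const.mul
      ((hy.mul hg₂c).sub ((hVc.continuousOn.mul hx).mul hψ.continuous.continuousOn)))
  obtain ⟨M₁, hM₁⟩ := hSc.exists_bound_of_continuousOn hg₁c
  obtain ⟨M₂, hM₂⟩ := hSc.exists_bound_of_continuousOn hg₂c
  obtain ⟨M₃, hM₃⟩ := hSc.exists_bound_of_continuousOn hVc.continuousOn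
  obtain ⟨M₄, hM₄⟩ := hSc.exists_bound_of_continuousOn
    (hVc.mul hψ.continuous).continuousOn
  have hEbd : ∀ y x C : ℝ, |y| ≤ C → |x| ≤ 1 → ∀ z ∈ S,
      |E y x z| ≤ C ^ 2 * M₁ + M₃ + |2 * ε| * (C * M₂ + M₄) := by
    intro y x C hy hx z hz
    have h1 := hM₁ z hz
    have h2 := hM₂ z hz
    have h3 := hM₃ z hz
    have h4 := hM₄ z hz
    rw [Real.norm_eq_abs] at h1 h2 h3 h4
    have hC : 0 ≤ C := (abs_nonneg y).trans hy
    have hy2 : |y ^ 2| ≤ C ^ 2 := by rw [abs_pow]; exact pow_le_pow_left₀ (abs_nonneg y) hy 2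
    have hx2 : |x ^ 2| ≤ 1 := by rw [abs_pow]; exact pow_le_one₀ (abs_nonneg x) hx
    have b1 : |y ^ 2 * g₁ z| ≤ C ^ 2 * M₁ := by
      rw [abs_mul]; exact mul_le_mul hy2 h1 (abs_nonneg _) (by positivity)
    have b2 : |V z * x ^ 2| ≤ M₃ := by
      rw [abs_mul]
      exact (mul_le_of_le_one_right (abs_nonneg _) hx2).trans h3
    have b3 : |y * g₂ z| ≤ C * M₂ := by
      rw [abs_mul]; exact mul_le_mul hy h2 (abs_nonneg _) hC
    have b4 : |V z * x * ψ z| ≤ M₄ := by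
      rw [mul_right_comm, abs_mul]
      exact (mul_le_of_le_one_right (abs_nonneg _) hx).trans h4
    refine (abs_add_le _ _).trans (add_le_add ((abs_sub _ _).trans (add_le_add b1 b2)) ?_)
    rw [abs_mul]
    exact mul_le_mul_of_nonneg_left ((abs_sub _ _).trans (add_le_add b3 b4)) (abs_nonneg _)
  have hlog : ∀ z ∈ A, L z ∈ Ioo (-s) s := fun z hz => (mem_annulusDomain_exp_iff (hA0 z hz)).1 hz
  have hw01 : ∀ z ∈ A, 0 < waistJacobi (L z) ∧ |waistJacobi (L z)| ≤ 1 := fun z hz => by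
    have h := waistJacobi_pos hs (hlog z hz)
    exact ⟨h, by rw [abs_of_pos h]; exact waistJacobi_le_one⟩
  -- the second variation at the approximations
  have hn : ∀ n : ℕ, 0 < n → -(ε ^ 2 * ∫ z in D, jacobiDensity ψ z) ≤
      ∫ z in A, E (a n z) (b n z) z := by
    intro n hn
    obtain ⟨hu, huc, hus, hform⟩ := cutoffJacobi_properties hs hn
    set u := cutoffJacobi s n with hudef
    have hud : Differentiable ℝ u := hu.differentiable (by simp)
    have hv : ContDiff ℝ ∞ (fun z => u z + ε * ψ z) := hu.add (contDiff_const.mul hψ)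
    have hψεc : HasCompactSupport fun z => ε * ψ z := hψc.mul_left
    have hvc : HasCompactSupport (fun z => u z + ε * ψ z) := huc.add hψεc
    have hvD : tsupport (fun z => u z + ε * ψ z) ⊆ D :=
      (tsupport_add u fun z => ε * ψ z).trans (union_subset (hus.trans hWD)
        ((tsupport_mul_subset_right (f := fun _ => ε) (g := ψ)).trans hψD))
    have h0 := hstable _ hv hvc hvD
    have hsplit : ∫ z in D, jacobiDensity (fun z => u z + ε * ψ z) z =
        (∫ z in D, (jacobiDensity (fun z => u z + ε * ψ z) z - ε ^ 2 * jacobiDensity ψ z)) +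
          ε ^ 2 * ∫ z in D, jacobiDensity ψ z := by
      rw [integral_sub (integrable_jacobiDensity hv hvc).integrableOn
        ((integrable_jacobiDensity hψ hψc).const_mul _).integrableOn, integral_const_mul]
      ring
    rw [hsplit] at h0
    have hDA : ∫ z in D, (jacobiDensity (fun z => u z + ε * ψ z) z - ε ^ 2 * jacobiDensity ψ z) =
        ∫ z in A, E (a n z) (b n z) z := by
      rw [setIntegral_eq_of_subset_of_forall_sdiff_eq_zero hD.measurableSet hWD fun z hz => ?_]
      · refine setIntegral_congr_fun hAo.measurableSet fun z hz => ?_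
        obtain ⟨f1, f2⟩ := hform z hz
        rw [jacobiDensity_add_mul ε hud.differentiableAt hψd.differentiableAt, f1, f2, f2]
        simp only [hE, ha, hb, hg₁, hg₂, hV, hL]
        ring
      · have hz' : z ∉ tsupport u := fun h => hz.2 (hus h)
        rw [jacobiDensity_add_mul ε hud.differentiableAt hψd.differentiableAt,
          image_eq_zero_of_notMem_tsupport hz', fderiv_of_notMem_tsupport ℝ hz']
        simp
    linarith
  -- the limit
  obtain ⟨C, hC⟩ := exists_abs_deriv_smoothRamp_le
  have hac : ∀ n, ContinuousOn (a n) S := fun n =>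
    (contDiff_smoothRamp.continuous_deriv (by simp)).comp_continuousOn (continuousOn_const.mul hw)
  have hbc : ∀ n, ContinuousOn (b n) S := fun n =>
    (contDiff_smoothRamp.continuous.comp_continuousOn (continuousOn_const.mul hw)).div_const _
  have hAfin : volume A ≠ ⊤ := ((measure_mono hAS).trans_lt hSc.measure_lt_top).ne
  have hlim : Filter.Tendsto (fun n : ℕ => ∫ z in A, E (a n z) (b n z) z) Filter.atTop
      (nhds (∫ z in A, E 1 (waistJacobi (L z)) z)) := by
    refine tendsto_integral_of_dominated_convergence
      (fun _ => C ^ 2 * M₁ + M₃ + |2 * ε| * (C * M₂ + M₄))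
      (fun n => ((hEc _ _ (hac n) (hbc n)).mono hAS).aestronglyMeasurable hAo.measurableSet)
      (integrableOn_const hAfin) (fun n => ?_) ?_
    · refine (ae_restrict_iff' hAo.measurableSet).2 (Filter.Eventually.of_forall fun z hz => ?_)
      refine hEbd _ _ C (hC _) ?_ z (hAS hz)
      simp only [hb]
      rw [abs_div, Nat.abs_cast]
      rcases Nat.eq_zero_or_pos n with rfl | hn
      · simp
      · have hn' : (0 : ℝ) < n := by exact_mod_cast hn
        rw [div_le_one hn']
        refine (abs_smoothRamp_le _).trans ?_
        rw [abs_mul, Nat.abs_cast]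
        exact mul_le_of_le_one_right hn'.le (hw01 z hz).2
    · refine (ae_restrict_iff' hAo.measurableSet).2 (Filter.Eventually.of_forall fun z hz => ?_)
      refine tendsto_const_nhds.congr' ?_
      filter_upwards [Filter.eventually_gt_atTop 0, ((tendsto_natCast_atTop_atTop (R := ℝ)).atTop_mul_const
        (hw01 z hz).1).eventually_gt_atTop 2] with n hn0 hn2
      have hn' : (n : ℝ) ≠ 0 := by exact_mod_cast hn0.ne'
      simp only [ha, hb]
      rw [deriv_smoothRamp_of_gt hn2, smoothRamp_of_ge hn2.le, mul_div_cancel_left₀ _ hn']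
  have hge := ge_of_tendsto hlim ((Filter.eventually_gt_atTop 0).mono fun n hn0 => hn n hn0)
  refine hge.trans (le_of_eq ?_)
  have hfin := integral_annulusDomain_exp (a := -s) (b := s)
    ((hEc _ _ continuousOn_const hw).mono hAS)
    (M := 1 ^ 2 * M₁ + M₃ + |2 * ε| * (1 * M₂ + M₄))
    fun z hz => hEbd 1 _ 1 (by simp) (hw01 z hz).2 z (hAS hz)
  refine hfin.trans ?_
  rw [← integral_const_mul]
  refine setIntegral_congr_fun measurableSet_Ioo fun θ _ => ?_
  have hline : Continuous fun t : ℝ => Complex.exp (t + θ * Complex.I) := by fun_prop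
  have hdc : Continuous fun t : ℝ =>
      fderiv ℝ ψ (Complex.exp (t + θ * Complex.I)) (Complex.exp (t + θ * Complex.I)) :=
    ((hψ.continuous_fderiv (by simp)).comp hline).clm_apply hline
  refine Eq.trans ?_ (integral_waist_eq (ε := ε) hs0 hs
    (f := fun t => ψ (Complex.exp (t + θ * Complex.I)))
    (fun t => hasDerivAt_radial hψd.differentiableAt) hdc)
  refine setIntegral_congr_fun measurableSet_Ioo fun t _ => ?_
  set z := Complex.exp (t + θ * Complex.I) with hz
  have hz0 : z ≠ 0 := Complex.exp_ne_zero _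
  have hLz : L z = t := by simp only [hL, hz, Complex.norm_exp, Real.log_exp]; simp
  have hnz : Real.exp (2 * t) = Complex.normSq z := (normSq_exp t θ).symm
  have hn0 : Complex.normSq z ≠ 0 := (Complex.normSq_pos.2 hz0).ne'
  have hVz : Real.exp (2 * t) * V z = 2 / Real.cosh t ^ 2 := by
    simp only [hV, ← hnz]
    exact exp_mul_potential t
  have e1 : Real.exp (2 * t) * g₁ z = waistJacobiDeriv t ^ 2 := by
    simp only [hg₁, hLz, hnz]
    simp only [mul_one, Complex.mul_I_re, Complex.inv_re, Complex.inv_im]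
    have := Complex.normSq_apply z
    field_simp
    rw [this]
    ring
  have e2 : Real.exp (2 * t) * g₂ z = waistJacobiDeriv t * fderiv ℝ ψ z z := by
    rw [clm_apply_eq_re_im (fderiv ℝ ψ z) z]
    simp only [hg₂, hLz, hnz, smul_eq_mul]
    simp only [mul_one, Complex.mul_I_re, Complex.inv_re, Complex.inv_im]
    field_simp
  simp only [hE, hLz]
  rw [← e1, ← hVz, show waistJacobiDeriv t * fderiv ℝ ψ z z = Real.exp (2 * t) * g₂ z from e2.symm]
  ring

/-- A connected domain that properly contains the waist between the zeros of the Jacobi function is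
unstable: the Jacobi function, extended by zero, has vanishing second variation, and since it has a
corner at the boundary the second variation becomes negative under a perturbation there. -/
theorem not_isStableOn_catenoid {c s : ℝ} (hc : c ≠ 0) (hs0 : 0 < s)
    (hs : s * Real.sinh s = Real.cosh s) {D : Set ℂ} (hD : IsOpen D) (hDc : IsPreconnected D)
    (hWD : annulusDomain (Real.exp (-s)) (Real.exp s) ⊂ D) (hD0 : D ⊆ {0}ᶜ) :
    ¬ IsStableOn (catenoid c) D := by
  rw [isStableOn_catenoid_iff hc hD hD0]
  intro hstable
  have hpi := Real.pi_pos
  obtain ⟨p, hpD, hps⟩ := exists_mem_abs_log_norm_eq hs0 hDc hWD hD0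
  have hp0 : p ≠ 0 := hD0 hpD
  obtain ⟨ψ, hψD, hψc, hψ, hψr, hψp⟩ :=
    exists_contDiff_tsupport_subset (n := ⊤) (hD.mem_nhds hpD)
  have hψ0 : ∀ z, 0 ≤ ψ z := fun z => (hψr (mem_range_self z)).1
  have key : ∀ ε : ℝ, _ := fun ε => neg_sq_mul_integral_le (ε := ε) hs0 hs hD hWD.1 hstable hψ hψc hψD
  set Q := ∫ z in D, jacobiDensity ψ z
  set f : ℝ → ℝ := fun θ => ψ (Complex.exp (s + θ * Complex.I)) +
    ψ (Complex.exp ((-s : ℝ) + θ * Complex.I)) with hf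
  have hfc : Continuous f := by
    have h1 : Continuous fun θ : ℝ => Complex.exp (s + θ * Complex.I) := by fun_prop
    have h2 : Continuous fun θ : ℝ => Complex.exp ((-s : ℝ) + θ * Complex.I) := by fun_prop
    exact (hψ.continuous.comp h1).add (hψ.continuous.comp h2)
  have hf0 : ∀ θ, 0 ≤ f θ := fun θ => add_nonneg (hψ0 _) (hψ0 _)
  have hfp : 0 < f p.arg := by
    have hpe : Complex.exp ((Real.log ‖p‖ : ℝ) + p.arg * Complex.I) = p := Complex.exp_log hp0
    rcases abs_eq hs0.le |>.1 hps with h | h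
    · rw [h] at hpe
      simp only [hf, hpe, hψp]
      linarith [hψ0 (Complex.exp ((-s : ℝ) + p.arg * Complex.I))]
    · rw [h] at hpe
      simp only [hf, hpe, hψp]
      linarith [hψ0 (Complex.exp (s + p.arg * Complex.I))]
  have hI : 0 < ∫ θ in -Real.pi..Real.pi, f θ :=
    intervalIntegral.integral_pos (by linarith) hfc.continuousOn (fun θ _ => hf0 θ)
      ⟨p.arg, ⟨(Complex.neg_pi_lt_arg p).le, Complex.arg_le_pi p⟩, hfp⟩
  rw [intervalIntegral.integral_of_le (by linarith), integral_Ioc_eq_integral_Ioo] at hI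
  have hβ : ∫ θ in Ioo (-Real.pi) Real.pi, waistJacobiDeriv s * f θ < 0 := by
    rw [integral_const_mul]
    exact mul_neg_of_neg_of_pos (waistJacobiDeriv_neg_of_pos hs0) hI
  set β := ∫ θ in Ioo (-Real.pi) Real.pi, waistJacobiDeriv s * f θ with hβdef
  have hQ : 0 < |Q| + 1 := by positivity
  have hε : 0 < -β / (|Q| + 1) := div_pos (by linarith) hQ
  have h1 := key (-β / (|Q| + 1))
  change -((-β / (|Q| + 1)) ^ 2 * Q) ≤ 2 * (-β / (|Q| + 1)) * β at h1
  set ε := -β / (|Q| + 1) with hεdef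
  have h2 : ε * (|Q| + 1) = -β := div_mul_cancel₀ _ hQ.ne'
  have h3 : -(ε * Q) ≤ 2 * β := by
    refine le_of_mul_le_mul_left ?_ hε
    linarith
  have h4 := mul_le_mul_of_nonneg_left (le_abs_self Q) hε.le
  linarith

/-! ### The marginally stable waist -/

/-- The marginally stable waist is the one whose ends are the zeros of the Jacobi function. -/
theorem isMarginallyStableWaist_iff {h s c : ℝ} (hh : 0 < h) (hs0 : 0 < s)
    (hs : s * Real.sinh s = Real.cosh s) : IsMarginallyStableWaist h c ↔ c = h / s := by
  have hss : ∀ {T T' : ℝ}, T < T' →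
      annulusDomain (Real.exp (-T)) (Real.exp T) ⊆
        annulusDomain (Real.exp (-T')) (Real.exp T') := fun hTT z hz =>
    ⟨(Real.exp_lt_exp.2 (by linarith)).trans hz.1, hz.2.trans (Real.exp_lt_exp.2 hTT)⟩
  have hssub : ∀ {T T' : ℝ}, 0 < T → T < T' →
      annulusDomain (Real.exp (-T)) (Real.exp T) ⊂
        annulusDomain (Real.exp (-T')) (Real.exp T') := by
    intro T T' hT hTT
    refine ⟨hss hTT, fun hsup => ?_⟩
    have hmem : (Real.exp T : ℂ) ∈ annulusDomain (Real.exp (-T')) (Real.exp T') := by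
      constructor <;> rw [Complex.norm_real, Real.norm_of_nonneg (Real.exp_pos T).le]
      · exact Real.exp_lt_exp.2 (by linarith)
      · exact Real.exp_lt_exp.2 hTT
    have := (hsup hmem).2
    rw [Complex.norm_real, Real.norm_of_nonneg (Real.exp_pos T).le] at this
    exact lt_irrefl _ this
  have hpre : ∀ T : ℝ, IsPreconnected (annulusDomain (Real.exp (-T)) (Real.exp T)) := fun T =>
    isPreconnected_annulusDomain (Real.exp_pos _) (Real.exp_pos _)
  have h0 : ∀ T : ℝ, annulusDomain (Real.exp (-T)) (Real.exp T) ⊆ {0}ᶜ := fun T z hz =>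
    annulusDomain_exp_ne_zero hz
  constructor
  · rintro ⟨hc, hst, hun⟩
    have hT : 0 < h / c := div_pos hh hc
    rcases lt_trichotomy (h / c) s with hlt | heq | hgt
    · exact absurd (isStableOn_catenoid hc.ne' hs hs0 le_rfl)
        (hun _ (isOpen_annulusDomain _ _) (hpre s) (hssub hT hlt) (h0 s))
    · rw [← heq]
      field_simp
    · exact absurd hst (not_isStableOn_catenoid hc.ne' hs0 hs (isOpen_annulusDomain _ _) (hpre _)
        (hssub hs0 hgt) (h0 _))
  · rintro rfl
    have hc : 0 < h / s := div_pos hh hs0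
    have hT : h / (h / s) = s := by field_simp
    refine ⟨hc, ?_, fun D hD hDc hWD hD0 => ?_⟩
    · rw [waistDomain, hT]
      exact isStableOn_catenoid hc.ne' hs hs0 le_rfl
    · rw [waistDomain, hT] at hWD
      exact not_isStableOn_catenoid hc.ne' hs0 hs hD hDc hWD hD0

/-! ### Area minimization in the slab -/

lemma waistArea_nonneg (h : ℝ) {T : ℝ} (hT : 0 ≤ T) : 0 ≤ waistArea h T :=
  intervalIntegral.integral_nonneg (by linarith) fun _ _ => by
    have := Real.pi_pos
    positivity

/-- The area of a minimal annulus of degree one is at least that of the marginally stable waist, and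
equality holds only for injective parametrizations of horizontal translates of it. -/
theorem IsMinimalAnnulusOfDegree.ofReal_waistArea_le_area {h s S₀ S₁ : ℝ} {G : ℂ → E3} (hh : 0 < h)
    (hs0 : 0 < s) (hs : s * Real.sinh s = Real.cosh s)
    (hG : IsMinimalAnnulusOfDegree h 1 S₀ S₁ G) :
    ENNReal.ofReal (waistArea h s) ≤ area S₀ S₁ G ∧
    (area S₀ S₁ G ≤ ENNReal.ofReal (waistArea h s) → ∃ v : E3, v 2 = 0 ∧
      InjOn G (annulusDomain S₀ S₁) ∧ G '' annulusDomain S₀ S₁ = (fun p => p + v) ''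
        (catenoid (h / s) '' annulusDomain (Real.exp (-s)) (Real.exp s))) := by
  by_cases hfin : area S₀ S₁ G = ⊤
  · rw [hfin]
    exact ⟨le_top, fun hle => absurd hle (not_le.2 ENNReal.ofReal_lt_top)⟩
  obtain ⟨c, T, α, hT, hS₀, hS₁, hαT, hα, hx, hle, heq⟩ := hG.waistArea_le hh hfin
  by_cases hTs : T = s
  · subst hTs
    refine ⟨hle, fun hge => ?_⟩
    obtain ⟨κ, hκ, hκ0, hg⟩ := heq hge
    have hα0 : α ≠ 0 := by
      rintro rfl
      simp at hαT
      exact hh.ne hαT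
    obtain ⟨v, hv, hGv⟩ := hG.1.eq_catenoid_add (fun z hz => (hG.2.1 z hz).1) hα0 hα hx hκ hκ0 hg
    have h₀ := hG.1.inner_pos
    have hαe : h / T = |α| := by rw [← hαT, mul_div_assoc, div_self hT.ne', mul_one]
    rw [hαe]
    exact ⟨v, hv, injOn_and_image_of_eq_catenoid h₀ (h₀.trans hG.1.inner_lt_outer) hS₀ hS₁ hα0 hκ
      hκ0 hGv⟩
  · have hlt := waistArea_lt hh hs0 hs hT hTs
    have hlt' : ENNReal.ofReal (waistArea h s) < ENNReal.ofReal (waistArea h T) :=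
      (ENNReal.ofReal_lt_ofReal_iff ((waistArea_nonneg h hs0.le).trans_lt hlt)).2 hlt
    exact ⟨hlt'.le.trans hle, fun hge => absurd (hle.trans hge) (not_le.2 hlt')⟩

theorem mainTheorem9 (h : ℝ) (hh : 0 < h) (k : ℤ) (hk : k ≠ 0) :
    (∃! c : ℝ, IsMarginallyStableWaist h c) ∧
    ∀ c : ℝ, IsMarginallyStableWaist h c →
      ∃ ρ₀ ρ₁ : ℝ,
        IsPowerCover k ρ₀ ρ₁ (fun z => catenoid c (z ^ k))
          (Real.exp (-(h / c))) (Real.exp (h / c)) (catenoid c) ∧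
        IsCoverAnnulus h k ρ₀ ρ₁ (fun z => catenoid c (z ^ k)) ∧
        area ρ₀ ρ₁ (fun z => catenoid c (z ^ k)) ≠ ⊤ ∧
        ∀ (R₀ R₁ : ℝ) (F : ℂ → E3), IsCoverAnnulus h k R₀ R₁ F →
          area ρ₀ ρ₁ (fun z => catenoid c (z ^ k)) ≤ area R₀ R₁ F ∧
          (area R₀ R₁ F = area ρ₀ ρ₁ (fun z => catenoid c (z ^ k)) ↔
            IsCoverOfWaist h c k R₀ R₁ F) := by
  obtain ⟨s, hs0, hs⟩ := exists_mul_sinh_eq_cosh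
  refine ⟨⟨h / s, (isMarginallyStableWaist_iff hh hs0 hs).2 rfl,
    fun c hc => (isMarginallyStableWaist_iff hh hs0 hs).1 hc⟩, fun c hc => ?_⟩
  obtain rfl := (isMarginallyStableWaist_iff hh hs0 hs).1 hc
  have hc0 : 0 < h / s := div_pos hh hs0
  have hT : h / (h / s) = s := by field_simp
  have hpc := isPowerCover_catenoid (h / s) (T := s) hk
  have hdeg := isMinimalAnnulusOfDegree_catenoid_zpow hh hc0 hk
  have hdeg1 := isMinimalAnnulusOfDegree_catenoid_zpow hh hc0 one_ne_zero
  simp only [Int.cast_one, abs_one, mul_one, zpow_one, hT] at hdeg1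
  rw [← div_div, hT] at hdeg
  have hk0 : ENNReal.ofReal |(k : ℝ)| ≠ 0 := by
    rw [Ne, ENNReal.ofReal_eq_zero, not_le]
    exact abs_pos.2 (by exact_mod_cast hk)
  have hcover : ∀ {R₀ R₁ S₀ S₁ : ℝ} {F G : ℂ → E3}, IsMinimalAnnulus h R₀ R₁ F →
      IsMinimalAnnulus h S₀ S₁ G → IsPowerCover k R₀ R₁ F S₀ S₁ G →
      area R₀ R₁ F = ENNReal.ofReal |(k : ℝ)| * area S₀ S₁ G := fun hF hG hFG =>
    area_of_isPowerCover hk hF.inner_pos hF.inner_lt_outer hG.inner_pos hG.inner_lt_outer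
      hF.contDiffOn hG.contDiffOn hFG
  have hwaist : area (Real.exp (-s)) (Real.exp s) (catenoid (h / s)) =
      ENNReal.ofReal (waistArea h s) := area_catenoid (h / s) hs0
  have harea := hcover hdeg.1 hdeg1.1 hpc
  refine ⟨_, _, by rw [hT]; exact hpc, ⟨hdeg, _, _, _, hdeg1, hpc⟩, ?_, fun R₀ R₁ F hF => ?_⟩
  · rw [harea, hwaist]
    exact ENNReal.mul_ne_top ENNReal.ofReal_ne_top ENNReal.ofReal_ne_top
  · rw [harea, hwaist]
    obtain ⟨hF, S₀, S₁, G, hG, hFG⟩ := hF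
    have hGarea := hG.ofReal_waistArea_le_area hh hs0 hs
    refine ⟨by rw [hcover hF.1 hG.1 hFG]; exact mul_le_mul_right hGarea.1 _, fun heq => ?_, ?_⟩
    · rw [hcover hF.1 hG.1 hFG, ENNReal.mul_right_inj hk0 ENNReal.ofReal_ne_top] at heq
      obtain ⟨v, hv, hinj, himg⟩ := hGarea.2 heq.le
      exact ⟨v, S₀, S₁, G, hv, hG, hinj, by rw [waistDomain, hT]; exact himg, hFG⟩
    · rintro ⟨v, S₀', S₁', G', -, hG', hinj, himg, hFG'⟩
      rw [waistDomain, hT] at himg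
      rw [hcover hF.1 hG'.1 hFG', area_eq_of_injOn_of_image_eq hc0
        (fun z hz => (hG'.1.conformal z hz).differentiableAt) hinj himg, hwaist]

end
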